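/- **Theorem 2.5.** *Geometry.* Let $0<s<\tfrac13$ and let $p_0,p_1,p_2\in\mathbb R^2$ be the vertices of a unit equilateral triangle. For $0\le i\le j\le 2$ let $\phi_{ij}(x)=sx+(1-s)\frac{p_i+p_j}{2}$ (six similitudes, $\phi_{ij}=\phi_{ji}$). For each ordered pair $i\ne j$ let $I_{ij}$ be the segment from $\phi_{ii}(p_j)$ to $\phi_{ij}(p_i)$, and let $\mathrm{SG}$ be the (inverted) Sierpinski gasket with vertices $\phi_{12}(p_0),\phi_{02}(p_1),\phi_{01}(p_2)$. Let $J$ consist of the six segments $I_{ij}$ and $\mathrm{SG}$. The hybrid $\mathrm H$ is the unique non-empty compact set with $\mathrm H=\bigcup_{i\le j}\phi_{ij}(\mathrm H)\cup\bigcup_{K\in J}K$. For a word $\alpha\in\mathcal A_n$ of length $n$ in the six labels let $\phi_\alpha$ be the corresponding composition ($\phi_\emptyset=\mathrm{id}$); $\phi_\alpha(\mathrm H)$ is called an $n$-cell. *The form $\mathcal E$.* Let $0<r<\frac7{15}$ and $$R=\frac{30}{9-31r+\sqrt{81+r(61r-138)}}.$$ For $n\ge0$ let $\mathcal E_n(u,v)=\sum_{\{x,y\}}\frac1{r_n(x,y)}(u(x)-u(y))(v(x)-v(y))$,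 where the sum runs over: the sides of the triangles $\phi_\alpha(\{p_0,p_1,p_2\})$, $\alpha\in\mathcal A_n$, with $r_n=Rr^n$; and, for $1\le k\le n$ and $\alpha\in\mathcal A_{k-1}$, the edges of the $(n-k)$-th dyadic subdivision of $\phi_\alpha(I_{ij})$, with $r_n=r^{k-1}2^{-(n-k)}$, and the edges of the $(n-k)$-th graph approximation of $\phi_\alpha(\mathrm{SG})$, with $r_n=r^{k-1}(3/5)^{n-k}$. Let $\operatorname{dom}\mathcal E$ be the set of continuous $u\colon\mathrm H\to\mathbb R$ for which $\lim_n\mathcal E_n(u,u)$ exists and is finite, and $\mathcal E(u,v)=\lim_n\mathcal E_n(u,v)$. *The form $\widetilde{\mathcal E}$.* Let $\mathcal E^{I}$ and $\mathcal E^{\mathrm{SG}}$ be the standard energies on a segment $I\in J$ and on $\mathrm{SG}$, i.e. the limits as $n\to\infty$ of $2^n\sum(u(x)-u(y))(v(x)-v(y))$, respectively $(5/3)^n\sum(u(x)-u(y))(v(x)-v(y))$, over the edges of the $n$-th graph approximation. Let $\widetilde{\mathcal F}_n$ be the set of $u\in\operatorname{dom}\mathcal E$ that are constant on every $n$-cell.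 Let $\operatorname{dom}\widetilde{\mathcal E}$ be the set of $u\in\operatorname{dom}\mathcal E$ for which there is a sequence $(u_n)$ in $\bigcup_{m\ge1}\widetilde{\mathcal F}_m$ with $\mathcal E(u-u_n,u-u_n)\to0$ and $u_n(x)\to u(x)$ for every $x\in\mathrm H$, and let $$\widetilde{\mathcal E}(u,v)=\sum_{k=0}^\infty\sum_{\alpha\in\mathcal A_k}\frac1{r^k}\Big(\sum_{I\in J}\mathcal E^{I}\big((u\circ\phi_\alpha)|_I,(v\circ\phi_\alpha)|_I\big)+\mathcal E^{\mathrm{SG}}\big((u\circ\phi_\alpha)|_{\mathrm{SG}},(v\circ\phi_\alpha)|_{\mathrm{SG}}\big)\Big),$$ where $I$ runs over the six segments in $J$. *Claim.* For $u,v\in\operatorname{dom}\mathcal E$ all limits and the series over $k$ above converge. $(\mathcal E,\operatorname{dom}\mathcal E)$ and $(\widetilde{\mathcal E},\operatorname{dom}\widetilde{\mathcal E})$ are resistance forms on $\mathrm H$, and they coincide: $\operatorname{dom}\mathcal E=\operatorname{dom}\widetilde{\mathcal E}$, and $\mathcal E(u,v)=\widetilde{\mathcal E}(u,v)$ for all $u,v\in\operatorname{dom}\mathcal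 E$. Here a resistance form on a set $X$ is a pair $(\mathcal E,\mathcal F)$ such that: $\mathcal F$ is a linear space of functions $X\to\mathbb R$ that contains the constants, and $\mathcal E$ is a symmetric non-negative bilinear form on $\mathcal F$ with $\mathcal E(u,u)=0$ iff $u$ is constant; $\mathcal F$ modulo constants is complete under $\mathcal E$; $\mathcal F$ separates points; $\sup\{|u(x)-u(y)|^2/\mathcal E(u,u): u\in\mathcal F,\ \mathcal E(u,u)>0\}<\infty$ for all $x,y\in X$; and for $u\in\mathcal F$, $\bar u=\min\{\max\{0,u\},1\}$ lies in $\mathcal F$ and $\mathcal E(\bar u,\bar u)\le\mathcal E(u,u)$. -/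

import Mathlib

open Set Filter Topology

noncomputable section

namespace HybridGasket

/-! ### Attractors -/

/-- A nonempty compact set `A` with `A = ⋃ i, f i (A) ∪ B`. -/
def IsAttractor {E ι : Type*} [TopologicalSpace E] (f : ι → E → E) (B A : Set E) : Prop :=
  A.Nonempty ∧ IsCompact A ∧ A = (⋃ i, f i '' A) ∪ B

theorem existsUnique_isAttractor {E ι : Type*} [MetricSpace E] [CompleteSpace E] [Nonempty E]
    [Finite ι] [Nonempty ι] (f : ι → E → E) (B : Set E) (K : NNReal) (hK : K < 1)
    (hf : ∀ i, LipschitzWith K (f i)) (hB : IsCompact B) : ∃! A, IsAttractor f B A := by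
  classical
  let Φ : TopologicalSpace.NonemptyCompacts E → TopologicalSpace.NonemptyCompacts E := fun A =>
    ⟨⟨(⋃ i, f i '' (A : Set E)) ∪ B,
      (isCompact_iUnion fun i => A.isCompact.image (hf i).continuous).union hB⟩, by
      obtain ⟨x, hx⟩ := A.nonempty
      obtain ⟨i⟩ := ‹Nonempty ι›
      exact ⟨f i x, Or.inl (mem_iUnion.2 ⟨i, mem_image_of_mem _ hx⟩)⟩⟩
  have hΦ : ∀ A, ((Φ A : TopologicalSpace.NonemptyCompacts E) : Set E)
      = (⋃ i, f i '' (A : Set E)) ∪ B := fun _ => rfl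
  have key : ∀ A A' : TopologicalSpace.NonemptyCompacts E, ∀ x ∈ (Φ A : Set E),
      Metric.infEDist x (Φ A' : Set E) ≤ K * Metric.hausdorffEDist (A : Set E) A' := by
    intro A A' x hx
    rw [hΦ] at hx
    rcases hx with hx | hx
    · obtain ⟨i, a, ha, rfl⟩ := mem_iUnion.1 hx
      obtain ⟨b, hb, hab⟩ := A'.isCompact.exists_infEDist_eq_edist A'.nonempty a
      have hmem : f i b ∈ (Φ A' : Set E) := by
        rw [hΦ]; exact Or.inl (mem_iUnion.2 ⟨i, mem_image_of_mem _ hb⟩)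
      calc Metric.infEDist (f i a) (Φ A' : Set E) ≤ edist (f i a) (f i b) :=
            Metric.infEDist_le_edist_of_mem hmem
        _ ≤ K * edist a b := hf i a b
        _ = K * Metric.infEDist a A' := by rw [hab]
        _ ≤ K * Metric.hausdorffEDist (A : Set E) A' := by
            gcongr
            exact Metric.infEDist_le_hausdorffEDist_of_mem ha
    · have : x ∈ (Φ A' : Set E) := by rw [hΦ]; exact Or.inr hx
      rw [Metric.infEDist_zero_of_mem this]
      exact zero_le
  have hc : ContractingWith K Φ := by
    refine ⟨hK, fun A A' => ?_⟩
    change Metric.hausdorffEDist (Φ A : Set E) (Φ A') ≤ K * Metric.hausdorffEDist (A : Set E) A'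
    refine Metric.hausdorffEDist_le_of_infEDist (key A A') fun x hx => ?_
    rw [Metric.hausdorffEDist_comm]
    exact key A' A x hx
  have : Nonempty (TopologicalSpace.NonemptyCompacts E) := by
    obtain ⟨x⟩ := ‹Nonempty E›
    exact ⟨⟨⟨{x}, isCompact_singleton⟩, singleton_nonempty x⟩⟩
  refine ⟨((ContractingWith.fixedPoint Φ hc : TopologicalSpace.NonemptyCompacts E) : Set E),
    ⟨(ContractingWith.fixedPoint Φ hc).nonempty, (ContractingWith.fixedPoint Φ hc).isCompact, ?_⟩,
    fun A hA => ?_⟩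
  · conv_lhs => rw [← hc.fixedPoint_isFixedPt.eq]
    exact hΦ _
  · have h : Function.IsFixedPt Φ ⟨⟨A, hA.2.1⟩, hA.1⟩ :=
      SetLike.coe_injective (show (⋃ i, f i '' A) ∪ B = A from hA.2.2.symm)
    exact congrArg (fun T : TopologicalSpace.NonemptyCompacts E => (T : Set E))
      (hc.fixedPoint_unique h)

open Classical in
/-- The attractor of a family of maps `f` with condensation set `B`: the nonempty compact set `A`
with `A = ⋃ i, f i (A) ∪ B`, unique when `f` is a finite nonempty family of contractions and `B`
is compact (and the empty set, by convention, if there is none). -/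
def attractor {E ι : Type*} [TopologicalSpace E] (f : ι → E → E) (B : Set E) : Set E :=
  if h : ∃ A, IsAttractor f B A then h.choose else ∅

theorem isAttractor_attractor {E ι : Type*} [MetricSpace E] [CompleteSpace E] [Nonempty E]
    [Finite ι] [Nonempty ι] (f : ι → E → E) (B : Set E) (K : NNReal) (hK : K < 1)
    (hf : ∀ i, LipschitzWith K (f i)) (hB : IsCompact B) : IsAttractor f B (attractor f B) := by
  have h : ∃ A, IsAttractor f B A := (existsUnique_isAttractor f B K hK hf hB).exists
  rw [attractor, dif_pos h]
  exact h.choose_spec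

/-! ### The plane geometry -/

abbrev Plane : Type := EuclideanSpace ℝ (Fin 2)

/-- The vertices of the unit equilateral triangle. -/
def vertex : Fin 3 → Plane := ![!₂[0, 0], !₂[1, 0], !₂[1 / 2, √3 / 2]]

/-- The labels of the six triangular cells of the first level: `s(i, i)` is the cell at the corner
`i`, and `s(i, j)`, `i ≠ j`, is the cell in the middle of the edge `ij`. -/
abbrev Letter : Type := Sym2 (Fin 3)

/-- The fixed point of the similitude with a given label. -/
def center : Letter → Plane :=
  Sym2.lift ⟨fun i j => midpoint ℝ (vertex i) (vertex j), fun _ _ => midpoint_comm _ _⟩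

/-- The six similitudes of ratio `s`. -/
def simil (s : ℝ) (l : Letter) (x : Plane) : Plane := s • x + (1 - s) • center l

/-- Ordered pairs `(i, j)`, `i ≠ j`, labelling the six intervals of the first generation. -/
abbrev Joint : Type := {e : Fin 3 × Fin 3 // e.1 ≠ e.2}

/-- The two endpoints of the interval `(i, j)`, which lies on the edge `ij` of the triangle and
joins the cell at the corner `i` to the cell in the middle of that edge. -/
def jointEnd (s : ℝ) (e : Joint) : Fin 2 → Plane :=
  ![simil s s(e.1.1, e.1.1) (vertex e.1.2), simil s s(e.1.1, e.1.2) (vertex e.1.1)]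

/-- The intervals of the first generation. -/
def interval (s : ℝ) (e : Joint) : Set Plane := segment ℝ (jointEnd s e 0) (jointEnd s e 1)

/-- The three vertices of the inverted gasket: the `k`-th one is the vertex with index `k` of the
cell in the middle of the edge opposite to `k`. -/
def gasketVertex (s : ℝ) (k : Fin 3) : Plane := simil s s(k + 1, k + 2) (vertex k)

def gasketMap (s : ℝ) (k : Fin 3) (x : Plane) : Plane := midpoint ℝ x (gasketVertex s k)

/-- The inverted Sierpinski gasket of the first generation. -/
def gasket (s : ℝ) : Set Plane := attractor (gasketMap s) ∅

/-- The union of all intervals and inverted gaskets of the first generation. -/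
def bonds (s : ℝ) : Set Plane := (⋃ e, interval s e) ∪ gasket s

/-- The hybrid fractal. -/
def hybrid (s : ℝ) : Set Plane := attractor (simil s) (bonds s)

/-- Admissible contraction ratios: the six cells of side `s` are pairwise disjoint, the three
along an edge being separated by gaps of length `(1 - 3 * s) / 2`. -/
abbrev Ratio : Type := Set.Ioo (0 : ℝ) (1 / 3)

theorem lipschitzWith_gasketMap (s : ℝ) (k : Fin 3) : LipschitzWith (1 / 2) (gasketMap s k) := by
  refine LipschitzWith.of_dist_le_mul fun x y => le_of_eq ?_
  have h : gasketMap s k x - gasketMap s k y = (1 / 2 : ℝ) • (x - y) := by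
    simp only [gasketMap, midpoint_eq_smul_add, invOf_eq_inv]
    module
  rw [dist_eq_norm, h, norm_smul, dist_eq_norm]
  norm_num

theorem lipschitzWith_simil (s : Ratio) (l : Letter) :
    LipschitzWith (Real.toNNReal s) (simil s l) := by
  refine LipschitzWith.of_dist_le_mul fun x y => le_of_eq ?_
  have h : simil s l x - simil s l y = (s : ℝ) • (x - y) := by
    simp only [simil]
    module
  rw [dist_eq_norm, h, norm_smul, dist_eq_norm, Real.norm_of_nonneg s.2.1.le,
    Real.coe_toNNReal _ s.2.1.le]

theorem toNNReal_ratio_lt_one (s : Ratio) : Real.toNNReal s < 1 :=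
  Real.toNNReal_lt_one.2 (s.2.2.trans (by norm_num))

theorem fixed_mem {E : Type*} [MetricSpace E] [CompleteSpace E] {f : E → E} {K : NNReal}
    (hK : K < 1) (hf : LipschitzWith K f) {A : Set E} (hA : A.Nonempty) (hc : IsClosed A)
    (hm : ∀ x ∈ A, f x ∈ A) {p : E} (hp : f p = p) : p ∈ A := by
  obtain ⟨a, ha⟩ := hA
  have : Nonempty E := ⟨a⟩
  have hC : ContractingWith K f := ⟨hK, hf⟩
  have ht := hC.tendsto_iterate_fixedPoint a
  rw [← hC.fixedPoint_unique (x := p) hp] at ht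
  refine hc.mem_of_tendsto ht (Eventually.of_forall fun n => ?_)
  induction n with
  | zero => exact ha
  | succ n ih => rw [Function.iterate_succ_apply']; exact hm _ ih

theorem isAttractor_gasket (s : ℝ) : IsAttractor (gasketMap s) ∅ (gasket s) :=
  isAttractor_attractor _ _ (1 / 2) (by rw [← NNReal.coe_lt_coe]; norm_num)
    (lipschitzWith_gasketMap s) isCompact_empty

theorem gasketMap_mem (s : ℝ) (k : Fin 3) {x : Plane} (hx : x ∈ gasket s) :
    gasketMap s k x ∈ gasket s := by
  rw [(isAttractor_gasket s).2.2]
  exact Or.inl (mem_iUnion.2 ⟨k, mem_image_of_mem _ hx⟩)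

theorem gasketVertex_mem (s : ℝ) (k : Fin 3) : gasketVertex s k ∈ gasket s :=
  fixed_mem (by rw [← NNReal.coe_lt_coe]; norm_num) (lipschitzWith_gasketMap s k)
    (isAttractor_gasket s).1 (isAttractor_gasket s).2.1.isClosed
    (fun _ hx => gasketMap_mem s k hx) (by simp [gasketMap])

theorem isCompact_bonds (s : ℝ) : IsCompact (bonds s) := by
  refine (isCompact_iUnion fun e => ?_).union (isAttractor_gasket s).2.1
  rw [interval, ← convexHull_pair]
  exact (Set.toFinite _).isCompact_convexHull ℝ

theorem isAttractor_hybrid (s : Ratio) : IsAttractor (simil s) (bonds s) (hybrid s) :=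
  isAttractor_attractor _ _ (Real.toNNReal s)
    (toNNReal_ratio_lt_one s)
    (lipschitzWith_simil s) (isCompact_bonds s)

theorem simil_mem (s : Ratio) (l : Letter) {x : Plane} (hx : x ∈ hybrid s) :
    simil s l x ∈ hybrid s := by
  rw [(isAttractor_hybrid s).2.2]
  exact Or.inl (mem_iUnion.2 ⟨l, mem_image_of_mem _ hx⟩)

theorem bonds_subset (s : Ratio) : bonds s ⊆ hybrid s := by
  intro x hx
  rw [(isAttractor_hybrid s).2.2]
  exact Or.inr hx

theorem interval_subset (s : Ratio) (e : Joint) : interval s e ⊆ hybrid s :=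
  ((subset_iUnion (interval (s : ℝ)) e).trans subset_union_left).trans (bonds_subset s)

theorem gasket_subset (s : Ratio) : gasket s ⊆ hybrid s :=
  subset_union_right.trans (bonds_subset s)

theorem vertex_mem (s : Ratio) (k : Fin 3) : vertex k ∈ hybrid s :=
  fixed_mem (toNNReal_ratio_lt_one s)
    (lipschitzWith_simil s s(k, k))
    (isAttractor_hybrid s).1 (isAttractor_hybrid s).2.1.isClosed
    (fun _ hx => simil_mem s _ hx) (by
      simp only [simil, center, Sym2.lift_mk, midpoint_self]
      module)

theorem jointEnd_mem (s : ℝ) (e : Joint) (j : Fin 2) : jointEnd s e j ∈ interval s e := by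
  fin_cases j
  · exact left_mem_segment ℝ _ _
  · exact right_mem_segment ℝ _ _

theorem midpoint_jointEnd_mem (s : ℝ) (e : Joint) (j : Fin 2) {x : Plane} (hx : x ∈ interval s e) :
    midpoint ℝ x (jointEnd s e j) ∈ interval s e :=
  (convex_segment _ _).midpoint_mem hx (jointEnd_mem s e j)

/-! ### The pieces as self-similar spaces, with their boundary points -/

/-- The map `φ_l` of the hybrid into itself. -/
def cellMap (s : Ratio) (l : Letter) (x : hybrid s) : hybrid s := ⟨simil s l x, simil_mem s l x.2⟩

/-- The boundary `V₀` of the hybrid. -/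
def corner (s : Ratio) (k : Fin 3) : hybrid s := ⟨vertex k, vertex_mem s k⟩

/-- The two maps of ratio `1 / 2` that generate an interval. -/
def intervalHalf (s : ℝ) (e : Joint) (j : Fin 2) (x : interval s e) : interval s e :=
  ⟨midpoint ℝ x.1 (jointEnd s e j), midpoint_jointEnd_mem s e j x.2⟩

def intervalBdry (s : ℝ) (e : Joint) (j : Fin 2) : interval s e := ⟨jointEnd s e j, jointEnd_mem s e j⟩

/-- The three maps of ratio `1 / 2` that generate the inverted gasket. -/
def gasketHalf (s : ℝ) (k : Fin 3) (x : gasket s) : gasket s :=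
  ⟨gasketMap s k x, gasketMap_mem s k x.2⟩

def gasketBdry (s : ℝ) (k : Fin 3) : gasket s := ⟨gasketVertex s k, gasketVertex_mem s k⟩

/-- Restriction to an interval of the first generation of a function on the hybrid. -/
def onInterval (s : Ratio) (e : Joint) (u : hybrid s → ℝ) : interval s e → ℝ :=
  u ∘ Set.inclusion (interval_subset s e)

/-- Restriction to the inverted gasket of the first generation of a function on the hybrid. -/
def onGasket (s : Ratio) (u : hybrid s → ℝ) : gasket s → ℝ :=
  u ∘ Set.inclusion (gasket_subset s)

/-- The composition `f_{w₁} ∘ ⋯ ∘ f_{wₙ}` for a word `w` of length `n`. -/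
def wordMap {X ι : Type*} (f : ι → X → X) : (n : ℕ) → (Fin n → ι) → X → X
  | 0, _ => id
  | n + 1, w => f (w 0) ∘ wordMap f n (Fin.tail w)

/-! ### Graph energies -/

/-- The sum of `(u x - u y) * (v x - v y)` over the edges `{x, y}` of the complete graph on the
boundary points `p 0, …, p (m - 1)`. -/
def edgeSum {X : Type*} {m : ℕ} (p : Fin m → X) (u v : X → ℝ) : ℝ :=
  ∑ a, ∑ b ∈ Finset.Ioi a, (u (p a) - u (p b)) * (v (p a) - v (p b))

/-- The sum of `(u x - u y) * (v x - v y)` over the edges `{x, y}` of all cells of level `n`. -/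
def levelSum {X ι : Type*} [Fintype ι] {m : ℕ} (f : ι → X → X) (p : Fin m → X) (n : ℕ)
    (u v : X → ℝ) : ℝ :=
  ∑ w : Fin n → ι, edgeSum p (u ∘ wordMap f n w) (v ∘ wordMap f n w)

/-- The `n`-th graph energy on the hybrid, for the graph `Γₙ` whose edges are
* the sides of the triangular cells of level `n`, with resistance `R * rH ^ n`;
* the edges of the `(n - k)`-th subdivision of the intervals born at level `k`, `1 ≤ k ≤ n`,
  with resistance `R * rH ^ (k - 1) * rI * (1 / 2) ^ (n - k)`;
* the edges of the `(n - k)`-th subdivision of the inverted gaskets born at level `k`,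
  with resistance `R * rH ^ (k - 1) * rSG * (3 / 5) ^ (n - k)`.

A bond born at level `k` is the image of one of the first generation by `φ_w`, with `w` a word of
length `k - 1`; the summation index `k` below is that length. -/
def graphEnergy (s : Ratio) (R rH rI rSG : ℝ) (n : ℕ) (u v : hybrid s → ℝ) : ℝ :=
  (R * rH ^ n)⁻¹ * levelSum (cellMap s) (corner s) n u v
  + ∑ k ∈ Finset.range n, ∑ w : Fin k → Letter,
      ((∑ e : Joint, (R * rH ^ k * rI * (1 / 2) ^ (n - (k + 1)))⁻¹ *
          levelSum (intervalHalf s e) (intervalBdry s e) (n - (k + 1))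
            (onInterval s e (u ∘ wordMap (cellMap s) k w))
            (onInterval s e (v ∘ wordMap (cellMap s) k w)))
        + (R * rH ^ k * rSG * (3 / 5) ^ (n - (k + 1)))⁻¹ *
          levelSum (gasketHalf s) (gasketBdry s) (n - (k + 1))
            (onGasket s (u ∘ wordMap (cellMap s) k w))
            (onGasket s (v ∘ wordMap (cellMap s) k w)))

/-- The resistance of the sides of the initial triangle that makes the sequence of graph energies
compatible when the bonds of the first generation have unit resistances and the scaling factor of
the triangular cells is `r`. -/
def baseResistance (r : ℝ) : ℝ := 30 / (9 - 31 * r + √(81 + r * (61 * r - 138)))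

/-- The graph energies `ℰₙ` with scaling factor `r` of the triangular cells, the edges of the
intervals and of the inverted gasket of the first generation having unit resistance. -/
def energyAt (s : Ratio) (r : ℝ) (n : ℕ) (u v : hybrid s → ℝ) : ℝ :=
  graphEnergy s (baseResistance r) r (baseResistance r)⁻¹ (baseResistance r)⁻¹ n u v

/-- The limit form `ℰ(u, v) = lim ℰₙ(u, v)`. -/
def energy (s : Ratio) (r : ℝ) (u v : hybrid s → ℝ) : ℝ :=
  limUnder atTop fun n => energyAt s r n u v

/-- `dom ℰ`: the continuous functions on the hybrid for which `lim ℰₙ(u, u)` is finite. -/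
def domEnergy (s : Ratio) (r : ℝ) : Set (hybrid s → ℝ) :=
  {u | Continuous u ∧ ∃ l : ℝ, Tendsto (fun n => energyAt s r n u u) atTop (𝓝 l)}

/-! ### Standard energies on the bonds -/

/-- The `n`-th renormalized graph energy on an interval. -/
def intervalEnergyAt (s : Ratio) (e : Joint) (n : ℕ) (u v : interval s e → ℝ) : ℝ :=
  2 ^ n * levelSum (intervalHalf s e) (intervalBdry s e) n u v

/-- The standard energy of an interval (the limit of `2 ^ n * ∑ (u x - u y) * (v x - v y)` over the
neighbours `x, y` in its `n`-th dyadic subdivision). -/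
def intervalEnergy (s : Ratio) (e : Joint) (u v : interval s e → ℝ) : ℝ :=
  limUnder atTop fun n => intervalEnergyAt s e n u v

/-- The `n`-th renormalized graph energy on the inverted gasket. -/
def gasketEnergyAt (s : Ratio) (n : ℕ) (u v : gasket s → ℝ) : ℝ :=
  (5 / 3) ^ n * levelSum (gasketHalf s) (gasketBdry s) n u v

/-- The standard energy of the inverted gasket. -/
def gasketEnergy (s : Ratio) (u v : gasket s → ℝ) : ℝ :=
  limUnder atTop fun n => gasketEnergyAt s n u v

/-! ### The form built from the bonds -/

/-- The functions of `dom ℰ` that are constant on every `n`-cell. -/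
def cellConstant (s : Ratio) (r : ℝ) (n : ℕ) : Set (hybrid s → ℝ) :=
  {u | u ∈ domEnergy s r ∧ ∀ (w : Fin n → Letter) (x y : hybrid s),
    u (wordMap (cellMap s) n w x) = u (wordMap (cellMap s) n w y)}

/-- The energy carried by the bonds born in the `k`-cells:
`∑_{w ∈ 𝒜ₖ} r⁻ᵏ (∑_I ℰ^I(u ∘ φ_w|_I, v ∘ φ_w|_I) + ℰ^SG(u ∘ φ_w|_SG, v ∘ φ_w|_SG))`. -/
def bondEnergy (s : Ratio) (r : ℝ) (k : ℕ) (u v : hybrid s → ℝ) : ℝ :=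
  ∑ w : Fin k → Letter,
    ((∑ e : Joint, (r ^ k)⁻¹ * intervalEnergy s e
        (onInterval s e (u ∘ wordMap (cellMap s) k w))
        (onInterval s e (v ∘ wordMap (cellMap s) k w)))
      + (r ^ k)⁻¹ * gasketEnergy s
        (onGasket s (u ∘ wordMap (cellMap s) k w))
        (onGasket s (v ∘ wordMap (cellMap s) k w)))

/-- The form `ℰ̃`. -/
def energyTilde (s : Ratio) (r : ℝ) (u v : hybrid s → ℝ) : ℝ := ∑' k, bondEnergy s r k u v

/-- `dom ℰ̃`: the functions of `dom ℰ` that are limits, in energy and pointwise, of functions that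
are constant on all cells of some level. -/
def domEnergyTilde (s : Ratio) (r : ℝ) : Set (hybrid s → ℝ) :=
  {u | u ∈ domEnergy s r ∧ ∃ U : ℕ → hybrid s → ℝ,
    (∀ n, ∃ m, 1 ≤ m ∧ U n ∈ cellConstant s r m) ∧
    Tendsto (fun n => energy s r (u - U n) (u - U n)) atTop (𝓝 0) ∧
    ∀ x, Tendsto (fun n => U n x) atTop (𝓝 (u x))}

/-! ### Resistance forms -/

/-- `(ℰ, F)` is a resistance form on `X`. -/
structure IsResistanceForm {X : Type*} (ℰ : (X → ℝ) → (X → ℝ) → ℝ) (F : Set (X → ℝ)) : Prop where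
  const_mem : ∀ c : ℝ, (fun _ => c) ∈ F
  add_mem : ∀ u ∈ F, ∀ v ∈ F, u + v ∈ F
  smul_mem : ∀ (c : ℝ), ∀ u ∈ F, c • u ∈ F
  symm : ∀ u ∈ F, ∀ v ∈ F, ℰ u v = ℰ v u
  add_left : ∀ u ∈ F, ∀ v ∈ F, ∀ w ∈ F, ℰ (u + v) w = ℰ u w + ℰ v w
  smul_left : ∀ (c : ℝ), ∀ u ∈ F, ∀ v ∈ F, ℰ (c • u) v = c * ℰ u v
  nonneg : ∀ u ∈ F, 0 ≤ ℰ u u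
  eq_zero_iff : ∀ u ∈ F, ℰ u u = 0 ↔ ∃ c : ℝ, u = fun _ => c
  /-- `F` modulo constants is complete. -/
  complete : ∀ U : ℕ → X → ℝ, (∀ n, U n ∈ F) →
    (∀ ε > 0, ∃ N, ∀ m ≥ N, ∀ n ≥ N, ℰ (U m - U n) (U m - U n) < ε) →
    ∃ u ∈ F, Tendsto (fun n => ℰ (U n - u) (U n - u)) atTop (𝓝 0)
  separates : ∀ x y : X, x ≠ y → ∃ u ∈ F, u x ≠ u y
  /-- The effective resistance between two points is finite. -/
  resistance_finite : ∀ x y : X,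
    BddAbove {t : ℝ | ∃ u ∈ F, 0 < ℰ u u ∧ t = |u x - u y| ^ 2 / ℰ u u}
  markov : ∀ u ∈ F, (fun x => min (max 0 (u x)) 1) ∈ F ∧
    ℰ (fun x => min (max 0 (u x)) 1) (fun x => min (max 0 (u x)) 1) ≤ ℰ u u

end HybridGasket

end

open HybridGasket

open Set Filter Topology

noncomputable section

namespace HybridGasket

/-! ### Graph forms -/

/-! Each `energyAt s r n` is a non-negative combination of squared differences. On the diagonal
these forms increase with `n`, because the base resistance R solves a network equation: series and
triangle-star reductions bound the energy of a triangle with sides R by that of the first-level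
network, whose triangles have sides Rr and whose bonds have unit resistance (`network_le`,
`networkResistance_one`). The recursion `energyAt_succ` carries the inequality to all levels, so ℰ
is a monotone limit.

Such a limit is a resistance form as soon as its finite-energy functions separate points and satisfy
|u x - u y| ≤ C √ℰ(u, u) (`IsFormSeq.isResistanceForm`). The estimate is a chaining argument:
entering a cell shrinks the root of the energy by √r, so the costs of the successive steps form a
geometric series (`abs_sub_le_of_chain`, `exists_abs_sub_corner_le`). Separation holds because
finite-energy functions, glued from cells and bonds, are uniformly dense
(`exists_finiteEnergy_near`).

For ℰ = ℰ̃, split ℰₙ into a triangle part Tₙ and the energies of the bonds; the point is that Tₙ(u,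
u) → 0. Lowering the bond resistances from 1 to 1/2 makes the equivalent resistance of the
first-level network strictly smaller than R. Hence Tₙ ≤ θ (Tₙ₊₁ + 2 bₙ) with some θ < 1, where bₙ is
the energy of the bonds born in the n-cells. The bₙ are summable and Tₙ is bounded, so iterating
towards higher levels forces Tₙ → 0 (`tendsto_triangleEnergy`). Thus ℰ(u, u) = ∑ bₖ, and
polarization gives the two-variable identity (`hasSum_bondEnergy`).

For the domains, subtract from u a function W that equals u minus a constant on each n-cell and is
harmonic on the bonds outside the n-cells. Then u - W is constant on n-cells. The energy of W is at
most the tail of the bond series plus a multiple of Tₙ, and |W| is at most the oscillation of u on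
n-cells; both tend to 0 (`exists_flattening`). -/

/-- Finite non-negative combinations of the forms `(u x - u y) * (v x - v y)`. -/
inductive IsGraphForm {X : Type*} : ((X → ℝ) → (X → ℝ) → ℝ) → Prop
  | edge (x y : X) : IsGraphForm fun u v => (u x - u y) * (v x - v y)
  | zero : IsGraphForm fun _ _ => 0
  | add {Q Q' : (X → ℝ) → (X → ℝ) → ℝ} : IsGraphForm Q → IsGraphForm Q' →
      IsGraphForm fun u v => Q u v + Q' u v
  | smul {Q : (X → ℝ) → (X → ℝ) → ℝ} (c : ℝ) : 0 ≤ c → IsGraphForm Q →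
      IsGraphForm fun u v => c * Q u v

namespace IsGraphForm

variable {X Y : Type*} {Q : (X → ℝ) → (X → ℝ) → ℝ}

theorem sum {ι : Type*} (t : Finset ι) {P : ι → (X → ℝ) → (X → ℝ) → ℝ}
    (h : ∀ i ∈ t, IsGraphForm (P i)) : IsGraphForm fun u v => ∑ i ∈ t, P i u v := by
  classical
  induction t using Finset.induction_on with
  | empty => simpa using IsGraphForm.zero
  | insert a t ha ih =>
    simp only [Finset.sum_insert ha]
    exact .add (h a (by simp)) (ih fun i hi => h i (by simp [hi]))

theorem comp (h : IsGraphForm Q) (g : X → Y) :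
    IsGraphForm fun u v : Y → ℝ => Q (u ∘ g) (v ∘ g) := by
  induction h with
  | edge x y => exact .edge (g x) (g y)
  | zero => exact .zero
  | add _ _ h₁ h₂ => exact .add h₁ h₂
  | smul c hc _ h => exact .smul c hc h

theorem symm (h : IsGraphForm Q) (u v : X → ℝ) : Q u v = Q v u := by
  induction h with
  | edge x y => ring
  | zero => rfl
  | add _ _ h₁ h₂ => simp only [h₁, h₂]
  | smul c hc _ h => simp only [h]

theorem add_left (h : IsGraphForm Q) (u v w : X → ℝ) : Q (u + v) w = Q u w + Q v w := by
  induction h with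
  | edge x y => simp only [Pi.add_apply]; ring
  | zero => simp
  | add _ _ h₁ h₂ => simp only [h₁, h₂]; ring
  | smul c hc _ h => simp only [h]; ring

theorem smul_left (h : IsGraphForm Q) (c : ℝ) (u v : X → ℝ) : Q (c • u) v = c * Q u v := by
  induction h with
  | edge x y => simp only [Pi.smul_apply, smul_eq_mul]; ring
  | zero => simp
  | add _ _ h₁ h₂ => simp only [h₁, h₂]; ring
  | smul c hc _ h => simp only [h]; ring

theorem nonneg (h : IsGraphForm Q) (u : X → ℝ) : 0 ≤ Q u u := by
  induction h with
  | edge x y => exact mul_self_nonneg _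
  | zero => exact le_rfl
  | add _ _ h₁ h₂ => exact add_nonneg h₁ h₂
  | smul c hc _ h => exact mul_nonneg hc h

theorem const_left (h : IsGraphForm Q) (c : ℝ) (v : X → ℝ) : Q (fun _ => c) v = 0 := by
  induction h with
  | edge x y => simp
  | zero => rfl
  | add _ _ h₁ h₂ => simp [h₁, h₂]
  | smul c hc _ h => simp [h]

/-- True edge by edge. It yields the Markov property and the invariance under subtracting constants.
-/
theorem contraction (h : IsGraphForm Q) {u v : X → ℝ} (huv : ∀ x y, |u x - u y| ≤ |v x - v y|) :
    Q u u ≤ Q v v := by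
  induction h with
  | edge x y =>
    simpa only [← sq] using sq_le_sq.2 (huv x y)
  | zero => exact le_rfl
  | add _ _ h₁ h₂ => exact add_le_add h₁ h₂
  | smul c hc _ h => exact mul_le_mul_of_nonneg_left h hc

/-- Only finitely many points enter a graph form, so pointwise convergence is enough. This replaces
lower semicontinuity in the completeness proof. -/
theorem tendsto (h : IsGraphForm Q) {U : ℕ → X → ℝ} {u : X → ℝ}
    (hU : ∀ x, Tendsto (fun n => U n x) atTop (𝓝 (u x))) :
    Tendsto (fun n => Q (U n) (U n)) atTop (𝓝 (Q u u)) := by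
  induction h with
  | edge x y => exact ((hU x).sub (hU y)).mul ((hU x).sub (hU y))
  | zero => exact tendsto_const_nhds
  | add _ _ h₁ h₂ => exact h₁.add h₂
  | smul c hc _ h => exact h.const_mul c

theorem add_right (h : IsGraphForm Q) (u v w : X → ℝ) : Q w (u + v) = Q w u + Q w v := by
  rw [h.symm, h.add_left, h.symm u, h.symm v]

theorem smul_right (h : IsGraphForm Q) (c : ℝ) (u v : X → ℝ) : Q u (c • v) = c * Q u v := by
  rw [h.symm, h.smul_left, h.symm v]

theorem smul_self (h : IsGraphForm Q) (c : ℝ) (u : X → ℝ) : Q (c • u) (c • u) = c ^ 2 * Q u u := by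
  rw [h.smul_left, h.smul_right]; ring

theorem sub_const (h : IsGraphForm Q) (u : X → ℝ) (c : ℝ) :
    Q (fun x => u x - c) (fun x => u x - c) = Q u u :=
  le_antisymm (h.contraction fun x y => by simp) (h.contraction fun x y => by simp)

theorem add_self_add_sub_self (h : IsGraphForm Q) (u v : X → ℝ) :
    Q (u + v) (u + v) + Q (u - v) (u - v) = 2 * Q u u + 2 * Q v v := by
  have e : u - v = u + (-1 : ℝ) • v := by module
  rw [e, h.add_left, h.add_right, h.add_right, h.add_left, h.add_right, h.add_right,
    h.smul_left, h.smul_left, h.smul_right, h.smul_right]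
  ring

theorem add_self_le (h : IsGraphForm Q) (u v : X → ℝ) :
    Q (u + v) (u + v) ≤ 2 * Q u u + 2 * Q v v := by
  have := h.add_self_add_sub_self u v
  have := h.nonneg (u - v)
  linarith

theorem polarization (h : IsGraphForm Q) (u v : X → ℝ) :
    Q u v = (Q (u + v) (u + v) - Q (u - v) (u - v)) / 4 := by
  have e : u - v = u + (-1 : ℝ) • v := by module
  rw [e, h.add_left, h.add_right, h.add_right, h.add_left, h.add_right, h.add_right,
    h.smul_left, h.smul_left, h.smul_right, h.smul_right, h.symm v u]
  ring

end IsGraphForm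

/-! ### Monotone sequences of graph forms -/

/-- A monotone sequence of graph forms. -/
structure IsFormSeq {X : Type*} (Q : ℕ → (X → ℝ) → (X → ℝ) → ℝ) : Prop where
  graph : ∀ n, IsGraphForm (Q n)
  mono : ∀ n u, Q n u u ≤ Q (n + 1) u u

/-- Functions of finite energy with respect to a sequence of forms. -/
def FiniteEnergy {X : Type*} (Q : ℕ → (X → ℝ) → (X → ℝ) → ℝ) (u : X → ℝ) : Prop :=
  ∃ M, ∀ n, Q n u u ≤ M

/-- The limit of a sequence of forms. -/
def limForm {X : Type*} (Q : ℕ → (X → ℝ) → (X → ℝ) → ℝ) (u v : X → ℝ) : ℝ :=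
  limUnder atTop fun n => Q n u v

namespace IsFormSeq

variable {X : Type*} {Q : ℕ → (X → ℝ) → (X → ℝ) → ℝ}

theorem finiteEnergy_add (h : IsFormSeq Q) {u v : X → ℝ} (hu : FiniteEnergy Q u)
    (hv : FiniteEnergy Q v) : FiniteEnergy Q (u + v) := by
  obtain ⟨M, hM⟩ := hu
  obtain ⟨N, hN⟩ := hv
  refine ⟨2 * M + 2 * N, fun n => ((h.graph n).add_self_le u v).trans ?_⟩
  linarith [hM n, hN n]

theorem finiteEnergy_smul (h : IsFormSeq Q) (c : ℝ) {u : X → ℝ} (hu : FiniteEnergy Q u) :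
    FiniteEnergy Q (c • u) := by
  obtain ⟨M, hM⟩ := hu
  refine ⟨c ^ 2 * M, fun n => ?_⟩
  rw [(h.graph n).smul_self]
  exact mul_le_mul_of_nonneg_left (hM n) (sq_nonneg c)

theorem finiteEnergy_sub (h : IsFormSeq Q) {u v : X → ℝ} (hu : FiniteEnergy Q u)
    (hv : FiniteEnergy Q v) : FiniteEnergy Q (u - v) := by
  have e : u - v = u + (-1 : ℝ) • v := by module
  rw [e]
  exact h.finiteEnergy_add hu (h.finiteEnergy_smul _ hv)

theorem finiteEnergy_const (h : IsFormSeq Q) (c : ℝ) : FiniteEnergy Q fun _ => c :=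
  ⟨0, fun n => ((h.graph n).const_left c _).le⟩

theorem monotone (h : IsFormSeq Q) (u : X → ℝ) : Monotone fun n => Q n u u :=
  monotone_nat_of_le_succ fun n => h.mono n u

theorem finiteEnergy_iff (h : IsFormSeq Q) (u : X → ℝ) :
    FiniteEnergy Q u ↔ ∃ l : ℝ, Tendsto (fun n => Q n u u) atTop (𝓝 l) := by
  constructor
  · rintro ⟨M, hM⟩
    exact ⟨_, tendsto_atTop_ciSup (h.monotone u) ⟨M, by rintro _ ⟨n, rfl⟩; exact hM n⟩⟩
  · rintro ⟨l, hl⟩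
    exact ⟨l, fun n => (h.monotone u).ge_of_tendsto hl n⟩

theorem tendsto (h : IsFormSeq Q) {u v : X → ℝ} (hu : FiniteEnergy Q u) (hv : FiniteEnergy Q v) :
    Tendsto (fun n => Q n u v) atTop (𝓝 (limForm Q u v)) := by
  obtain ⟨a, ha⟩ := (h.finiteEnergy_iff _).1 (h.finiteEnergy_add hu hv)
  obtain ⟨b, hb⟩ := (h.finiteEnergy_iff _).1 (h.finiteEnergy_sub hu hv)
  have : Tendsto (fun n => Q n u v) atTop (𝓝 ((a - b) / 4)) :=
    ((ha.sub hb).div_const 4).congr fun n => ((h.graph n).polarization u v).symm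
  exact tendsto_nhds_limUnder ⟨_, this⟩

theorem le_limForm (h : IsFormSeq Q) {u : X → ℝ} (hu : FiniteEnergy Q u) (n : ℕ) :
    Q n u u ≤ limForm Q u u :=
  (h.monotone u).ge_of_tendsto (h.tendsto hu hu) n

theorem limForm_le (h : IsFormSeq Q) {u : X → ℝ} {M : ℝ} (hu : ∀ n, Q n u u ≤ M) :
    limForm Q u u ≤ M :=
  le_of_tendsto' (h.tendsto ⟨M, hu⟩ ⟨M, hu⟩) hu

theorem limForm_nonneg (h : IsFormSeq Q) {u : X → ℝ} (hu : FiniteEnergy Q u) :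
    0 ≤ limForm Q u u :=
  ((h.graph 0).nonneg u).trans (h.le_limForm hu 0)

theorem limForm_symm (h : IsFormSeq Q) (u v : X → ℝ) : limForm Q u v = limForm Q v u := by
  have : (fun n => Q n u v) = fun n => Q n v u := funext fun n => (h.graph n).symm u v
  simp only [limForm, this]

theorem limForm_add_left (h : IsFormSeq Q) {u v w : X → ℝ} (hu : FiniteEnergy Q u)
    (hv : FiniteEnergy Q v) (hw : FiniteEnergy Q w) :
    limForm Q (u + v) w = limForm Q u w + limForm Q v w :=
  tendsto_nhds_unique (h.tendsto (h.finiteEnergy_add hu hv) hw)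
    (((h.tendsto hu hw).add (h.tendsto hv hw)).congr fun n => ((h.graph n).add_left u v w).symm)

theorem limForm_smul_left (h : IsFormSeq Q) (c : ℝ) {u v : X → ℝ} (hu : FiniteEnergy Q u)
    (hv : FiniteEnergy Q v) : limForm Q (c • u) v = c * limForm Q u v :=
  tendsto_nhds_unique (h.tendsto (h.finiteEnergy_smul c hu) hv)
    (((h.tendsto hu hv).const_mul c).congr fun n => ((h.graph n).smul_left c u v).symm)

theorem limForm_polarization (h : IsFormSeq Q) {u v : X → ℝ} (hu : FiniteEnergy Q u)
    (hv : FiniteEnergy Q v) :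
    limForm Q u v = (limForm Q (u + v) (u + v) - limForm Q (u - v) (u - v)) / 4 :=
  tendsto_nhds_unique (h.tendsto hu hv)
    ((((h.tendsto (h.finiteEnergy_add hu hv) (h.finiteEnergy_add hu hv)).sub
      (h.tendsto (h.finiteEnergy_sub hu hv) (h.finiteEnergy_sub hu hv))).div_const 4).congr
      fun n => ((h.graph n).polarization u v).symm)

/-- A monotone sequence of graph forms whose finite energy functions satisfy a uniform oscillation
estimate and separate points defines a resistance form. -/
theorem isResistanceForm [TopologicalSpace X] [Nonempty X] (h : IsFormSeq Q) (C : ℝ)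
    (hC : ∀ (M : ℝ) (u : X → ℝ), 0 ≤ M → Continuous u → (∀ n, Q n u u ≤ M ^ 2) →
      ∀ x y, |u x - u y| ≤ C * M)
    (hsep : ∀ x y : X, x ≠ y → ∃ u, Continuous u ∧ FiniteEnergy Q u ∧ u x ≠ u y) :
    IsResistanceForm (limForm Q) {u | Continuous u ∧ FiniteEnergy Q u} := by
  have hres : ∀ u : X → ℝ, Continuous u → FiniteEnergy Q u → ∀ x y,
      |u x - u y| ≤ C * √(limForm Q u u) := fun u hu hf x y =>
    hC _ u (Real.sqrt_nonneg _) hu (fun n => by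
      rw [Real.sq_sqrt (h.limForm_nonneg hf)]; exact h.le_limForm hf n) x y
  refine ⟨fun c => ⟨continuous_const, h.finiteEnergy_const c⟩,
    fun u hu v hv => ⟨hu.1.add hv.1, h.finiteEnergy_add hu.2 hv.2⟩,
    fun c u hu => ⟨hu.1.const_smul c, h.finiteEnergy_smul c hu.2⟩,
    fun u _ v _ => h.limForm_symm u v,
    fun u hu v hv w hw => h.limForm_add_left hu.2 hv.2 hw.2,
    fun c u hu v hv => h.limForm_smul_left c hu.2 hv.2,
    fun u hu => h.limForm_nonneg hu.2, fun u hu => ⟨fun h0 => ?_, ?_⟩, fun U hU hcau => ?_,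
    fun x y hxy => ?_, fun x y => ⟨C ^ 2, ?_⟩, fun u hu => ?_⟩
  · obtain ⟨p⟩ := ‹Nonempty X›
    refine ⟨u p, funext fun x => ?_⟩
    have := hres u hu.1 hu.2 x p
    rw [h0, Real.sqrt_zero, mul_zero] at this
    exact sub_eq_zero.1 (abs_nonpos_iff.1 this)
  · rintro ⟨c, rfl⟩
    refine le_antisymm (h.limForm_le fun n => ((h.graph n).const_left c _).le)
      (h.limForm_nonneg hu.2)
  · obtain ⟨p⟩ := ‹Nonempty X›
    -- Energies ignore constants; normalizing at `p` turns an energy-Cauchy sequence into a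
    -- uniformly Cauchy one.
    set V : ℕ → X → ℝ := fun n x => U n x - U n p with hV
    have hVc : ∀ n, Continuous (V n) := fun n => (hU n).1.sub continuous_const
    have hdiff : ∀ m n x, |V m x - V n x| ≤ C * √(limForm Q (U m - U n) (U m - U n)) := by
      intro m n x
      have := hres (U m - U n) ((hU m).1.sub (hU n).1)
        (h.finiteEnergy_sub (hU m).2 (hU n).2) x p
      simp only [Pi.sub_apply] at this
      convert this using 2
      simp only [hV]; ring
    -- The sign of `C` is forced by the estimate itself, applied to the zero function with `M = 1`.
    have hC0 : 0 ≤ C := by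
      have := (abs_nonneg _).trans
        (hC 1 (fun _ => 0) zero_le_one continuous_const
          (fun n => by rw [(h.graph n).const_left]; norm_num) p p)
      linarith
    have huc : UniformCauchySeqOn V atTop univ := by
      rw [Metric.uniformCauchySeqOn_iff]
      intro ε hε
      obtain ⟨N, hN⟩ := hcau ((ε / (C + 1)) ^ 2) (by positivity)
      refine ⟨N, fun m hm n hn x _ => ?_⟩
      rw [Real.dist_eq]
      refine (hdiff m n x).trans_lt ?_
      have h1 : √(limForm Q (U m - U n) (U m - U n)) < ε / (C + 1) :=
        (Real.sqrt_lt' (by positivity)).2 (hN m hm n hn)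
      calc C * √(limForm Q (U m - U n) (U m - U n)) ≤ C * (ε / (C + 1)) := by gcongr
        _ < (C + 1) * (ε / (C + 1)) := by
            have : 0 < ε / (C + 1) := by positivity
            nlinarith
        _ = ε := by field_simp
    have hlim : ∀ x, ∃ l, Tendsto (fun n => V n x) atTop (𝓝 l) := fun x =>
      cauchySeq_tendsto_of_complete (huc.cauchySeq (mem_univ x))
    choose u hu using hlim
    have hunif : TendstoUniformlyOn V u atTop univ :=
      huc.tendstoUniformlyOn_of_tendsto fun x _ => hu x
    have huc' : Continuous u := (tendstoUniformlyOn_univ.1 hunif).continuous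
      (Frequently.of_forall hVc)
    -- Fatou-type argument: at a fixed level `k` let `n → ∞` in the Cauchy bound. The resulting `N`
    -- does not depend on `k`, so the bound survives in the limit form.
    have hsub : ∀ ε > 0, ∃ N, ∀ m ≥ N, ∀ k, Q k (U m - u) (U m - u) ≤ ε := by
      intro ε hε
      obtain ⟨N, hN⟩ := hcau ε hε
      refine ⟨N, fun m hm k => ?_⟩
      have e : ∀ w : X → ℝ, (fun x => (U m - w) x - U m p) = fun x => V m x - w x := fun w => by
        funext x; simp only [Pi.sub_apply, hV]; ring
      rw [← (h.graph k).sub_const _ (U m p), e]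
      refine le_of_tendsto ((h.graph k).tendsto (U := fun n x => V m x - V n x)
        fun x => tendsto_const_nhds.sub (hu x)) ?_
      filter_upwards [eventually_ge_atTop N] with n hn
      have e2 : (fun x => V m x - V n x) = fun x => (U m - U n) x - (U m p - U n p) := by
        funext x; simp only [Pi.sub_apply, hV]; ring
      rw [e2, (h.graph k).sub_const]
      exact (h.le_limForm (h.finiteEnergy_sub (hU m).2 (hU n).2) k).trans (hN m hm n hn).le
    have hue : FiniteEnergy Q u := by
      obtain ⟨N, hN⟩ := hsub 1 one_pos
      have e : u = U N - (U N - u) := by abel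
      rw [e]
      exact h.finiteEnergy_sub (hU N).2 ⟨1, hN N le_rfl⟩
    refine ⟨u, ⟨huc', hue⟩, ?_⟩
    rw [Metric.tendsto_atTop]
    intro ε hε
    obtain ⟨N, hN⟩ := hsub (ε / 2) (half_pos hε)
    refine ⟨N, fun m hm => ?_⟩
    rw [Real.dist_0_eq_abs, abs_of_nonneg
      (h.limForm_nonneg (h.finiteEnergy_sub (hU m).2 hue))]
    exact (h.limForm_le (hN m hm)).trans_lt (half_lt_self hε)
  · obtain ⟨u, h1, h2, h3⟩ := hsep x y hxy
    exact ⟨u, ⟨h1, h2⟩, h3⟩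
  · rintro t ⟨u, hu, hpos, rfl⟩
    rw [div_le_iff₀ hpos]
    calc |u x - u y| ^ 2 ≤ (C * √(limForm Q u u)) ^ 2 := by
          gcongr; exact hres u hu.1 hu.2 x y
      _ = C ^ 2 * limForm Q u u := by rw [mul_pow, Real.sq_sqrt hpos.le]
  · have hle : ∀ n, Q n (fun x => min (max 0 (u x)) 1) (fun x => min (max 0 (u x)) 1) ≤ Q n u u :=
      fun n => (h.graph n).contraction fun x y =>
        (abs_min_sub_min_le_max _ _ _ _).trans (by
          simp only [sub_self, abs_zero]
          refine max_le ((abs_max_sub_max_le_max _ _ _ _).trans ?_) (abs_nonneg _)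
          simp)
    refine ⟨⟨(continuous_const.max hu.1).min continuous_const, ?_⟩, ?_⟩
    · obtain ⟨M, hM⟩ := hu.2
      exact ⟨M, fun n => (hle n).trans (hM n)⟩
    · exact h.limForm_le fun n => (hle n).trans (h.le_limForm hu.2 n)

end IsFormSeq

theorem IsResistanceForm.sub_mem {X : Type*} {ℰ : (X → ℝ) → (X → ℝ) → ℝ} {F : Set (X → ℝ)}
    (h : IsResistanceForm ℰ F) {u v : X → ℝ} (hu : u ∈ F) (hv : v ∈ F) : u - v ∈ F := by
  have e : u - v = u + (-1 : ℝ) • v := by module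
  rw [e]
  exact h.add_mem _ hu _ (h.smul_mem _ _ hv)

/-- Needed because the two forms are known to agree on the domain only, not on arbitrary functions.
-/
theorem IsResistanceForm.congr {X : Type*} {ℰ ℰ' : (X → ℝ) → (X → ℝ) → ℝ} {F : Set (X → ℝ)}
    (h : IsResistanceForm ℰ F) (he : ∀ u ∈ F, ∀ v ∈ F, ℰ u v = ℰ' u v) :
    IsResistanceForm ℰ' F where
  const_mem := h.const_mem
  add_mem := h.add_mem
  smul_mem := h.smul_mem
  symm u hu v hv := by rw [← he u hu v hv, ← he v hv u hu, h.symm u hu v hv]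
  add_left u hu v hv w hw := by
    rw [← he _ (h.add_mem u hu v hv) w hw, ← he u hu w hw, ← he v hv w hw, h.add_left u hu v hv w hw]
  smul_left c u hu v hv := by
    rw [← he _ (h.smul_mem c u hu) v hv, ← he u hu v hv, h.smul_left c u hu v hv]
  nonneg u hu := by rw [← he u hu u hu]; exact h.nonneg u hu
  eq_zero_iff u hu := by rw [← he u hu u hu]; exact h.eq_zero_iff u hu
  complete U hU hc := by
    obtain ⟨u, hu, ht⟩ := h.complete U hU fun ε hε => by
      obtain ⟨N, hN⟩ := hc ε hε
      refine ⟨N, fun m hm n hn => ?_⟩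
      rw [he _ (h.sub_mem (hU m) (hU n)) _ (h.sub_mem (hU m) (hU n))]
      exact hN m hm n hn
    exact ⟨u, hu, ht.congr fun n => he _ (h.sub_mem (hU n) hu) _ (h.sub_mem (hU n) hu)⟩
  separates := h.separates
  resistance_finite x y := by
    obtain ⟨B, hB⟩ := h.resistance_finite x y
    refine ⟨B, ?_⟩
    rintro t ⟨u, hu, hpos, rfl⟩
    rw [← he u hu u hu] at hpos ⊢
    exact hB ⟨u, hu, hpos, rfl⟩
  markov u hu := by
    obtain ⟨h1, h2⟩ := h.markov u hu
    exact ⟨h1, by rw [← he _ h1 _ h1, ← he u hu u hu]; exact h2⟩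

/-! ### Words -/

theorem wordMap_succ {X ι : Type*} (f : ι → X → X) (n : ℕ) (w : Fin (n + 1) → ι) :
    wordMap f (n + 1) w = f (w 0) ∘ wordMap f n (Fin.tail w) := rfl

theorem wordMap_cons {X ι : Type*} (f : ι → X → X) (n : ℕ) (i : ι) (w : Fin n → ι) :
    wordMap f (n + 1) (Fin.cons i w) = f i ∘ wordMap f n w := rfl

theorem sum_words_succ {ι M : Type*} [Fintype ι] [AddCommMonoid M] (n : ℕ)
    (F : (Fin (n + 1) → ι) → M) :
    ∑ w, F w = ∑ i, ∑ w : Fin n → ι, F (Fin.cons i w) := by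
  rw [← (Fin.consEquiv fun _ => ι).sum_comp, Fintype.sum_prod_type]
  rfl

theorem dist_wordMap_le {X ι : Type*} [MetricSpace X] (f : ι → X → X) {K : ℝ} (hK : 0 ≤ K)
    (hf : ∀ i x y, dist (f i x) (f i y) ≤ K * dist x y) (n : ℕ) (w : Fin n → ι) (x y : X) :
    dist (wordMap f n w x) (wordMap f n w y) ≤ K ^ n * dist x y := by
  induction n with
  | zero => simp [wordMap]
  | succ n ih =>
    rw [wordMap_succ, pow_succ', mul_assoc]
    exact (hf _ _ _).trans (mul_le_mul_of_nonneg_left (ih _) hK)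

/-- A continuous function on a compact space has small oscillation on all cells of high level. -/
theorem exists_osc_wordMap_le {X ι : Type*} [MetricSpace X] [CompactSpace X] (f : ι → X → X)
    {K : ℝ} (hK : 0 ≤ K) (hK1 : K < 1) (hf : ∀ i x y, dist (f i x) (f i y) ≤ K * dist x y)
    {u : X → ℝ} (hu : Continuous u) {ε : ℝ} (hε : 0 < ε) :
    ∃ N, ∀ n ≥ N, ∀ (w : Fin n → ι) x y, |u (wordMap f n w x) - u (wordMap f n w y)| ≤ ε := by
  obtain ⟨δ, hδ, h⟩ := Metric.uniformContinuous_iff.1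
    (CompactSpace.uniformContinuous_of_continuous hu) ε hε
  have ht : Tendsto (fun n => K ^ n * Metric.diam (univ : Set X)) atTop (𝓝 0) := by
    simpa using (tendsto_pow_atTop_nhds_zero_of_lt_one hK hK1).mul_const
      (Metric.diam (univ : Set X))
  obtain ⟨N, hN⟩ := eventually_atTop.1 (ht.eventually_lt_const hδ)
  refine ⟨N, fun n hn w x y => ?_⟩
  have hd : dist x y ≤ Metric.diam (univ : Set X) :=
    Metric.dist_le_diam_of_mem isCompact_univ.isBounded (mem_univ x) (mem_univ y)
  have := h (((dist_wordMap_le f hK hf n w x y).trans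
    (mul_le_mul_of_nonneg_left hd (pow_nonneg hK n))).trans_lt (hN n hn))
  exact this.le

/-- Chaining: an estimate at the first level yields an oscillation estimate on the whole space. -/
theorem abs_sub_le_of_chain {X ι : Type*} (f : ι → X → X) (p : X) (P : ℝ → (X → ℝ) → Prop)
    {q C : ℝ} (hq0 : 0 ≤ q) (hq1 : q < 1) (hC : 0 ≤ C)
    (hP : ∀ M u i, 0 ≤ M → P M u → P (q * M) (u ∘ f i))
    (hstep : ∀ M u x, 0 ≤ M → P M u → |u x - u p| ≤ C * M ∨
      ∃ i y, x = f i y ∧ |u (f i p) - u p| ≤ C * M)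
    (hmesh : ∀ M u, P M u → ∀ ε > 0, ∃ n, ∀ (w : Fin n → ι) x y,
      |u (wordMap f n w x) - u (wordMap f n w y)| ≤ ε)
    {M : ℝ} {u : X → ℝ} (hM : 0 ≤ M) (hu : P M u) (x : X) : |u x - u p| ≤ C / (1 - q) * M := by
  -- Descend `n` cells and pay `C * M`, `C * q * M`, … on the way; `δ` absorbs the oscillation left
  -- inside the last cell, and continuity later sends it to 0.
  have key : ∀ (n : ℕ) (M : ℝ) (u : X → ℝ) (x : X) (δ : ℝ), 0 ≤ M → P M u → 0 ≤ δ →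
      (∀ (w : Fin n → ι) x y, |u (wordMap f n w x) - u (wordMap f n w y)| ≤ δ) →
      |u x - u p| ≤ C / (1 - q) * M + δ := by
    have hq : 0 < 1 - q := by linarith
    have hCq : C ≤ C / (1 - q) := (le_div_iff₀ hq).2 (by nlinarith)
    intro n
    induction n with
    | zero =>
      intro M u x δ hM _ _ hδ
      have := hδ Fin.elim0 x p
      simp only [wordMap, id] at this
      have : 0 ≤ C / (1 - q) * M := by positivity
      linarith
    | succ n ih =>
      intro M u x δ hM hu hδ0 hδ
      rcases hstep M u x hM hu with h | ⟨i, y, rfl, h⟩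
      · have := mul_le_mul_of_nonneg_right hCq hM
        linarith
      · have h1 := ih (q * M) (u ∘ f i) y δ (mul_nonneg hq0 hM) (hP M u i hM hu) hδ0
          fun w a b => hδ (Fin.cons i w) a b
        have h2 := abs_sub_le (u (f i y)) (u (f i p)) (u p)
        have h3 : C / (1 - q) * (q * M) + C * M = C / (1 - q) * M := by
          field_simp; ring
        simp only [Function.comp] at h1
        linarith
  refine le_of_forall_pos_le_add fun ε hε => ?_
  obtain ⟨n, hn⟩ := hmesh M u hu ε hε
  exact key n M u x ε hM hu hε.le hn

/-! ### Level sums -/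

theorem isGraphForm_edgeSum {X : Type*} {m : ℕ} (p : Fin m → X) : IsGraphForm (edgeSum p) :=
  .sum _ fun _ _ => .sum _ fun _ _ => .edge _ _

theorem isGraphForm_levelSum {X ι : Type*} [Fintype ι] {m : ℕ} (f : ι → X → X) (p : Fin m → X)
    (n : ℕ) : IsGraphForm (levelSum f p n) :=
  .sum _ fun w _ => (isGraphForm_edgeSum p).comp (wordMap f n w)

theorem levelSum_zero {X ι : Type*} [Fintype ι] {m : ℕ} (f : ι → X → X) (p : Fin m → X)
    (u v : X → ℝ) : levelSum f p 0 u v = edgeSum p u v := by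
  simp [levelSum, wordMap]

theorem levelSum_succ {X ι : Type*} [Fintype ι] {m : ℕ} (f : ι → X → X) (p : Fin m → X) (n : ℕ)
    (u v : X → ℝ) : levelSum f p (n + 1) u v = ∑ i, levelSum f p n (u ∘ f i) (v ∘ f i) := by
  simp only [levelSum, sum_words_succ]
  rfl

/-! ### Gluing continuous functions -/

theorem exists_glue_of_isClosed {X ι : Type*} [TopologicalSpace X] [Finite ι] (C : ι → Set X)
    (hC : ∀ i, IsClosed (C i)) (hcov : ∀ x, ∃ i, x ∈ C i) (g : ι → X → ℝ)
    (hg : ∀ i, ContinuousOn (g i) (C i))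
    (hcompat : ∀ i j, ∀ x ∈ C i, x ∈ C j → g i x = g j x) :
    ∃ G : X → ℝ, Continuous G ∧ ∀ i, ∀ x ∈ C i, G x = g i x := by
  choose I hI using hcov
  have hG : ∀ i, ∀ x ∈ C i, g (I x) x = g i x := fun i x hx => hcompat _ _ x (hI x) hx
  refine ⟨fun x => g (I x) x, ?_, hG⟩
  exact (locallyFinite_of_finite C).continuous (iUnion_eq_univ_iff.2 fun x => ⟨I x, hI x⟩) hC
    fun i => (hg i).congr (hG i)

/-- A continuous injection of a compact space into a Hausdorff space is a closed embedding, so `f`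
can be transported to the range. The value 0 off the range plays no role. -/
theorem continuousOn_range_extend {X Y : Type*} [TopologicalSpace X] [T2Space X]
    [TopologicalSpace Y] [CompactSpace Y] {q : Y → X} (hq : Continuous q)
    (hinj : Function.Injective q) {f : Y → ℝ} (hf : Continuous f) :
    ContinuousOn (Function.extend q f 0) (range q) := by
  have hemb := (hq.isClosedEmbedding hinj).isEmbedding
  rw [continuousOn_iff_continuous_domRestrict]
  have : (range q).domRestrict (Function.extend q f 0) = f ∘ hemb.toHomeomorph.symm := by
    funext ⟨x, y, hy⟩
    subst hy
    have : hemb.toHomeomorph.symm ⟨q y, mem_range_self y⟩ = y := by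
      rw [Homeomorph.symm_apply_eq]; rfl
    simp [this, hinj.extend_apply]
  rw [this]
  exact hf.comp hemb.toHomeomorph.symm.continuous

/-! ### Segments and gaskets as self-similar simplices -/

/-- The maps `f i`, of ratio `1 / 2` with fixed points `p i`, generate the compact space `X` in the
way a segment (`m = 2`) or a Sierpinski gasket (`m = 3`) is generated: two cells `f i (X)` and
`f j (X)` meet in the single point `f i (p j) = f j (p i)`. -/
structure IsSimplexGasket {X : Type*} [MetricSpace X] {m : ℕ} (f : Fin m → X → X)
    (p : Fin m → X) : Prop where
  dim : m = 2 ∨ m = 3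
  dist_map : ∀ i x y, dist (f i x) (f i y) = 1 / 2 * dist x y
  cover : ∀ x, ∃ i y, x = f i y
  fixed : ∀ i, f i (p i) = p i
  adj : ∀ i j, f i (p j) = f j (p i)
  overlap : ∀ i j x y, i ≠ j → f i x = f j y → x = p j ∧ y = p i
  bary : ∃ β : Fin m → X → ℝ, (∀ i, Continuous (β i)) ∧ (∀ i x, 0 ≤ β i x) ∧
    (∀ x, ∑ i, β i x = 1) ∧ ∀ i j, β i (p j) = if i = j then 1 else 0

/-- The values of a harmonic function on the corners of the `i`-th cell of level `1`, given its
values on the corners of the simplex. -/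
def harmonicStep {m : ℕ} (a : Fin m → ℝ) (i j : Fin m) : ℝ :=
  if i = j then a i else (a i + a j + ∑ k, a k) / (m + 2)

/-- The energy of a function on the vertices of a simplex. -/
def simplexEnergy {m : ℕ} (a : Fin m → ℝ) : ℝ := edgeSum id a a

/-- The renormalized graph energies of a segment or a gasket. -/
def renormEnergy {X : Type*} {m : ℕ} (f : Fin m → X → X) (p : Fin m → X) (n : ℕ)
    (u v : X → ℝ) : ℝ :=
  ((m + 2 : ℝ) / m) ^ n * levelSum f p n u v

theorem edgeSum_self {X : Type*} {m : ℕ} (p : Fin m → X) (u : X → ℝ) :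
    edgeSum p u u = simplexEnergy (u ∘ p) := rfl

theorem simplexEnergy_nonneg {m : ℕ} (a : Fin m → ℝ) : 0 ≤ simplexEnergy a :=
  (isGraphForm_edgeSum id).nonneg a

theorem sq_sub_le_simplexEnergy {m : ℕ} (a : Fin m → ℝ) (i j : Fin m) :
    (a i - a j) ^ 2 ≤ simplexEnergy a := by
  have key : ∀ i j, i < j → (a i - a j) ^ 2 ≤ simplexEnergy a := by
    intro i j hij
    rw [sq]
    refine (Finset.single_le_sum (f := fun b => (a i - a b) * (a i - a b))
      (fun b _ => mul_self_nonneg _) (Finset.mem_Ioi.2 hij)).trans ?_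
    exact Finset.single_le_sum
      (f := fun i => ∑ b ∈ Finset.Ioi i, (a i - a b) * (a i - a b))
      (fun i _ => Finset.sum_nonneg fun b _ => mul_self_nonneg _) (Finset.mem_univ i)
  rcases lt_trichotomy i j with h | rfl | h
  · exact key i j h
  · simpa using simplexEnergy_nonneg a
  · rw [← neg_sub, neg_sq]; exact key j i h

theorem simplexEnergy_two (a : Fin 2 → ℝ) : simplexEnergy a = (a 0 - a 1) ^ 2 := by
  have h0 : Finset.Ioi (0 : Fin 2) = {1} := by decide
  have h1 : Finset.Ioi (1 : Fin 2) = ∅ := by decide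
  simp only [simplexEnergy, edgeSum, Fin.sum_univ_two, h0, h1, Finset.sum_singleton,
    Finset.sum_empty, id]
  ring

theorem simplexEnergy_three (a : Fin 3 → ℝ) :
    simplexEnergy a = (a 0 - a 1) ^ 2 + (a 0 - a 2) ^ 2 + (a 1 - a 2) ^ 2 := by
  have h0 : Finset.Ioi (0 : Fin 3) = {1, 2} := by decide
  have h1 : Finset.Ioi (1 : Fin 3) = {2} := by decide
  have h2 : Finset.Ioi (2 : Fin 3) = ∅ := by decide
  simp only [simplexEnergy, edgeSum, Fin.sum_univ_three, h0, h1, h2, Finset.sum_singleton,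
    Finset.sum_empty, id, Finset.sum_pair (show (1 : Fin 3) ≠ 2 by decide)]
  ring

/-- The factor is 2 for the segment and 5/3 for the gasket; it is the renormalization for which
harmonic extension preserves energy. -/
theorem simplexEnergy_harmonicStep {m : ℕ} (hm : m = 2 ∨ m = 3) (a : Fin m → ℝ) :
    ((m + 2 : ℝ) / m) * ∑ i, simplexEnergy (harmonicStep a i) = simplexEnergy a := by
  rcases hm with rfl | rfl
  · simp only [simplexEnergy_two, Fin.sum_univ_two, harmonicStep]
    norm_num
    ring
  · simp only [simplexEnergy_three, Fin.sum_univ_three, harmonicStep]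
    norm_num [Fin.ext_iff]
    ring

/-- Among all values at the new vertices the harmonic ones minimize the energy. -/
theorem simplexEnergy_le {m : ℕ} (hm : m = 2 ∨ m = 3) (b : Fin m → Fin m → ℝ)
    (hb : ∀ i j, b i j = b j i) :
    simplexEnergy (fun i => b i i) ≤ ((m + 2 : ℝ) / m) * ∑ i, simplexEnergy (b i) := by
  rcases hm with rfl | rfl
  · simp only [simplexEnergy_two, Fin.sum_univ_two, hb 1 0]
    norm_num
    nlinarith [sq_nonneg (b 0 0 + b 1 1 - 2 * b 0 1)]
  · simp only [simplexEnergy_three, Fin.sum_univ_three, hb 1 0, hb 2 0, hb 2 1]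
    norm_num
    -- Deviations from the harmonic values given by the 2/5, 2/5, 1/5 rule. In these variables the
    -- cross terms vanish and a sum of squares remains.
    set x := b 0 1 - (2 * b 0 0 + 2 * b 1 1 + b 2 2) / 5 with hx
    set y := b 0 2 - (2 * b 0 0 + b 1 1 + 2 * b 2 2) / 5 with hy
    set z := b 1 2 - (b 0 0 + 2 * b 1 1 + 2 * b 2 2) / 5 with hz
    have hx' : b 0 1 = x + (2 * b 0 0 + 2 * b 1 1 + b 2 2) / 5 := by rw [hx]; ring
    have hy' : b 0 2 = y + (2 * b 0 0 + b 1 1 + 2 * b 2 2) / 5 := by rw [hy]; ring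
    have hz' : b 1 2 = z + (b 0 0 + 2 * b 1 1 + 2 * b 2 2) / 5 := by rw [hz]; ring
    rw [hx', hy', hz']
    clear_value x y z
    nlinarith [sq_nonneg x, sq_nonneg y, sq_nonneg z, sq_nonneg (x - y), sq_nonneg (x - z),
      sq_nonneg (y - z)]

/-- The oscillation shrinks by 1/2 on a segment and by 3/5 on a gasket; 3/5 serves for both. -/
theorem abs_harmonicStep_sub_le {m : ℕ} (hm : m = 2 ∨ m = 3) {a : Fin m → ℝ} {d : ℝ}
    (ha : ∀ i j, |a i - a j| ≤ d) (k i j : Fin m) :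
    |harmonicStep a k i - harmonicStep a k j| ≤ 3 / 5 * d := by
  have h0 : 0 ≤ d := (abs_nonneg _).trans (ha k k)
  have h : ∀ i j, a i - a j ≤ d := fun i j => (le_abs_self _).trans (ha i j)
  rcases hm with rfl | rfl
  · have h1 := h 0 1
    have h2 := h 1 0
    fin_cases k <;> fin_cases i <;> fin_cases j <;>
      simp [harmonicStep, Fin.sum_univ_two, abs_le] <;> norm_num <;>
      first | done | positivity | (constructor <;> linarith)
  · have h1 := h 0 1
    have h2 := h 1 0
    have h3 := h 0 2
    have h4 := h 2 0
    have h5 := h 1 2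
    have h6 := h 2 1
    fin_cases k <;> fin_cases i <;> fin_cases j <;>
      simp [harmonicStep, Fin.sum_univ_three, abs_le] <;> norm_num <;>
      first | done | positivity | (constructor <;> linarith)

theorem harmonicStep_mem_Icc {m : ℕ} {a : Fin m → ℝ} {lo hi : ℝ}
    (ha : ∀ i, a i ∈ Icc lo hi) (i j : Fin m) : harmonicStep a i j ∈ Icc lo hi := by
  unfold harmonicStep
  split_ifs
  · exact ha i
  · have h1 : ∑ _k : Fin m, lo ≤ ∑ k, a k := Finset.sum_le_sum fun k _ => (ha k).1
    have h2 : ∑ k, a k ≤ ∑ _k : Fin m, hi := Finset.sum_le_sum fun k _ => (ha k).2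
    simp only [Finset.sum_const, Finset.card_univ, Fintype.card_fin, nsmul_eq_mul] at h1 h2
    have hi' := ha i
    have hj' := ha j
    rw [mem_Icc] at *
    have hm : (0 : ℝ) < m + 2 := by positivity
    rw [le_div_iff₀ hm, div_le_iff₀ hm]
    constructor <;> nlinarith

theorem renormEnergy_succ {X : Type*} {m : ℕ} (f : Fin m → X → X) (p : Fin m → X) (n : ℕ) (u v : X → ℝ) :
    renormEnergy f p (n + 1) u v =
      ((m + 2 : ℝ) / m) * ∑ i, renormEnergy f p n (u ∘ f i) (v ∘ f i) := by
  simp only [renormEnergy, levelSum_succ, ← Finset.mul_sum]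
  ring

theorem renormEnergy_zero {X : Type*} {m : ℕ} (f : Fin m → X → X) (p : Fin m → X) (u : X → ℝ) :
    renormEnergy f p 0 u u = simplexEnergy (u ∘ p) := by
  simp [renormEnergy, levelSum_zero, edgeSum_self]

namespace IsSimplexGasket

variable {X : Type*} [MetricSpace X] {m : ℕ} {f : Fin m → X → X} {p : Fin m → X}

theorem pos (h : IsSimplexGasket f p) : (0 : ℝ) < m := by
  rcases h.dim with rfl | rfl <;> norm_num

theorem continuous_map (h : IsSimplexGasket f p) (i : Fin m) : Continuous (f i) :=
  (LipschitzWith.of_dist_le_mul (K := 1) fun x y => by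
    rw [h.dist_map, NNReal.coe_one, one_mul]
    linarith [dist_nonneg (x := x) (y := y)]).continuous

theorem injective_map (h : IsSimplexGasket f p) (i : Fin m) : Function.Injective (f i) := by
  intro x y hxy
  have := h.dist_map i x y
  rw [hxy, dist_self] at this
  exact dist_le_zero.1 (by linarith)

/-- Only the passage from level 0 to level 1 has content; self-similarity propagates it. -/
theorem isFormSeq (h : IsSimplexGasket f p) : IsFormSeq (renormEnergy f p) where
  graph n := .smul _ (by positivity) (isGraphForm_levelSum f p n)
  mono n := by
    have hm := h.pos
    induction n with
    | zero =>
      intro u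
      rw [renormEnergy_succ]
      simp only [renormEnergy_zero]
      have := simplexEnergy_le h.dim (fun i j => u (f i (p j))) fun i j => by rw [h.adj]
      simp only [h.fixed] at this
      exact this
    | succ n ih =>
      intro u
      rw [renormEnergy_succ, renormEnergy_succ f p (n + 1)]
      gcongr
      exact ih _

theorem renormEnergy_comp_le (h : IsSimplexGasket f p) (n : ℕ) (u : X → ℝ) (i : Fin m) :
    ((m + 2 : ℝ) / m) * renormEnergy f p n (u ∘ f i) (u ∘ f i) ≤ renormEnergy f p (n + 1) u u := by
  have hm := h.pos
  rw [renormEnergy_succ]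
  gcongr
  exact Finset.single_le_sum (f := fun i => renormEnergy f p n (u ∘ f i) (u ∘ f i))
    (fun j _ => (h.isFormSeq.graph n).nonneg _) (Finset.mem_univ i)

/-- The uniform oscillation estimate. -/
theorem exists_abs_sub_le [CompactSpace X] (h : IsSimplexGasket f p) :
    ∃ C, 0 ≤ C ∧ ∀ (M : ℝ) (u : X → ℝ), 0 ≤ M → Continuous u →
      (∀ n, renormEnergy f p n u u ≤ M ^ 2) → ∀ x k, |u x - u (p k)| ≤ C * M := by
  have hm := h.pos
  have hc : (1 : ℝ) < (m + 2) / m := by rw [lt_div_iff₀ hm]; linarith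
  set c : ℝ := (m + 2) / m with hcdef
  have hq1 : √c⁻¹ < 1 := by
    rw [Real.sqrt_lt' one_pos, one_pow]
    exact inv_lt_one_of_one_lt₀ hc
  refine ⟨1 / (1 - √c⁻¹), by have : 0 < 1 - √c⁻¹ := by linarith
                             positivity, fun M u hM hu hE x k => ?_⟩
  refine abs_sub_le_of_chain f (p k)
    (fun M u => Continuous u ∧ ∀ n, renormEnergy f p n u u ≤ M ^ 2)
    (Real.sqrt_nonneg _) hq1 zero_le_one ?_ ?_ ?_ hM ⟨hu, hE⟩ x
  · rintro M u i hM ⟨hu, hE⟩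
    refine ⟨hu.comp (h.continuous_map i), fun n => ?_⟩
    rw [mul_pow, Real.sq_sqrt (by positivity), ← div_eq_inv_mul, le_div_iff₀' (by positivity)]
    exact (h.renormEnergy_comp_le n u i).trans (hE _)
  · rintro M u x hM ⟨hu, hE⟩
    obtain ⟨i, y, rfl⟩ := h.cover x
    refine Or.inr ⟨i, y, rfl, ?_⟩
    rw [one_mul]
    refine abs_le_of_sq_le_sq ?_ hM
    -- By adjacency `f i (p k) = f k (p i)`, and `p k = f k (p k)`: both points are corners of the
    -- cell `k`, so one step of the chain costs at most the energy of that cell.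
    have h1 := sq_sub_le_simplexEnergy (fun j => u (f k (p j))) i k
    simp only [h.fixed] at h1
    rw [h.adj]
    refine h1.trans (le_trans ?_ (hE 1))
    have h2 := h.renormEnergy_comp_le 0 u k
    rw [renormEnergy_zero] at h2
    refine le_trans ?_ h2
    have h3 := simplexEnergy_nonneg ((u ∘ f k) ∘ p)
    change simplexEnergy ((u ∘ f k) ∘ p) ≤ _
    nlinarith
  · rintro M u ⟨hu, -⟩ ε hε
    obtain ⟨N, hN⟩ := exists_osc_wordMap_le f (K := 1 / 2) (by norm_num) (by norm_num)
      (fun i x y => (h.dist_map i x y).le) hu hε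
    exact ⟨N, hN N le_rfl⟩

theorem exists_glue [CompactSpace X] (h : IsSimplexGasket f p) (g : Fin m → X → ℝ)
    (hg : ∀ i, Continuous (g i)) (hcompat : ∀ i j, g i (p j) = g j (p i)) :
    ∃ G : X → ℝ, Continuous G ∧ ∀ i x, G (f i x) = g i x := by
  obtain ⟨G, hG, hG'⟩ := exists_glue_of_isClosed (fun i => range (f i))
    (fun i => (isCompact_range (h.continuous_map i)).isClosed)
    (fun x => by obtain ⟨i, y, rfl⟩ := h.cover x; exact ⟨i, mem_range_self y⟩)
    (fun i => Function.extend (f i) (g i) 0)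
    (fun i => continuousOn_range_extend (h.continuous_map i) (h.injective_map i) (hg i))
    (by
      rintro i j _ ⟨x, rfl⟩ ⟨y, hy⟩
      rw [(h.injective_map i).extend_apply, ← hy, (h.injective_map j).extend_apply]
      rcases eq_or_ne i j with rfl | hij
      · rw [h.injective_map i hy]
      · obtain ⟨rfl, rfl⟩ := h.overlap i j x y hij hy.symm
        exact hcompat i j)
  refine ⟨G, hG, fun i x => ?_⟩
  rw [hG' i _ (mem_range_self x), (h.injective_map i).extend_apply]

/-- Harmonic functions on a segment or a gasket. -/
theorem exists_harmonic [CompactSpace X] (h : IsSimplexGasket f p) :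
    ∃ H : (Fin m → ℝ) → X → ℝ, ∀ a, Continuous (H a) ∧ (∀ i, H a (p i) = a i) ∧
      (∀ i x, H a (f i x) = H (harmonicStep a i) x) ∧
      (∀ lo hi : ℝ, (∀ i, a i ∈ Icc lo hi) → ∀ x, H a x ∈ Icc lo hi) ∧
      ∀ n, renormEnergy f p n (H a) (H a) = simplexEnergy a := by
  -- Harmonic functions arise as the limit of an iteration on families `F` indexed by boundary data.
  -- The two properties kept along the way are the boundary values and the maximum principle.
  let S : Type _ := {F : (Fin m → ℝ) → C(X, ℝ) // (∀ a i, F a (p i) = a i) ∧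
    ∀ a (lo hi : ℝ), (∀ i, a i ∈ Icc lo hi) → ∀ x, F a x ∈ Icc lo hi}
  have base : ∃ F : S, True := by
    obtain ⟨β, hβ, hβ0, hβ1, hβp⟩ := h.bary
    refine ⟨⟨fun a => ⟨fun x => ∑ i, β i x * a i,
      continuous_finsetSum _ fun i _ => (hβ i).mul continuous_const⟩, fun a i => ?_,
      fun a lo hi ha x => ⟨?_, ?_⟩⟩, trivial⟩
    · simp [hβp]
    · calc lo = ∑ i, β i x * lo := by rw [← Finset.sum_mul, hβ1, one_mul]
        _ ≤ ∑ i, β i x * a i :=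
          Finset.sum_le_sum fun i _ => mul_le_mul_of_nonneg_left (ha i).1 (hβ0 i x)
    · calc ∑ i, β i x * a i ≤ ∑ i, β i x * hi :=
          Finset.sum_le_sum fun i _ => mul_le_mul_of_nonneg_left (ha i).2 (hβ0 i x)
        _ = hi := by rw [← Finset.sum_mul, hβ1, one_mul]
  have step : ∀ F : S, ∃ F' : S, ∀ a i x, F'.1 a (f i x) = F.1 (harmonicStep a i) x := by
    rintro ⟨F, hFp, hFr⟩
    have : ∀ a, ∃ G : X → ℝ, Continuous G ∧ ∀ i x, G (f i x) = F (harmonicStep a i) x := fun a =>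
      h.exists_glue _ (fun i => (F _).continuous) fun i j => by
        rw [hFp, hFp]
        unfold harmonicStep
        rcases eq_or_ne i j with rfl | hij
        · rfl
        · rw [if_neg hij, if_neg hij.symm, add_comm (a i)]
    choose G hG hGf using this
    refine ⟨⟨fun a => ⟨G a, hG a⟩, fun a i => ?_, fun a lo hi ha x => ?_⟩, hGf⟩
    · change G a (p i) = a i
      rw [← h.fixed i, hGf, hFp]
      simp [harmonicStep]
    · change G a x ∈ Icc lo hi
      obtain ⟨i, y, rfl⟩ := h.cover x
      rw [hGf]
      exact hFr _ lo hi (fun j => harmonicStep_mem_Icc ha i j) y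
  obtain ⟨F₀, -⟩ := base
  choose T hT using step
  let F : ℕ → S := fun n => T^[n] F₀
  have hF : ∀ n a i x, (F (n + 1)).1 a (f i x) = (F n).1 (harmonicStep a i) x := fun n a i x => by
    simp only [F, Function.iterate_succ_apply', hT]
  have hm : Nonempty (Fin m) := by
    rcases h.dim with rfl | rfl <;> exact ⟨0⟩
  -- Initially both functions take values in the range of `a`, so they differ by at most `d`. Each
  -- further iteration evaluates the previous two at boundary data of oscillation at most `3 / 5 *
  -- d`.
  have hdiff : ∀ n (a : Fin m → ℝ) d, (∀ i j, |a i - a j| ≤ d) → ∀ x,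
      |(F n).1 a x - (F (n + 1)).1 a x| ≤ d * (3 / 5) ^ n := by
    intro n
    induction n with
    | zero =>
      intro a d ha x
      obtain ⟨k, hk⟩ := Finite.exists_min a
      have hr : ∀ i, a i ∈ Icc (a k) (a k + d) := fun i =>
        ⟨hk i, by linarith [(le_abs_self _).trans (ha i k)]⟩
      have h1 := (F 0).2.2 a _ _ hr x
      have h2 := (F 1).2.2 a _ _ hr x
      rw [pow_zero, mul_one, abs_le]
      constructor <;> linarith [h1.1, h1.2, h2.1, h2.2]
    | succ n ih =>
      intro a d ha x
      obtain ⟨i, y, rfl⟩ := h.cover x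
      rw [hF, hF]
      refine (ih _ _ (abs_harmonicStep_sub_le h.dim ha i) y).trans (le_of_eq ?_)
      ring
  have hlim : ∀ a, ∃ G : C(X, ℝ), Tendsto (fun n => (F n).1 a) atTop (𝓝 G) := by
    intro a
    refine cauchySeq_tendsto_of_complete
      (cauchySeq_of_le_geometric (3 / 5) (∑ i, ∑ j, |a i - a j|) (by norm_num) fun n => ?_)
    refine (ContinuousMap.dist_le (by positivity)).2 fun x => ?_
    refine hdiff n a _ (fun i j => ?_) x
    exact (Finset.single_le_sum (f := fun j => |a i - a j|) (fun _ _ => abs_nonneg _)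
      (Finset.mem_univ j)).trans (Finset.single_le_sum (f := fun i => ∑ j, |a i - a j|)
        (fun _ _ => Finset.sum_nonneg fun _ _ => abs_nonneg _) (Finset.mem_univ i))
  choose G hG using hlim
  have hGx : ∀ a x, Tendsto (fun n => (F n).1 a x) atTop (𝓝 (G a x)) := fun a x =>
    ((continuous_eval_const (F := C(X, ℝ)) x).tendsto (G a)).comp (hG a)
  have hGp : ∀ a i, G a (p i) = a i := fun a i =>
    tendsto_nhds_unique (hGx a (p i)) (by simp only [(F _).2.1]; exact tendsto_const_nhds)
  have hGf : ∀ a i x, G a (f i x) = G (harmonicStep a i) x := fun a i x =>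
    tendsto_nhds_unique ((tendsto_add_atTop_iff_nat 1).2 (hGx a (f i x)))
      (by simp only [hF]; exact hGx _ x)
  refine ⟨fun a => G a, fun a => ⟨(G a).continuous, hGp a, hGf a,
    fun lo hi ha x => isClosed_Icc.mem_of_tendsto (hGx a x)
      (Eventually.of_forall fun n => (F n).2.2 a lo hi ha x), fun n => ?_⟩⟩
  induction n generalizing a with
  | zero =>
    rw [renormEnergy_zero]
    exact congrArg _ (funext (hGp a))
  | succ n ih =>
    rw [renormEnergy_succ, ← simplexEnergy_harmonicStep h.dim a]
    congr 1
    refine Finset.sum_congr rfl fun i _ => ?_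
    have : (⇑(G a) ∘ f i) = G (harmonicStep a i) := funext (hGf a i)
    rw [this, ih]

/-- Functions of finite energy with prescribed boundary values are uniformly dense. -/
theorem exists_finiteEnergy_approx [CompactSpace X] (h : IsSimplexGasket f p) {φ : X → ℝ}
    (hφ : Continuous φ) {ε : ℝ} (hε : 0 < ε) :
    ∃ g : X → ℝ, Continuous g ∧ FiniteEnergy (renormEnergy f p) g ∧ (∀ i, g (p i) = φ (p i)) ∧
      ∀ x, |g x - φ x| ≤ ε := by
  obtain ⟨H, hH⟩ := h.exists_harmonic
  obtain ⟨N, hN⟩ := exists_osc_wordMap_le f (K := 1 / 2) (by norm_num) (by norm_num)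
      (fun i x y => (h.dist_map i x y).le) hφ hε
  replace hN := hN N le_rfl
  induction N generalizing φ with
  | zero =>
    -- On a single cell the harmonic interpolation of the corner values works: by the maximum
    -- principle it stays within `ε` of every `φ x`.
    refine ⟨H (φ ∘ p), (hH _).1, ⟨_, fun n => ((hH _).2.2.2.2 n).le⟩, (hH _).2.1, fun x => ?_⟩
    have := (hH (φ ∘ p)).2.2.2.1 (φ x - ε) (φ x + ε) (fun i => by
      have := abs_le.1 (hN Fin.elim0 (p i) x)
      simp only [wordMap, id] at this
      exact ⟨by simp only [Function.comp]; linarith, by simp only [Function.comp]; linarith⟩) x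
    rw [abs_le]
    constructor <;> linarith [this.1, this.2]
  | succ N ih =>
    have : ∀ i, ∃ g : X → ℝ, Continuous g ∧ FiniteEnergy (renormEnergy f p) g ∧
        (∀ j, g (p j) = φ (f i (p j))) ∧ ∀ x, |g x - φ (f i x)| ≤ ε := fun i =>
      ih (hφ.comp (h.continuous_map i)) fun w x y => hN (Fin.cons i w) x y
    choose g hg hgE hgp hgφ using this
    obtain ⟨G, hG, hGf⟩ := h.exists_glue g hg fun i j => by rw [hgp, hgp, h.adj]
    refine ⟨G, hG, ?_, fun i => ?_, fun x => ?_⟩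
    · choose M hM using hgE
      -- Bounding level `n` by level `n + 1` makes the recursion applicable also for `n = 0`.
      refine ⟨((m + 2 : ℝ) / m) * ∑ i, M i, fun n => (h.isFormSeq.mono n G).trans ?_⟩
      rw [renormEnergy_succ]
      have := h.pos
      gcongr with i
      rw [show G ∘ f i = g i from funext (hGf i)]
      exact hM i n
    · rw [← h.fixed i, hGf, hgp]
    · obtain ⟨i, y, rfl⟩ := h.cover x
      rw [hGf]
      exact hgφ i y

end IsSimplexGasket

/-! ### Barycentric coordinates -/

/-- Barycentric coordinates with respect to the initial triangle. -/
def bary (k : Fin 3) (x : Plane) : ℝ :=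
  (![1 - x 0 - x 1 / √3, x 0 - x 1 / √3, 2 * x 1 / √3] : Fin 3 → ℝ) k

theorem continuous_bary (k : Fin 3) : Continuous (bary k) := by
  fin_cases k
  · change Continuous fun x : Plane => 1 - x 0 - x 1 / √3
    fun_prop
  · change Continuous fun x : Plane => x 0 - x 1 / √3
    fun_prop
  · change Continuous fun x : Plane => 2 * x 1 / √3
    fun_prop

theorem bary_combo (k : Fin 3) {a b : ℝ} (hab : a + b = 1) (x y : Plane) :
    bary k (a • x + b • y) = a * bary k x + b * bary k y := by
  obtain rfl : b = 1 - a := by linarith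
  fin_cases k <;> simp [bary] <;> ring

theorem bary_midpoint (k : Fin 3) (x y : Plane) :
    bary k (midpoint ℝ x y) = (bary k x + bary k y) / 2 := by
  have : midpoint ℝ x y = (1 / 2 : ℝ) • x + (1 / 2 : ℝ) • y := by
    rw [midpoint_eq_smul_add, invOf_eq_inv, smul_add, one_div]
  rw [this, bary_combo k (by norm_num)]
  ring

theorem bary_vertex (k j : Fin 3) : bary k (vertex j) = if k = j then 1 else 0 := by
  have h3 : √3 / 2 / √3 = (1 / 2 : ℝ) := by
    have : √(3 : ℝ) ≠ 0 := by positivity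
    field_simp
  have h3' : 2 * (√3 / 2) / √3 = (1 : ℝ) := by
    have : √(3 : ℝ) ≠ 0 := by positivity
    field_simp
  fin_cases k <;> fin_cases j <;> (simp [bary, vertex, h3, h3']; try norm_num)

theorem bary_sum (x : Plane) : bary 0 x + bary 1 x + bary 2 x = 1 := by
  simp only [bary]; simp; ring

theorem bary_ext {x y : Plane} (h : ∀ k, bary k x = bary k y) : x = y := by
  have h1 := h 1
  have h2 := h 2
  simp only [bary] at h1 h2
  simp at h1 h2
  have h3 : √(3 : ℝ) ≠ 0 := by positivity
  have e1 : x 1 = y 1 := h2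
  have e0 : x 0 = y 0 := by
    rw [e1] at h1
    linarith
  ext i
  fin_cases i
  · exact e0
  · exact e1

theorem bary_center (k i j : Fin 3) :
    bary k (center s(i, j)) = ((if k = i then 1 else 0) + if k = j then 1 else 0) / 2 := by
  simp only [center, Sym2.lift_mk, bary_midpoint, bary_vertex]

theorem bary_simil (s : ℝ) (k : Fin 3) (l : Letter) (x : Plane) :
    bary k (simil s l x) = s * bary k x + (1 - s) * bary k (center l) :=
  bary_combo k (by ring) _ _

theorem letter_cases (l : Letter) : l = s(0, 0) ∨ l = s(1, 1) ∨ l = s(2, 2) ∨ l = s(0, 1) ∨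
    l = s(0, 2) ∨ l = s(1, 2) := by
  revert l; decide

theorem joint_cases (e : Joint) : e = ⟨(0, 1), by decide⟩ ∨ e = ⟨(1, 0), by decide⟩ ∨
    e = ⟨(0, 2), by decide⟩ ∨ e = ⟨(2, 0), by decide⟩ ∨ e = ⟨(1, 2), by decide⟩ ∨
    e = ⟨(2, 1), by decide⟩ := by
  revert e; decide

theorem bary_center_nonneg (k : Fin 3) (l : Letter) : 0 ≤ bary k (center l) := by
  induction l using Sym2.ind with | _ i j =>
  rw [bary_center]
  positivity

/-! ### Location of the pieces -/

theorem bary_jointEnd_zero (s : ℝ) (e : Joint) (k : Fin 3) :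
    bary k (jointEnd s e 0) = if k = e.1.1 then 1 - s else if k = e.1.2 then s else 0 := by
  obtain ⟨⟨i, j⟩, hij⟩ := e
  simp only [jointEnd, Matrix.cons_val_zero, bary_simil, bary_center, bary_vertex]
  split_ifs with h1 h2 <;> first | ring1 | simp_all

theorem bary_jointEnd_one (s : ℝ) (e : Joint) (k : Fin 3) :
    bary k (jointEnd s e 1) =
      if k = e.1.1 then (1 + s) / 2 else if k = e.1.2 then (1 - s) / 2 else 0 := by
  obtain ⟨⟨i, j⟩, hij⟩ := e
  simp only [jointEnd, Matrix.cons_val_one, Matrix.cons_val_fin_one, bary_simil, bary_center,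
    bary_vertex]
  split_ifs with h1 h2 <;> first | ring1 | simp_all

theorem bary_gasketVertex (s : ℝ) (j k : Fin 3) :
    bary k (gasketVertex s j) = if k = j then s else (1 - s) / 2 := by
  fin_cases j <;> fin_cases k <;> simp [gasketVertex, bary_simil, bary_center, bary_vertex] <;>
    first | done | ring

theorem bary_interval (s : Ratio) (e : Joint) {x : Plane} (hx : x ∈ interval s e) :
    (1 + s) / 2 ≤ bary e.1.1 x ∧ bary e.1.1 x ≤ 1 - s ∧
      ∀ k, k ≠ e.1.1 → k ≠ e.1.2 → bary k x = 0 := by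
  obtain ⟨a, b, ha, hb, hab, rfl⟩ := hx
  have hs := s.2.2
  refine ⟨?_, ?_, fun k h1 h2 => ?_⟩
  · rw [bary_combo _ hab, bary_jointEnd_zero, bary_jointEnd_one, if_pos rfl, if_pos rfl]
    nlinarith
  · rw [bary_combo _ hab, bary_jointEnd_zero, bary_jointEnd_one, if_pos rfl, if_pos rfl]
    nlinarith
  · rw [bary_combo _ hab, bary_jointEnd_zero, bary_jointEnd_one, if_neg h1, if_neg h1, if_neg h2,
      if_neg h2]
    ring

theorem interval_ext (s : Ratio) (e : Joint) {x y : Plane} (hx : x ∈ interval s e)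
    (hy : y ∈ interval s e) (h : bary e.1.1 x = bary e.1.1 y) : x = y := by
  have hx' := (bary_interval s e hx).2.2
  have hy' := (bary_interval s e hy).2.2
  have sx := bary_sum x
  have sy := bary_sum y
  refine bary_ext fun k => ?_
  rcases joint_cases e with rfl | rfl | rfl | rfl | rfl | rfl <;>
    simp only [Fin.forall_fin_succ, Fin.isValue] at hx' hy' h <;>
    fin_cases k <;> simp at hx' hy' h ⊢ <;> linarith

/-- At a maximum point `x`, the midpoint of `y` and a vertex, the coordinate is at most the average
of the maximum and `(1 - s) / 2`, which bounds the maximum. The lower bound follows because the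
three coordinates sum to 1. -/
theorem bary_gasket (s : Ratio) {x : Plane} (hx : x ∈ gasket s) (k : Fin 3) :
    s ≤ bary k x ∧ bary k x ≤ (1 - s) / 2 := by
  have hs := s.2.2
  have up : ∀ k, ∀ x ∈ gasket s, bary k x ≤ (1 - s) / 2 := by
    intro k
    obtain ⟨x, hx, hmax⟩ := (isAttractor_gasket s).2.1.exists_isMaxOn (isAttractor_gasket s).1
      (continuous_bary k).continuousOn
    have key : bary k x ≤ (1 - s) / 2 := by
      rw [(isAttractor_gasket s).2.2, union_empty, mem_iUnion] at hx
      obtain ⟨j, y, hy, rfl⟩ := hx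
      have h1 : bary k y ≤ bary k (gasketMap s j y) := hmax hy
      rw [gasketMap, bary_midpoint, bary_gasketVertex] at *
      split_ifs at * <;> linarith
    exact fun y hy => (hmax hy).trans key
  have h0 := up 0 x hx
  have h1 := up 1 x hx
  have h2 := up 2 x hx
  have := bary_sum x
  refine ⟨?_, up k x hx⟩
  fin_cases k <;> simp only [Fin.zero_eta, Fin.mk_one, Fin.reduceFinMk] <;> linarith

/-- Minimum principle: a negative minimum inside a cell would be exceeded by `s` times a value no
smaller plus a non-negative term; bonds are checked directly. -/
theorem bary_hybrid (s : Ratio) {x : Plane} (hx : x ∈ hybrid s) (k : Fin 3) : 0 ≤ bary k x := by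
  have hs := s.2.2
  have hs0 := s.2.1
  obtain ⟨x', hx', hmin⟩ := (isAttractor_hybrid s).2.1.exists_isMinOn (isAttractor_hybrid s).1
      (continuous_bary k).continuousOn
  refine le_trans ?_ (hmin hx)
  rw [(isAttractor_hybrid s).2.2] at hx'
  rcases hx' with hx' | hx' | hx'
  · obtain ⟨l, y, hy, rfl⟩ := mem_iUnion.1 hx'
    have h1 : bary k (simil s l y) ≤ bary k y := hmin hy
    rw [bary_simil] at h1 ⊢
    have := bary_center_nonneg k l
    have h2 : 0 ≤ (1 - (s : ℝ)) * bary k (center l) := by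
      apply mul_nonneg _ this; linarith
    have h3 : 0 ≤ bary k y := by
      by_contra hneg
      push Not at hneg
      nlinarith
    have := mul_nonneg hs0.le h3
    linarith
  · obtain ⟨e, he⟩ := mem_iUnion.1 hx'
    obtain ⟨a, b, ha, hb, hab, rfl⟩ := he
    rw [bary_combo _ hab, bary_jointEnd_zero, bary_jointEnd_one]
    have h1 : (0 : ℝ) ≤ 1 - s := by linarith
    have h2 : (0 : ℝ) ≤ (1 + s) / 2 := by linarith
    have h3 : (0 : ℝ) ≤ (1 - s) / 2 := by linarith
    split_ifs <;> positivity
  · exact hs0.le.trans (bary_gasket s hx' k).1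

theorem eq_vertex {x : Plane} {j : Fin 3} (h : ∀ k, k ≠ j → bary k x = 0) : x = vertex j := by
  have := bary_sum x
  refine bary_ext fun k => ?_
  rw [bary_vertex]
  fin_cases j <;> fin_cases k <;> simp [Fin.forall_fin_succ] at h ⊢ <;> linarith

/-- Scaled barycentric coordinates of a point of the hybrid. -/
theorem mul_bary_hybrid (s : Ratio) {x : Plane} (hx : x ∈ hybrid s) :
    (∀ k, 0 ≤ s * bary k x) ∧ s * bary 0 x + s * bary 1 x + s * bary 2 x = s := by
  refine ⟨fun k => mul_nonneg s.2.1.le (bary_hybrid s hx k), ?_⟩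
  rw [← mul_add, ← mul_add, bary_sum, mul_one]

theorem cell_disjoint (s : Ratio) {l l' : Letter} {x y : Plane} (hx : x ∈ hybrid s)
    (hy : y ∈ hybrid s) (h : simil s l x = simil s l' y) : l = l' := by
  by_contra hne
  have h' : ∀ k, s * bary k x + (1 - s) * bary k (center l) =
      s * bary k y + (1 - s) * bary k (center l') := fun k => by
    rw [← bary_simil, ← bary_simil, h]
  obtain ⟨hx0, hxs⟩ := mul_bary_hybrid s hx
  obtain ⟨hy0, hys⟩ := mul_bary_hybrid s hy
  have hs := s.2.2
  have hs0 := s.2.1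
  have a0 := h' 0
  have a1 := h' 1
  have a2 := h' 2
  have x0 := hx0 0
  have x1 := hx0 1
  have x2 := hx0 2
  have y0 := hy0 0
  have y1 := hy0 1
  have y2 := hy0 2
  rcases letter_cases l with rfl | rfl | rfl | rfl | rfl | rfl <;>
    rcases letter_cases l' with rfl | rfl | rfl | rfl | rfl | rfl <;>
    first
    | exact hne rfl
    | (simp only [bary_center, Fin.isValue, Fin.reduceEq, if_true, if_false] at a0 a1 a2
       linarith)

/-- Modulo 3 the indices sum to 0, so `2 * (i + j) = -(i + j)` is the remaining index. -/
theorem third_ne (e : Joint) : 2 * (e.1.1 + e.1.2) ≠ e.1.1 ∧ 2 * (e.1.1 + e.1.2) ≠ e.1.2 := by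
  revert e; decide

theorem eq_vertex_of_mul_bary_le (s : Ratio) {x : Plane} (hx : x ∈ hybrid s) :
    (s * bary 1 x ≤ 0 → s * bary 2 x ≤ 0 → x = vertex 0) ∧
    (s * bary 0 x ≤ 0 → s * bary 2 x ≤ 0 → x = vertex 1) ∧
    (s * bary 0 x ≤ 0 → s * bary 1 x ≤ 0 → x = vertex 2) := by
  have h0 : ∀ k, s * bary k x ≤ 0 → bary k x = 0 := fun k h =>
    (mul_eq_zero.1 (le_antisymm h ((mul_bary_hybrid s hx).1 k))).resolve_left s.2.1.ne'
  refine ⟨fun a b => eq_vertex fun k hk => ?_, fun a b => eq_vertex fun k hk => ?_,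
    fun a b => eq_vertex fun k hk => ?_⟩ <;> fin_cases k <;>
    first | exact absurd rfl hk | exact h0 _ a | exact h0 _ b

/-- The third coordinate vanishes on the bond and the coordinate `e.1.1` lies in `[(1 + s) / 2, 1 -
s]`. All but the two adjacent cells violate this, and those two satisfy it only at a corner. The
products `s * bary k x` serve as atoms for linear arithmetic. -/
theorem cell_inter_interval (s : Ratio) {l : Letter} {x : Plane} (hx : x ∈ hybrid s) {e : Joint}
    (h : simil s l x ∈ interval s e) :
    (l = s(e.1.1, e.1.1) ∧ x = vertex e.1.2) ∨ (l = s(e.1.1, e.1.2) ∧ x = vertex e.1.1) := by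
  obtain ⟨h1, h2, h3⟩ := bary_interval s e h
  replace h3 := h3 _ (third_ne e).1 (third_ne e).2
  simp only [bary_simil] at h1 h2 h3
  obtain ⟨hx0, hxs⟩ := mul_bary_hybrid s hx
  have hs := s.2.2
  have hs0 := s.2.1
  have x0 := hx0 0
  have x1 := hx0 1
  have x2 := hx0 2
  obtain ⟨v0, v1, v2⟩ := eq_vertex_of_mul_bary_le s hx
  rcases joint_cases e with rfl | rfl | rfl | rfl | rfl | rfl <;>
    simp only [Fin.isValue, Fin.reduceAdd, Fin.reduceMul] at h1 h2 h3 ⊢ <;>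
    rcases letter_cases l with rfl | rfl | rfl | rfl | rfl | rfl <;>
    simp only [bary_center, Fin.isValue, Fin.reduceEq, if_true, if_false] at h1 h2 h3 <;>
    first
    | (exfalso; linarith)
    | exact .inl ⟨by decide, v0 (by linarith) (by linarith)⟩
    | exact .inl ⟨by decide, v1 (by linarith) (by linarith)⟩
    | exact .inl ⟨by decide, v2 (by linarith) (by linarith)⟩
    | exact .inr ⟨by decide, v0 (by linarith) (by linarith)⟩
    | exact .inr ⟨by decide, v1 (by linarith) (by linarith)⟩
    | exact .inr ⟨by decide, v2 (by linarith) (by linarith)⟩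

theorem interval_disjoint (s : Ratio) {e e' : Joint} {x : Plane} (h : x ∈ interval s e)
    (h' : x ∈ interval s e') : e = e' := by
  obtain ⟨h1, h2, h3⟩ := bary_interval s e h
  obtain ⟨h1', h2', h3'⟩ := bary_interval s e' h'
  replace h3 := h3 _ (third_ne e).1 (third_ne e).2
  replace h3' := h3' _ (third_ne e').1 (third_ne e').2
  have hx := bary_sum x
  have hs := s.2.2
  have hs0 := s.2.1
  rcases joint_cases e with rfl | rfl | rfl | rfl | rfl | rfl <;>
    simp only [Fin.isValue, Fin.reduceAdd, Fin.reduceMul] at h1 h2 h3 <;>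
    rcases joint_cases e' with rfl | rfl | rfl | rfl | rfl | rfl <;>
    first
    | rfl
    | (exfalso
       simp only [Fin.isValue, Fin.reduceAdd, Fin.reduceMul]
         at h1' h2' h3'
       linarith)

theorem interval_inter_gasket (s : Ratio) {e : Joint} {x : Plane} (h : x ∈ interval s e) :
    x ∉ gasket s := by
  intro h'
  have h2 := (bary_interval s e h).2.2 _ (third_ne e).1 (third_ne e).2
  have h3 := (bary_gasket s h' (2 * (e.1.1 + e.1.2))).1
  have := s.2.1
  linarith

/-- Corner cells have a coordinate above `(1 - s) / 2`. In a middle cell, the coordinate opposite to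
its edge is `s * bary k x`; the lower bound `s` forces `x` to be the vertex `k`. -/
theorem cell_inter_gasket (s : Ratio) {l : Letter} {x : Plane} (hx : x ∈ hybrid s)
    (h : simil s l x ∈ gasket s) : ∃ k : Fin 3, l = s(k + 1, k + 2) ∧ x = vertex k := by
  have b0 := bary_gasket s h 0
  have b1 := bary_gasket s h 1
  have b2 := bary_gasket s h 2
  obtain ⟨hx0, hxs⟩ := mul_bary_hybrid s hx
  have hs := s.2.2
  have hs0 := s.2.1
  have x0 := hx0 0
  have x1 := hx0 1
  have x2 := hx0 2
  obtain ⟨v0, v1, v2⟩ := eq_vertex_of_mul_bary_le s hx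
  simp only [bary_simil] at b0 b1 b2
  rcases letter_cases l with rfl | rfl | rfl | rfl | rfl | rfl <;>
    simp only [bary_center, Fin.isValue, Fin.reduceEq, if_true, if_false] at b0 b1 b2
  · linarith
  · linarith
  · linarith
  · exact ⟨2, by decide, v2 (by linarith) (by linarith)⟩
  · exact ⟨1, by decide, v1 (by linarith) (by linarith)⟩
  · exact ⟨0, by decide, v0 (by linarith) (by linarith)⟩

/-! ### The bonds are segments and gaskets -/

theorem dist_midpoint_right (x y z : Plane) :
    dist (midpoint ℝ x z) (midpoint ℝ y z) = 1 / 2 * dist x y := by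
  have h : midpoint ℝ x z - midpoint ℝ y z = (1 / 2 : ℝ) • (x - y) := by
    simp only [midpoint_eq_smul_add, invOf_eq_inv]
    module
  rw [dist_eq_norm, h, norm_smul, dist_eq_norm]
  norm_num

instance compactSpace_interval (s : ℝ) (e : Joint) : CompactSpace (interval s e) := by
  rw [← isCompact_iff_compactSpace, interval, ← convexHull_pair]
  exact (Set.toFinite _).isCompact_convexHull ℝ

instance compactSpace_gasket (s : ℝ) : CompactSpace (gasket s) :=
  isCompact_iff_compactSpace.1 (isAttractor_gasket s).2.1

instance compactSpace_hybrid (s : Ratio) : CompactSpace (hybrid s) :=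
  isCompact_iff_compactSpace.1 (isAttractor_hybrid s).2.1

theorem isSimplexGasket_interval (s : Ratio) (e : Joint) :
    IsSimplexGasket (intervalHalf s e) (intervalBdry s e) where
  dim := .inl rfl
  dist_map j x y := dist_midpoint_right _ _ _
  cover := by
    rintro ⟨x, a, b, ha, hb, hab, rfl⟩
    rcases le_total (1 / 2) a with h | h
    · refine ⟨0, ⟨(2 * a - 1) • jointEnd s e 0 + (2 * b) • jointEnd s e 1, 2 * a - 1, 2 * b,
        by linarith, by linarith, by linarith, rfl⟩, Subtype.ext ?_⟩
      simp only [intervalHalf, midpoint_eq_smul_add, invOf_eq_inv]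
      module
    · refine ⟨1, ⟨(2 * a) • jointEnd s e 0 + (2 * b - 1) • jointEnd s e 1, 2 * a, 2 * b - 1,
        by linarith, by linarith, by linarith, rfl⟩, Subtype.ext ?_⟩
      simp only [intervalHalf, midpoint_eq_smul_add, invOf_eq_inv]
      module
  fixed i := Subtype.ext (midpoint_self _ _)
  adj i j := Subtype.ext (midpoint_comm _ _)
  overlap := by
    have hs := s.2.2
    have key : ∀ x y : interval s e, intervalHalf s e 0 x = intervalHalf s e 1 y →
        x = intervalBdry s e 1 ∧ y = intervalBdry s e 0 := by
      intro x y hxy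
      have h := congrArg (bary e.1.1) (congrArg Subtype.val hxy)
      simp only [intervalHalf, bary_midpoint, bary_jointEnd_zero, bary_jointEnd_one,
        if_true] at h
      have hx := bary_interval s e x.2
      have hy := bary_interval s e y.2
      refine ⟨Subtype.ext (interval_ext s e x.2 (jointEnd_mem s e 1) ?_),
        Subtype.ext (interval_ext s e y.2 (jointEnd_mem s e 0) ?_)⟩
      · change _ = bary _ (jointEnd s e 1)
        rw [bary_jointEnd_one, if_pos rfl]; linarith
      · change _ = bary _ (jointEnd s e 0)
        rw [bary_jointEnd_zero, if_pos rfl]; linarith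
    intro i j x y hij hxy
    fin_cases i <;> fin_cases j
    · exact absurd rfl hij
    · exact key x y hxy
    · exact (key y x hxy.symm).symm
    · exact absurd rfl hij
  bary := by
    have hs : 0 < (1 - 3 * (s : ℝ)) / 2 := by linarith [s.2.2]
    -- The coordinate `e.1.1` runs over an interval of length `(1 - 3 * s) / 2`, and is rescaled to
    -- `[0, 1]`.
    refine ⟨![fun x => (bary e.1.1 x - (1 + s) / 2) / ((1 - 3 * s) / 2),
      fun x => (1 - s - bary e.1.1 x) / ((1 - 3 * s) / 2)], fun i => ?_, fun i x => ?_,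
      fun x => ?_, fun i j => ?_⟩
    · have := (continuous_bary e.1.1).comp (continuous_subtype_val (p := (· ∈ interval s e)))
      fin_cases i
      · exact (this.sub continuous_const).div_const _
      · exact (continuous_const.sub this).div_const _
    · have := bary_interval s e x.2
      fin_cases i
      · exact div_nonneg (by linarith) hs.le
      · exact div_nonneg (by linarith) hs.le
    · simp only [Fin.sum_univ_two, Matrix.cons_val_zero, Matrix.cons_val_one]
      rw [← add_div, div_eq_one_iff_eq hs.ne']
      ring
    · have b0 : bary e.1.1 (jointEnd s e 0) = 1 - s := by rw [bary_jointEnd_zero, if_pos rfl]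
      have b1 : bary e.1.1 (jointEnd s e 1) = (1 + s) / 2 := by
        rw [bary_jointEnd_one, if_pos rfl]
      fin_cases i <;> fin_cases j
      · change (bary e.1.1 (jointEnd s e 0) - (1 + s) / 2) / ((1 - 3 * s) / 2) = 1
        rw [b0, div_eq_one_iff_eq hs.ne']
        ring
      · change (bary e.1.1 (jointEnd s e 1) - (1 + s) / 2) / ((1 - 3 * s) / 2) = 0
        rw [b1, sub_self, zero_div]
      · change (1 - s - bary e.1.1 (jointEnd s e 0)) / ((1 - 3 * s) / 2) = 0
        rw [b0, sub_self, zero_div]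
      · change (1 - s - bary e.1.1 (jointEnd s e 1)) / ((1 - 3 * s) / 2) = 1
        rw [b1, div_eq_one_iff_eq hs.ne']
        ring

theorem isSimplexGasket_gasket (s : Ratio) :
    IsSimplexGasket (gasketHalf s) (gasketBdry s) where
  dim := .inr rfl
  dist_map j x y := dist_midpoint_right _ _ _
  cover := by
    rintro ⟨x, hx⟩
    have h := hx
    rw [(isAttractor_gasket s).2.2, union_empty, mem_iUnion] at h
    obtain ⟨j, y, hy, rfl⟩ := h
    exact ⟨j, ⟨y, hy⟩, rfl⟩
  fixed i := Subtype.ext (midpoint_self _ _)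
  adj i j := Subtype.ext (midpoint_comm _ _)
  overlap i j x y hij hxy := by
    have hs := s.2.2
    have key : ∀ k, bary k x.1 + bary k (gasketVertex s i) =
        bary k y.1 + bary k (gasketVertex s j) := by
      intro k
      have h := congrArg (bary k) (congrArg Subtype.val hxy)
      simp only [gasketHalf, gasketMap, bary_midpoint] at h
      linarith
    have hx := bary_gasket s x.2
    have hy := bary_gasket s y.2
    -- The other two coordinates are at most `(1 - s) / 2` and the sum is 1, so all bounds are
    -- attained.
    have aux : ∀ (z : gasket s) (j : Fin 3), bary j z.1 ≤ s → z = gasketBdry s j := by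
      intro z j hj
      have hz := bary_gasket s z.2
      have h0 := hz 0
      have h1 := hz 1
      have h2 := hz 2
      have hsum := bary_sum z
      refine Subtype.ext (bary_ext fun k => ?_)
      simp only [gasketBdry, bary_gasketVertex]
      fin_cases j <;> fin_cases k <;> simp at hj ⊢ <;> linarith
    have hi := key i
    have hj := key j
    rw [bary_gasketVertex, bary_gasketVertex, if_pos rfl, if_neg hij] at hi
    rw [bary_gasketVertex, bary_gasketVertex, if_pos rfl, if_neg hij.symm] at hj
    exact ⟨aux x j (by linarith [hy j]), aux y i (by linarith [hx i])⟩
  bary := by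
    have hs : 0 < (1 - 3 * (s : ℝ)) / 2 := by linarith [s.2.2]
    -- The gasket is inverted: the coordinate `k` is smallest, not largest, at its vertex `k`; hence
    -- the reversed sign.
    refine ⟨fun k x => ((1 - s) / 2 - bary k x) / ((1 - 3 * s) / 2), fun i => ?_, fun i x => ?_,
      fun x => ?_, fun i j => ?_⟩
    · exact (continuous_const.sub ((continuous_bary i).comp continuous_subtype_val)).div_const _
    · exact div_nonneg (by linarith [bary_gasket s x.2 i]) hs.le
    · have := bary_sum x
      rw [Fin.sum_univ_three, ← add_div, ← add_div, div_eq_one_iff_eq hs.ne']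
      linarith
    · simp only [gasketBdry, bary_gasketVertex]
      split_ifs
      · rw [div_eq_one_iff_eq hs.ne']; ring
      · simp

/-! ### Gluing on the hybrid -/

theorem dist_cellMap (s : Ratio) (l : Letter) (x y : hybrid s) :
    dist (cellMap s l x) (cellMap s l y) = s * dist x y := by
  have h : simil s l x - simil s l y = (s : ℝ) • ((x : Plane) - y) := by
    simp only [simil]
    module
  change dist (simil s l x) (simil s l y) = _
  rw [dist_eq_norm, h, norm_smul, Real.norm_of_nonneg s.2.1.le, ← dist_eq_norm]
  rfl

theorem continuous_cellMap (s : Ratio) (l : Letter) : Continuous (cellMap s l) :=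
  ((lipschitzWith_simil s l).continuous.comp continuous_subtype_val).subtype_mk _

theorem injective_cellMap (s : Ratio) (l : Letter) : Function.Injective (cellMap s l) := by
  intro x y hxy
  have := dist_cellMap s l x y
  rw [hxy, dist_self] at this
  have hs := s.2.1
  exact dist_le_zero.1 (by nlinarith)

theorem cellMap_corner (s : Ratio) (k : Fin 3) : cellMap s s(k, k) (corner s k) = corner s k := by
  refine Subtype.ext ?_
  simp only [cellMap, corner, simil, center, Sym2.lift_mk, midpoint_self]
  module

/-- A point of the hybrid lies in a cell or in a bond of the first generation. -/
theorem hybrid_cases (s : Ratio) (x : hybrid s) : (∃ l y, x = cellMap s l y) ∨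
    (∃ e y, x = Set.inclusion (interval_subset s e) y) ∨
    ∃ y, x = Set.inclusion (gasket_subset s) y := by
  obtain ⟨x, hx⟩ := x
  have h := hx
  rw [(isAttractor_hybrid s).2.2] at h
  rcases h with h | h | h
  · obtain ⟨l, y, hy, rfl⟩ := mem_iUnion.1 h
    exact .inl ⟨l, ⟨y, hy⟩, rfl⟩
  · obtain ⟨e, he⟩ := mem_iUnion.1 h
    exact .inr (.inl ⟨e, ⟨x, he⟩, rfl⟩)
  · exact .inr (.inr ⟨⟨x, h⟩, rfl⟩)

/-- Distinct cells are disjoint, as are distinct bonds, and a cell meets a bond only in boundary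
points of the bond. The conditions `h0`, `h1`, `h2` are therefore all the compatibility there is. -/
theorem exists_glue_hybrid (s : Ratio) (f : Letter → hybrid s → ℝ) (hf : ∀ l, Continuous (f l))
    (g : ∀ e, interval s e → ℝ) (hg : ∀ e, Continuous (g e)) (h : gasket s → ℝ)
    (hh : Continuous h)
    (h0 : ∀ e, g e (intervalBdry s e 0) = f s(e.1.1, e.1.1) (corner s e.1.2))
    (h1 : ∀ e, g e (intervalBdry s e 1) = f s(e.1.1, e.1.2) (corner s e.1.1))
    (h2 : ∀ k, h (gasketBdry s k) = f s(k + 1, k + 2) (corner s k)) :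
    ∃ G : hybrid s → ℝ, Continuous G ∧ (∀ l, G ∘ cellMap s l = f l) ∧
      (∀ e, onInterval s e G = g e) ∧ onGasket s G = h := by
  have ce := fun e => continuous_inclusion (interval_subset s e)
  have cg := continuous_inclusion (gasket_subset s)
  have ie := fun e => Set.inclusion_injective (interval_subset s e)
  have ig := Set.inclusion_injective (gasket_subset s)
  have ic := injective_cellMap s
  have cell_int : ∀ l e x y, cellMap s l x = Set.inclusion (interval_subset s e) y →
      f l x = g e y := by
    intro l e x y hxy
    have hy : y.1 = simil s l x := (congrArg Subtype.val hxy).symm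
    have hm : simil s l x ∈ interval s e := hy ▸ y.2
    rcases cell_inter_interval s x.2 hm with ⟨rfl, hv⟩ | ⟨rfl, hv⟩
    · obtain rfl : x = corner s e.1.2 := Subtype.ext hv
      obtain rfl : y = intervalBdry s e 0 := Subtype.ext hy
      exact (h0 e).symm
    · obtain rfl : x = corner s e.1.1 := Subtype.ext hv
      obtain rfl : y = intervalBdry s e 1 := Subtype.ext hy
      exact (h1 e).symm
  have cell_gas : ∀ l x y, cellMap s l x = Set.inclusion (gasket_subset s) y → f l x = h y := by
    intro l x y hxy
    have hy : y.1 = simil s l x := (congrArg Subtype.val hxy).symm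
    have hm : simil s l x ∈ gasket s := hy ▸ y.2
    obtain ⟨k, rfl, hv⟩ := cell_inter_gasket s x.2 hm
    obtain rfl : x = corner s k := Subtype.ext hv
    obtain rfl : y = gasketBdry s k := Subtype.ext hy
    exact (h2 k).symm
  obtain ⟨G, hG, hG'⟩ := exists_glue_of_isClosed (ι := Letter ⊕ Joint ⊕ Unit)
    (Sum.elim (fun l => range (cellMap s l))
      (Sum.elim (fun e => range (Set.inclusion (interval_subset s e)))
        fun _ => range (Set.inclusion (gasket_subset s))))
    (by
      rintro (l | e | _)
      · exact (isCompact_range (continuous_cellMap s l)).isClosed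
      · exact (isCompact_range (ce e)).isClosed
      · exact (isCompact_range cg).isClosed)
    (by
      intro x
      rcases hybrid_cases s x with ⟨l, y, rfl⟩ | ⟨e, y, rfl⟩ | ⟨y, rfl⟩
      · exact ⟨.inl l, mem_range_self y⟩
      · exact ⟨.inr (.inl e), mem_range_self y⟩
      · exact ⟨.inr (.inr ()), mem_range_self y⟩)
    (Sum.elim (fun l => Function.extend (cellMap s l) (f l) 0)
      (Sum.elim (fun e => Function.extend (Set.inclusion (interval_subset s e)) (g e) 0)
        fun _ => Function.extend (Set.inclusion (gasket_subset s)) h 0))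
    (by
      rintro (l | e | _)
      · exact continuousOn_range_extend (continuous_cellMap s l) (ic l) (hf l)
      · exact continuousOn_range_extend (ce e) (ie e) (hg e)
      · exact continuousOn_range_extend cg ig hh)
    (by
      rintro (l | e | _) (l' | e' | _) _ ⟨x, rfl⟩ ⟨y, hy⟩ <;>
        simp only [Sum.elim_inl, Sum.elim_inr] at hy ⊢
      · obtain rfl := cell_disjoint s x.2 y.2 (congrArg Subtype.val hy).symm
        rfl
      · rw [(ic l).extend_apply, ← hy, (ie e').extend_apply]
        exact cell_int _ _ _ _ hy.symm
      · rw [(ic l).extend_apply, ← hy, ig.extend_apply]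
        exact cell_gas _ _ _ hy.symm
      · rw [(ie e).extend_apply, ← hy, (ic l').extend_apply]
        exact (cell_int _ _ _ _ hy).symm
      · obtain rfl := interval_disjoint s x.2 ((congrArg Subtype.val hy : y.1 = x.1) ▸ y.2)
        rfl
      · exact absurd ((congrArg Subtype.val hy : y.1 = x.1) ▸ y.2) (interval_inter_gasket s x.2)
      · rw [ig.extend_apply, ← hy, (ic l').extend_apply]
        exact (cell_gas _ _ _ hy).symm
      · exact absurd ((congrArg Subtype.val hy : y.1 = x.1) ▸ x.2) (interval_inter_gasket s y.2))
  refine ⟨G, hG, fun l => funext fun x => ?_, fun e => funext fun x => ?_, funext fun x => ?_⟩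
  · have := hG' (.inl l) _ (mem_range_self x)
    simp only [Sum.elim_inl, (ic l).extend_apply] at this
    exact this
  · have := hG' (.inr (.inl e)) _ (mem_range_self x)
    simp only [Sum.elim_inl, Sum.elim_inr, (ie e).extend_apply] at this
    exact this
  · have := hG' (.inr (.inr ())) _ (mem_range_self x)
    simp only [Sum.elim_inr, ig.extend_apply] at this
    exact this

/-! ### The network of the first level -/

theorem sum_letters (F : Letter → ℝ) : ∑ l, F l =
    F s(0, 0) + F s(1, 1) + F s(2, 2) + F s(0, 1) + F s(0, 2) + F s(1, 2) := by
  have : (Finset.univ : Finset Letter) =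
      {s(0, 0), s(1, 1), s(2, 2), s(0, 1), s(0, 2), s(1, 2)} := by decide
  rw [this, Finset.sum_insert (by decide), Finset.sum_insert (by decide),
    Finset.sum_insert (by decide), Finset.sum_insert (by decide), Finset.sum_insert (by decide),
    Finset.sum_singleton]
  ring

theorem sum_joints (F : Joint → ℝ) : ∑ e, F e =
    F ⟨(0, 1), by decide⟩ + F ⟨(1, 0), by decide⟩ + F ⟨(0, 2), by decide⟩ +
      F ⟨(2, 0), by decide⟩ + F ⟨(1, 2), by decide⟩ + F ⟨(2, 1), by decide⟩ := by
  have : (Finset.univ : Finset Joint) = {⟨(0, 1), by decide⟩, ⟨(1, 0), by decide⟩,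
      ⟨(0, 2), by decide⟩, ⟨(2, 0), by decide⟩, ⟨(1, 2), by decide⟩, ⟨(2, 1), by decide⟩} := by
    decide
  rw [this, Finset.sum_insert (by decide), Finset.sum_insert (by decide),
    Finset.sum_insert (by decide), Finset.sum_insert (by decide), Finset.sum_insert (by decide),
    Finset.sum_singleton]
  ring

/-- The series law; the defect is the square of `B * (x - y) - A * (y - z)`. -/
theorem series_le {A B : ℝ} (hA : 0 < A) (hB : 0 < B) (x y z : ℝ) :
    (x - z) ^ 2 / (A + B) ≤ (x - y) ^ 2 / A + (y - z) ^ 2 / B := by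
  rw [div_add_div _ _ hA.ne' hB.ne', div_le_div_iff₀ (by positivity) (by positivity)]
  nlinarith [sq_nonneg (B * (x - y) - A * (y - z))]

/-- Triangle-star transformation. -/
theorem simplexEnergy_three_eq_star (a : Fin 3 → ℝ) :
    simplexEnergy a = 3 * ((a 0 - (a 0 + a 1 + a 2) / 3) ^ 2 + (a 1 - (a 0 + a 1 + a 2) / 3) ^ 2 +
      (a 2 - (a 0 + a 1 + a 2) / 3) ^ 2) := by
  rw [simplexEnergy_three]; ring

theorem simplexEnergy_three_le_star (a : Fin 3 → ℝ) (m : ℝ) :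
    simplexEnergy a ≤ 3 * ((a 0 - m) ^ 2 + (a 1 - m) ^ 2 + (a 2 - m) ^ 2) := by
  rw [simplexEnergy_three]
  nlinarith [sq_nonneg (a 0 + a 1 + a 2 - 3 * m)]

/-- The left side is the minimum over `d`, attained at `d = b * (u + v) / (a + 2 * b)`. -/
theorem star_elimination {a b : ℝ} (ha : 0 < a) (hb : 0 < b) (u v d : ℝ) :
    (u ^ 2 + v ^ 2) / a - b / (a * (2 * b + a)) * (u + v) ^ 2 ≤
      (u - d) ^ 2 / a + (v - d) ^ 2 / a + d ^ 2 / b := by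
  have h : (u - d) ^ 2 / a + (v - d) ^ 2 / a + d ^ 2 / b -
      ((u ^ 2 + v ^ 2) / a - b / (a * (2 * b + a)) * (u + v) ^ 2) =
      ((a + 2 * b) * d - b * (u + v)) ^ 2 / (a * b * (2 * b + a)) := by
    field_simp
    ring
  have : 0 ≤ ((a + 2 * b) * d - b * (u + v)) ^ 2 / (a * b * (2 * b + a)) := by positivity
  linarith

/-- The three middle nodes are minimized out, then the centre `g`, whose contribution is a multiple
of `(u + v + w - 3 * g) ^ 2`. A star with centre at the mean of `u`, `v`, `w` remains. -/
theorem hexagon_le {a b : ℝ} (ha : 0 < a) (hb : 0 < b) (u v w d₁ d₂ d₃ g : ℝ) :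
    ∃ m, ((u - m) ^ 2 + (v - m) ^ 2 + (w - m) ^ 2) / (a * (a + 2 * b) / (3 * b + 2 * a)) ≤
      ((v - d₁) ^ 2 / a + (w - d₁) ^ 2 / a + (d₁ - g) ^ 2 / b) +
      ((u - d₂) ^ 2 / a + (w - d₂) ^ 2 / a + (d₂ - g) ^ 2 / b) +
      ((u - d₃) ^ 2 / a + (v - d₃) ^ 2 / a + (d₃ - g) ^ 2 / b) := by
  refine ⟨(u + v + w) / 3, ?_⟩
  have h1 := star_elimination ha hb (v - g) (w - g) (d₁ - g)
  have h2 := star_elimination ha hb (u - g) (w - g) (d₂ - g)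
  have h3 := star_elimination ha hb (u - g) (v - g) (d₃ - g)
  simp only [sub_sub_sub_cancel_right] at h1 h2 h3
  refine le_trans ?_ (add_le_add (add_le_add h1 h2) h3)
  have h : ((v - g) ^ 2 + (w - g) ^ 2) / a - b / (a * (2 * b + a)) * (v - g + (w - g)) ^ 2 +
      (((u - g) ^ 2 + (w - g) ^ 2) / a - b / (a * (2 * b + a)) * (u - g + (w - g)) ^ 2) +
      (((u - g) ^ 2 + (v - g) ^ 2) / a - b / (a * (2 * b + a)) * (u - g + (v - g)) ^ 2) -
      ((u - (u + v + w) / 3) ^ 2 + (v - (u + v + w) / 3) ^ 2 + (w - (u + v + w) / 3) ^ 2) /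
        (a * (a + 2 * b) / (3 * b + 2 * a)) =
      2 * (u + v + w - 3 * g) ^ 2 / (3 * (a + 2 * b)) := by
    have h1 : a + 2 * b ≠ 0 := by positivity
    have h2 : 2 * b + a ≠ 0 := by positivity
    have h3 : 3 * b + 2 * a ≠ 0 := by positivity
    rw [show 2 * b + a = a + 2 * b by ring]
    field_simp
    ring
  have : 0 ≤ 2 * (u + v + w - 3 * g) ^ 2 / (3 * (a + 2 * b)) := by positivity
  linarith

/-- The resistance of the sides of the triangle equivalent to the network of the first level, when
the sides of the triangular cells have resistance `ρ` and the edges of the bonds resistance `t`. -/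
def networkResistance (ρ t : ℝ) : ℝ :=
  ρ + (3 * t + 2 * ρ) * (5 * t + 4 * ρ) / (9 * t + 7 * ρ)

theorem networkResistance_pos {ρ t : ℝ} (hρ : 0 < ρ) (ht : 0 < t) : 0 < networkResistance ρ t := by
  unfold networkResistance; positivity

/-- Triangles become stars with legs `ρ / 3` and the gasket a star with legs `t / 3`; series
reduction leaves the network of `hexagon_le`, whose star is extended by the outer legs `ρ / 3`. Each
reduction is used only as an inequality, which is all that monotonicity needs. -/
theorem network_le {ρ t : ℝ} (hρ : 0 < ρ) (ht : 0 < t) (x : Letter → Fin 3 → ℝ) :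
    simplexEnergy (fun k => x s(k, k) k) / networkResistance ρ t ≤
      (∑ l, simplexEnergy (x l)) / ρ +
      (∑ e : Joint, (x s(e.1.1, e.1.1) e.1.2 - x s(e.1.1, e.1.2) e.1.1) ^ 2 +
        simplexEnergy (fun k => x s(k + 1, k + 2) k)) / t := by
  have hρ3 : 0 < ρ / 3 := by positivity
  have ht3 : 0 < t / 3 := by positivity
  -- `a` joins the centres of a corner cell and a middle cell; `b` joins the centre of a middle cell
  -- to that of the gasket.
  set a : ℝ := ρ / 3 + t + ρ / 3 with ha
  set b : ℝ := ρ / 3 + t / 3 with hb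
  have ha0 : 0 < a := by positivity
  have hb0 : 0 < b := by positivity
  set c : Letter → ℝ := fun l => (x l 0 + x l 1 + x l 2) / 3 with hc
  set z : Fin 3 → ℝ := fun k => x s(k + 1, k + 2) k with hz
  set g : ℝ := (z 0 + z 1 + z 2) / 3 with hg
  have hcell : ∀ l, simplexEnergy (x l) / ρ = (x l 0 - c l) ^ 2 / (ρ / 3) +
      (x l 1 - c l) ^ 2 / (ρ / 3) + (x l 2 - c l) ^ 2 / (ρ / 3) := fun l => by
    rw [simplexEnergy_three_eq_star]
    field_simp
    simp only [hc]
    ring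
  have hgas : simplexEnergy z / t = (z 0 - g) ^ 2 / (t / 3) +
      (z 1 - g) ^ 2 / (t / 3) + (z 2 - g) ^ 2 / (t / 3) := by
    rw [simplexEnergy_three_eq_star]
    field_simp
    simp only [hg]
    ring
  have hjoint : ∀ i j : Fin 3, (c s(i, i) - c s(i, j)) ^ 2 / a ≤
      (x s(i, i) j - c s(i, i)) ^ 2 / (ρ / 3) + (x s(i, i) j - x s(i, j) i) ^ 2 / t +
        (x s(i, j) i - c s(i, j)) ^ 2 / (ρ / 3) := fun i j => by
    have h1 := series_le hρ3 ht (c s(i, i)) (x s(i, i) j) (x s(i, j) i)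
    have h2 := series_le (add_pos hρ3 ht) hρ3 (c s(i, i)) (x s(i, j) i) (c s(i, j))
    rw [← neg_sub (x s(i, i) j), neg_sq] at h1
    linarith
  have hleg : ∀ k : Fin 3, (c s(k + 1, k + 2) - g) ^ 2 / b ≤
      (z k - c s(k + 1, k + 2)) ^ 2 / (ρ / 3) + (z k - g) ^ 2 / (t / 3) := fun k => by
    have h1 := series_le hρ3 ht3 (c s(k + 1, k + 2)) (z k) g
    rw [← neg_sub (z k), neg_sq] at h1
    exact h1
  obtain ⟨m, hm⟩ := hexagon_le ha0 hb0 (c s(0, 0)) (c s(1, 1)) (c s(2, 2)) (c s(1, 2)) (c s(0, 2))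
    (c s(0, 1)) g
  set y : ℝ := a * (a + 2 * b) / (3 * b + 2 * a) with hy
  have hy0 : 0 < y := by positivity
  have hR : networkResistance ρ t = 3 * (ρ / 3 + y) := by
    simp only [networkResistance, hy, ha, hb]
    field_simp
    ring
  have hend : ∀ k : Fin 3, (x s(k, k) k - m) ^ 2 / (ρ / 3 + y) ≤
      (x s(k, k) k - c s(k, k)) ^ 2 / (ρ / 3) + (c s(k, k) - m) ^ 2 / y := fun k =>
    series_le hρ3 hy0 _ _ _
  have hfin : simplexEnergy (fun k => x s(k, k) k) / networkResistance ρ t ≤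
      (x s(0, 0) 0 - m) ^ 2 / (ρ / 3 + y) + (x s(1, 1) 1 - m) ^ 2 / (ρ / 3 + y) +
        (x s(2, 2) 2 - m) ^ 2 / (ρ / 3 + y) := by
    rw [hR, ← add_div, ← add_div, div_le_div_iff₀ (by positivity) (by positivity)]
    have := simplexEnergy_three_le_star (fun k => x s(k, k) k) m
    have hp : 0 < ρ / 3 + y := by positivity
    nlinarith
  refine hfin.trans ?_
  have e01 := hjoint 0 1
  have e10 := hjoint 1 0
  have e02 := hjoint 0 2
  have e20 := hjoint 2 0
  have e12 := hjoint 1 2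
  have e21 := hjoint 2 1
  have l0 := hleg 0
  have l1 := hleg 1
  have l2 := hleg 2
  have p0 := hend 0
  have p1 := hend 1
  have p2 := hend 2
  have s10 : (s(1, 0) : Letter) = s(0, 1) := Sym2.eq_swap
  have s20 : (s(2, 0) : Letter) = s(0, 2) := Sym2.eq_swap
  have s21 : (s(2, 1) : Letter) = s(1, 2) := Sym2.eq_swap
  have z0 : (s(0 + 1, 0 + 2) : Letter) = s(1, 2) := rfl
  have z1 : (s(1 + 1, 1 + 2) : Letter) = s(0, 2) := by decide
  have z2 : (s(2 + 1, 2 + 2) : Letter) = s(0, 1) := rfl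
  have hz0 : z 0 = x s(1, 2) 0 := rfl
  have hz1 : z 1 = x s(0, 2) 1 := by simp only [hz]; rw [z1]
  have hz2 : z 2 = x s(0, 1) 2 := rfl
  rw [add_div, hgas, Finset.sum_div, Finset.sum_div, sum_letters, sum_joints]
  simp only [hcell]
  simp only [s10, s20, s21, z0, z1, z2, hz0, hz1, hz2] at *
  simp only [add_div] at hm
  linarith

/-! ### The resistance of the initial triangle -/

theorem baseResistance_pos {r : ℝ} (hr₀ : 0 < r) (hr₁ : r < 7 / 15) : 0 < baseResistance r := by
  have h : |9 - 31 * r| < √(81 + r * (61 * r - 138)) := by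
    refine Real.lt_sqrt_of_sq_lt ?_
    rw [sq_abs]
    nlinarith
  have := (neg_abs_le (9 - 31 * r))
  unfold baseResistance
  exact div_pos (by norm_num) (by linarith)

/-- The base resistance is the positive root of this quadratic, in rationalized form. Positivity of
the leading coefficient `r * (7 - 15 * r)` is where 7/15 enters. -/
theorem baseResistance_eq {r : ℝ} (hr₀ : 0 < r) (hr₁ : r < 7 / 15) :
    15 = baseResistance r * (9 - 31 * r) + baseResistance r ^ 2 * (r * (7 - 15 * r)) := by
  have h : |9 - 31 * r| < √(81 + r * (61 * r - 138)) := by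
    refine Real.lt_sqrt_of_sq_lt ?_
    rw [sq_abs]
    nlinarith
  have h1 := (neg_abs_le (9 - 31 * r))
  have hsq : √(81 + r * (61 * r - 138)) ^ 2 = 81 + r * (61 * r - 138) :=
    Real.sq_sqrt (by nlinarith [sq_nonneg (9 - 31 * r)])
  unfold baseResistance
  set q := √(81 + r * (61 * r - 138)) with hq
  have hd : 9 - 31 * r + q ≠ 0 := by
    have : 0 < 9 - 31 * r + q := by linarith
    exact this.ne'
  field_simp
  nlinarith

theorem networkResistance_one {r : ℝ} (hr₀ : 0 < r) (hr₁ : r < 7 / 15) :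
    networkResistance (baseResistance r * r) 1 = baseResistance r := by
  have hR := baseResistance_pos hr₀ hr₁
  have h := baseResistance_eq hr₀ hr₁
  set R := baseResistance r
  unfold networkResistance
  have : 0 < 9 * 1 + 7 * (R * r) := by positivity
  rw [← eq_sub_iff_add_eq', div_eq_iff this.ne']
  nlinarith

/-- Shorter bonds lower the equivalent resistance strictly; this is the source of the contraction
factor for the triangle part. -/
theorem networkResistance_half_lt {r : ℝ} (hr₀ : 0 < r) (hr₁ : r < 7 / 15) :
    networkResistance (baseResistance r * r) (1 / 2) < baseResistance r := by
  have hR := baseResistance_pos hr₀ hr₁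
  conv_rhs => rw [← networkResistance_one hr₀ hr₁]
  set ρ := baseResistance r * r with hρ
  have hρ0 : 0 < ρ := mul_pos hR hr₀
  unfold networkResistance
  gcongr ρ + ?_
  rw [div_lt_div_iff₀ (by positivity) (by positivity)]
  nlinarith [mul_pos hρ0 hρ0]

/-! ### Recursive structure of the energies -/

theorem intervalEnergyAt_eq (s : Ratio) (e : Joint) :
    intervalEnergyAt s e = renormEnergy (intervalHalf s e) (intervalBdry s e) := by
  funext n u v
  simp only [intervalEnergyAt, renormEnergy]
  norm_num

theorem gasketEnergyAt_eq (s : Ratio) :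
    gasketEnergyAt s = renormEnergy (gasketHalf s) (gasketBdry s) := by
  funext n u v
  simp only [gasketEnergyAt, renormEnergy]
  norm_num

theorem isFormSeq_intervalEnergyAt (s : Ratio) (e : Joint) : IsFormSeq (intervalEnergyAt s e) := by
  rw [intervalEnergyAt_eq]
  exact (isSimplexGasket_interval s e).isFormSeq

theorem isFormSeq_gasketEnergyAt (s : Ratio) : IsFormSeq (gasketEnergyAt s) := by
  rw [gasketEnergyAt_eq]
  exact (isSimplexGasket_gasket s).isFormSeq

theorem energy_eq (s : Ratio) (r : ℝ) (u v : hybrid s → ℝ) :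
    energy s r u v = limForm (energyAt s r) u v := rfl

/-- The `n`-th graph energy of the bonds of the first generation. -/
def bondFormAt (s : Ratio) (n : ℕ) (u v : hybrid s → ℝ) : ℝ :=
  (∑ e : Joint, intervalEnergyAt s e n (onInterval s e u) (onInterval s e v)) +
    gasketEnergyAt s n (onGasket s u) (onGasket s v)

/-- The energy of the bonds of the first generation. -/
def bondForm (s : Ratio) (u v : hybrid s → ℝ) : ℝ :=
  (∑ e : Joint, intervalEnergy s e (onInterval s e u) (onInterval s e v)) +
    gasketEnergy s (onGasket s u) (onGasket s v)

/-- The energy of the triangular cells of level `n`. -/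
def triangleEnergy (s : Ratio) (r : ℝ) (n : ℕ) (u v : hybrid s → ℝ) : ℝ :=
  (baseResistance r * r ^ n)⁻¹ * levelSum (cellMap s) (corner s) n u v

theorem isFormSeq_bondFormAt (s : Ratio) : IsFormSeq (bondFormAt s) where
  graph n := .add (.sum _ fun e _ => ((isFormSeq_intervalEnergyAt s e).graph n).comp _)
    (((isFormSeq_gasketEnergyAt s).graph n).comp _)
  mono n _ := add_le_add
    (Finset.sum_le_sum fun e _ => (isFormSeq_intervalEnergyAt s e).mono n _)
    ((isFormSeq_gasketEnergyAt s).mono n _)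

theorem triangleEnergy_succ (s : Ratio) (r : ℝ) (n : ℕ) (u v : hybrid s → ℝ) :
    triangleEnergy s r (n + 1) u v =
      r⁻¹ * ∑ l, triangleEnergy s r n (u ∘ cellMap s l) (v ∘ cellMap s l) := by
  simp only [triangleEnergy, levelSum_succ, ← Finset.mul_sum, pow_succ, mul_inv]
  ring

theorem bondEnergy_eq (s : Ratio) (r : ℝ) (k : ℕ) (u v : hybrid s → ℝ) :
    bondEnergy s r k u v = ∑ w : Fin k → Letter, (r ^ k)⁻¹ *
      bondForm s (u ∘ wordMap (cellMap s) k w) (v ∘ wordMap (cellMap s) k w) := by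
  simp only [bondEnergy, bondForm, mul_add, Finset.mul_sum]

theorem bondEnergy_zero (s : Ratio) (r : ℝ) (u v : hybrid s → ℝ) :
    bondEnergy s r 0 u v = bondForm s u v := by
  simp [bondEnergy_eq, wordMap]

theorem bondEnergy_succ (s : Ratio) (r : ℝ) (k : ℕ) (u v : hybrid s → ℝ) :
    bondEnergy s r (k + 1) u v =
      r⁻¹ * ∑ l, bondEnergy s r k (u ∘ cellMap s l) (v ∘ cellMap s l) := by
  simp only [bondEnergy_eq, sum_words_succ, wordMap_cons, Finset.mul_sum, pow_succ', mul_inv,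
    mul_assoc]
  rfl

theorem energyAt_eq (s : Ratio) {r : ℝ} (hR : baseResistance r ≠ 0) (n : ℕ) (u v : hybrid s → ℝ) :
    energyAt s r n u v = triangleEnergy s r n u v +
      ∑ k ∈ Finset.range n, ∑ w : Fin k → Letter, (r ^ k)⁻¹ *
        bondFormAt s (n - (k + 1)) (u ∘ wordMap (cellMap s) k w)
          (v ∘ wordMap (cellMap s) k w) := by
  have h2 : ∀ k m : ℕ, (baseResistance r * r ^ k * (baseResistance r)⁻¹ * (1 / 2) ^ m)⁻¹ =
      (r ^ k)⁻¹ * 2 ^ m := fun k m => by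
    rw [mul_right_comm (baseResistance r), mul_inv_cancel₀ hR, one_mul, mul_inv, ← inv_pow (_ / _),
      inv_div, div_one]
  have h3 : ∀ k m : ℕ, (baseResistance r * r ^ k * (baseResistance r)⁻¹ * (3 / 5) ^ m)⁻¹ =
      (r ^ k)⁻¹ * (5 / 3) ^ m := fun k m => by
    rw [mul_right_comm (baseResistance r), mul_inv_cancel₀ hR, one_mul, mul_inv, ← inv_pow (_ / _),
      inv_div]
  simp only [energyAt, graphEnergy, triangleEnergy, bondFormAt, intervalEnergyAt, gasketEnergyAt,
    mul_add, Finset.mul_sum, h2, h3]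
  simp only [mul_assoc]

theorem energyAt_zero (s : Ratio) {r : ℝ} (hR : baseResistance r ≠ 0) (u v : hybrid s → ℝ) :
    energyAt s r 0 u v = triangleEnergy s r 0 u v := by
  simp [energyAt_eq s hR]

/-- The first letter of a word selects a cell of level 1, which rescales the energy by `r⁻¹`; the
empty word contributes the bonds of the first generation. -/
theorem energyAt_succ (s : Ratio) {r : ℝ} (hR : baseResistance r ≠ 0) (n : ℕ)
    (u v : hybrid s → ℝ) :
    energyAt s r (n + 1) u v =
      r⁻¹ * ∑ l, energyAt s r n (u ∘ cellMap s l) (v ∘ cellMap s l) + bondFormAt s n u v := by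
  simp only [energyAt_eq s hR, triangleEnergy_succ, Finset.sum_range_succ', Finset.sum_add_distrib,
    mul_add, add_assoc]
  congr 1
  rw [Finset.sum_comm]
  simp only [sum_words_succ, wordMap_cons, Finset.mul_sum, pow_succ', mul_inv, mul_assoc]
  congr 1
  · refine Finset.sum_congr rfl fun k _ => Finset.sum_congr rfl fun l _ =>
      Finset.sum_congr rfl fun w _ => ?_
    rw [show n + 1 - (k + (1 + 1)) = n - (k + 1) by omega]
    rfl
  · simp [wordMap]

theorem triangleEnergy_zero (s : Ratio) (r : ℝ) (u : hybrid s → ℝ) :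
    triangleEnergy s r 0 u u = simplexEnergy (u ∘ corner s) / baseResistance r := by
  rw [triangleEnergy, levelSum_zero, edgeSum_self, pow_zero, mul_one]
  exact (div_eq_inv_mul _ _).symm

theorem bondFormAt_zero (s : Ratio) (u : hybrid s → ℝ) :
    bondFormAt s 0 u u = ∑ e : Joint, (u (cellMap s s(e.1.1, e.1.1) (corner s e.1.2)) -
        u (cellMap s s(e.1.1, e.1.2) (corner s e.1.1))) ^ 2 +
      simplexEnergy (fun k => u (cellMap s s(k + 1, k + 2) (corner s k))) := by
  simp only [bondFormAt, intervalEnergyAt_eq, gasketEnergyAt_eq, renormEnergy_zero,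
    simplexEnergy_two]
  rfl

/-- The parameter `t` is free: `t = 1` gives monotonicity of the energies, `t = 1 / 2` a prefactor
below 1 at the price of counting the bonds twice. -/
theorem triangleEnergy_zero_le (s : Ratio) {r : ℝ} (hr₀ : 0 < r) (hr₁ : r < 7 / 15) {t : ℝ}
    (ht : 0 < t) (u : hybrid s → ℝ) :
    triangleEnergy s r 0 u u ≤ networkResistance (baseResistance r * r) t / baseResistance r *
      (triangleEnergy s r 1 u u + t⁻¹ * bondFormAt s 0 u u) := by
  have hR := baseResistance_pos hr₀ hr₁
  have h := network_le (mul_pos hR hr₀) ht fun l k => u (cellMap s l (corner s k))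
  rw [div_le_iff₀ (networkResistance_pos (mul_pos hR hr₀) ht)] at h
  rw [triangleEnergy_succ, triangleEnergy_zero, bondFormAt_zero]
  simp only [triangleEnergy_zero, cellMap_corner] at h ⊢
  have e : ∑ l, simplexEnergy ((u ∘ cellMap s l) ∘ corner s) / baseResistance r =
      (∑ l, simplexEnergy (fun k => u (cellMap s l (corner s k)))) / baseResistance r := by
    rw [Finset.sum_div]; rfl
  rw [e, div_le_iff₀ hR]
  refine h.trans (le_of_eq ?_)
  field_simp

theorem isFormSeq_energyAt (s : Ratio) {r : ℝ} (hr₀ : 0 < r) (hr₁ : r < 7 / 15) :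
    IsFormSeq (energyAt s r) where
  graph n := by
    have hR := baseResistance_pos hr₀ hr₁
    have : energyAt s r n = fun u v => triangleEnergy s r n u v +
      ∑ k ∈ Finset.range n, ∑ w : Fin k → Letter, (r ^ k)⁻¹ *
        bondFormAt s (n - (k + 1)) (u ∘ wordMap (cellMap s) k w)
          (v ∘ wordMap (cellMap s) k w) := by
      funext u v
      exact energyAt_eq s hR.ne' n u v
    rw [this]
    exact .add (.smul _ (by positivity) (isGraphForm_levelSum _ _ _))
      (.sum _ fun k _ => .sum _ fun w _ => .smul _ (by positivity)
        (((isFormSeq_bondFormAt s).graph _).comp _))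
  mono n := by
    have hR := baseResistance_pos hr₀ hr₁
    induction n with
    | zero =>
      intro u
      rw [energyAt_succ s hR.ne', energyAt_zero s hR.ne']
      simp only [energyAt_zero s hR.ne']
      rw [← triangleEnergy_succ]
      have := triangleEnergy_zero_le s hr₀ hr₁ one_pos u
      rwa [networkResistance_one hr₀ hr₁, div_self hR.ne', one_mul, inv_one, one_mul] at this
    | succ n ih =>
      intro u
      rw [energyAt_succ s hR.ne', energyAt_succ s hR.ne' (n + 1)]
      gcongr
      · exact ih _
      · exact (isFormSeq_bondFormAt s).mono n u

/-! ### Restriction of functions of finite energy -/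

theorem energyAt_comp_cellMap_le (s : Ratio) {r : ℝ} (hr₀ : 0 < r) (hr₁ : r < 7 / 15) (n : ℕ)
    (u : hybrid s → ℝ) (l : Letter) :
    energyAt s r n (u ∘ cellMap s l) (u ∘ cellMap s l) ≤ r * energyAt s r (n + 1) u u := by
  have hE := isFormSeq_energyAt s hr₀ hr₁
  rw [energyAt_succ s (baseResistance_pos hr₀ hr₁).ne', mul_add, mul_inv_cancel_left₀ hr₀.ne']
  have h1 := Finset.single_le_sum (f := fun l => energyAt s r n (u ∘ cellMap s l) (u ∘ cellMap s l))
    (fun l _ => (hE.graph n).nonneg _) (Finset.mem_univ l)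
  have h2 := mul_nonneg hr₀.le (((isFormSeq_bondFormAt s).graph n).nonneg u)
  linarith

theorem bondFormAt_le_energyAt (s : Ratio) {r : ℝ} (hr₀ : 0 < r) (hr₁ : r < 7 / 15) (n : ℕ)
    (u : hybrid s → ℝ) : bondFormAt s n u u ≤ energyAt s r (n + 1) u u := by
  have hE := isFormSeq_energyAt s hr₀ hr₁
  rw [energyAt_succ s (baseResistance_pos hr₀ hr₁).ne']
  have := mul_nonneg (inv_nonneg.2 hr₀.le) (Finset.sum_nonneg fun l (_ : l ∈ Finset.univ) =>
    (hE.graph n).nonneg (u ∘ cellMap s l))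
  linarith

theorem intervalEnergyAt_le (s : Ratio) (n : ℕ) (u : hybrid s → ℝ) (e : Joint) :
    intervalEnergyAt s e n (onInterval s e u) (onInterval s e u) ≤ bondFormAt s n u u := by
  have h1 := Finset.single_le_sum
    (f := fun e => intervalEnergyAt s e n (onInterval s e u) (onInterval s e u))
    (fun e _ => ((isFormSeq_intervalEnergyAt s e).graph n).nonneg _) (Finset.mem_univ e)
  have h2 := ((isFormSeq_gasketEnergyAt s).graph n).nonneg (onGasket s u)
  simp only [bondFormAt] at h1 ⊢
  linarith

theorem gasketEnergyAt_le (s : Ratio) (n : ℕ) (u : hybrid s → ℝ) :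
    gasketEnergyAt s n (onGasket s u) (onGasket s u) ≤ bondFormAt s n u u := by
  have := Finset.sum_nonneg fun e (_ : e ∈ Finset.univ) =>
    ((isFormSeq_intervalEnergyAt s e).graph n).nonneg (onInterval s e u)
  simp only [bondFormAt]
  linarith

section FiniteEnergy

variable {s : Ratio} {r : ℝ}

theorem finiteEnergy_comp_cellMap (hr₀ : 0 < r) (hr₁ : r < 7 / 15) {u : hybrid s → ℝ}
    (hu : FiniteEnergy (energyAt s r) u) (l : Letter) :
    FiniteEnergy (energyAt s r) (u ∘ cellMap s l) := by
  obtain ⟨M, hM⟩ := hu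
  exact ⟨r * M, fun n => (energyAt_comp_cellMap_le s hr₀ hr₁ n u l).trans
    (mul_le_mul_of_nonneg_left (hM _) hr₀.le)⟩

theorem finiteEnergy_bondFormAt (hr₀ : 0 < r) (hr₁ : r < 7 / 15) {u : hybrid s → ℝ}
    (hu : FiniteEnergy (energyAt s r) u) : FiniteEnergy (bondFormAt s) u := by
  obtain ⟨M, hM⟩ := hu
  exact ⟨M, fun n => (bondFormAt_le_energyAt s hr₀ hr₁ n u).trans (hM _)⟩

theorem finiteEnergy_onInterval {u : hybrid s → ℝ} (hu : FiniteEnergy (bondFormAt s) u)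
    (e : Joint) : FiniteEnergy (intervalEnergyAt s e) (onInterval s e u) := by
  obtain ⟨M, hM⟩ := hu
  exact ⟨M, fun n => (intervalEnergyAt_le s n u e).trans (hM _)⟩

theorem finiteEnergy_onGasket {u : hybrid s → ℝ} (hu : FiniteEnergy (bondFormAt s) u) :
    FiniteEnergy (gasketEnergyAt s) (onGasket s u) := by
  obtain ⟨M, hM⟩ := hu
  exact ⟨M, fun n => (gasketEnergyAt_le s n u).trans (hM _)⟩

theorem finiteEnergy_bondFormAt_iff {u : hybrid s → ℝ} : FiniteEnergy (bondFormAt s) u ↔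
    (∀ e, FiniteEnergy (intervalEnergyAt s e) (onInterval s e u)) ∧
      FiniteEnergy (gasketEnergyAt s) (onGasket s u) := by
  refine ⟨fun h => ⟨finiteEnergy_onInterval h, finiteEnergy_onGasket h⟩, ?_⟩
  rintro ⟨h1, M, hM⟩
  choose N hN using h1
  exact ⟨∑ e, N e + M, fun n => add_le_add (Finset.sum_le_sum fun e _ => hN e n) (hM n)⟩

theorem finiteEnergy_energyAt (hr₀ : 0 < r) (hr₁ : r < 7 / 15) {u : hybrid s → ℝ}
    (h1 : ∀ l, FiniteEnergy (energyAt s r) (u ∘ cellMap s l))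
    (h2 : FiniteEnergy (bondFormAt s) u) : FiniteEnergy (energyAt s r) u := by
  obtain ⟨M, hM⟩ := h2
  choose N hN using h1
  refine ⟨r⁻¹ * ∑ l, N l + M, fun n => ((isFormSeq_energyAt s hr₀ hr₁).mono n u).trans ?_⟩
  rw [energyAt_succ s (baseResistance_pos hr₀ hr₁).ne']
  gcongr
  · exact hN _ _
  · exact hM n

theorem finiteEnergy_comp_wordMap (hr₀ : 0 < r) (hr₁ : r < 7 / 15) {u : hybrid s → ℝ}
    (hu : FiniteEnergy (energyAt s r) u) (n : ℕ) (w : Fin n → Letter) :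
    FiniteEnergy (energyAt s r) (u ∘ wordMap (cellMap s) n w) := by
  induction n generalizing u with
  | zero => exact hu
  | succ n ih => exact ih (finiteEnergy_comp_cellMap hr₀ hr₁ hu (w 0)) (Fin.tail w)

theorem limForm_bondFormAt {u v : hybrid s → ℝ} (hu : FiniteEnergy (bondFormAt s) u)
    (hv : FiniteEnergy (bondFormAt s) v) : limForm (bondFormAt s) u v = bondForm s u v :=
  tendsto_nhds_unique ((isFormSeq_bondFormAt s).tendsto hu hv)
    ((tendsto_finsetSum _ fun e _ => (isFormSeq_intervalEnergyAt s e).tendsto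
      (finiteEnergy_onInterval hu e) (finiteEnergy_onInterval hv e)).add
      ((isFormSeq_gasketEnergyAt s).tendsto (finiteEnergy_onGasket hu) (finiteEnergy_onGasket hv)))

/-- Self-similarity of the limit form. -/
theorem energy_self_similar (hr₀ : 0 < r) (hr₁ : r < 7 / 15) {u v : hybrid s → ℝ}
    (hu : FiniteEnergy (energyAt s r) u) (hv : FiniteEnergy (energyAt s r) v) :
    energy s r u v =
      r⁻¹ * ∑ l, energy s r (u ∘ cellMap s l) (v ∘ cellMap s l) + bondForm s u v := by
  have hE := isFormSeq_energyAt s hr₀ hr₁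
  have hbu := finiteEnergy_bondFormAt hr₀ hr₁ hu
  have hbv := finiteEnergy_bondFormAt hr₀ hr₁ hv
  refine tendsto_nhds_unique ((tendsto_add_atTop_iff_nat 1).2 (hE.tendsto hu hv)) ?_
  simp only [energyAt_succ s (baseResistance_pos hr₀ hr₁).ne']
  rw [← limForm_bondFormAt hbu hbv]
  exact ((tendsto_finsetSum _ fun l _ => hE.tendsto (finiteEnergy_comp_cellMap hr₀ hr₁ hu l)
    (finiteEnergy_comp_cellMap hr₀ hr₁ hv l)).const_mul _).add
    ((isFormSeq_bondFormAt s).tendsto hbu hbv)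

/-! ### Decomposition of the limit form into bond energies -/

theorem bondForm_nonneg {u : hybrid s → ℝ} (hu : FiniteEnergy (bondFormAt s) u) :
    0 ≤ bondForm s u u := by
  rw [← limForm_bondFormAt hu hu]
  exact (isFormSeq_bondFormAt s).limForm_nonneg hu

theorem bondFormAt_le_bondForm {u : hybrid s → ℝ} (hu : FiniteEnergy (bondFormAt s) u) (n : ℕ) :
    bondFormAt s n u u ≤ bondForm s u u := by
  rw [← limForm_bondFormAt hu hu]
  exact (isFormSeq_bondFormAt s).le_limForm hu n

theorem bondEnergy_nonneg (hr₀ : 0 < r) (hr₁ : r < 7 / 15) {u : hybrid s → ℝ}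
    (hu : FiniteEnergy (energyAt s r) u) (k : ℕ) : 0 ≤ bondEnergy s r k u u := by
  rw [bondEnergy_eq]
  exact Finset.sum_nonneg fun w _ => mul_nonneg (by positivity)
    (bondForm_nonneg (finiteEnergy_bondFormAt hr₀ hr₁ (finiteEnergy_comp_wordMap hr₀ hr₁ hu k w)))

theorem sum_bondEnergy_le (hr₀ : 0 < r) (hr₁ : r < 7 / 15) {u : hybrid s → ℝ}
    (hu : FiniteEnergy (energyAt s r) u) (n : ℕ) :
    ∑ k ∈ Finset.range n, bondEnergy s r k u u ≤ energy s r u u := by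
  induction n generalizing u with
  | zero => simpa [energy_eq] using (isFormSeq_energyAt s hr₀ hr₁).limForm_nonneg hu
  | succ n ih =>
    rw [Finset.sum_range_succ', bondEnergy_zero, energy_self_similar hr₀ hr₁ hu hu]
    simp only [bondEnergy_succ, ← Finset.mul_sum]
    rw [Finset.sum_comm]
    gcongr with l
    exact ih (finiteEnergy_comp_cellMap hr₀ hr₁ hu l)

/-- Replacing each graph energy of a bond by its limit only increases it. -/
theorem energyAt_le_triangleEnergy_add (hr₀ : 0 < r) (hr₁ : r < 7 / 15) {u : hybrid s → ℝ}
    (hu : FiniteEnergy (energyAt s r) u) (n : ℕ) :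
    energyAt s r n u u ≤ triangleEnergy s r n u u + ∑ k ∈ Finset.range n, bondEnergy s r k u u := by
  have hR := (baseResistance_pos hr₀ hr₁).ne'
  induction n generalizing u with
  | zero => simp [energyAt_zero s hR]
  | succ n ih =>
    rw [Finset.sum_range_succ', bondEnergy_zero, energyAt_succ s hR, triangleEnergy_succ]
    simp only [bondEnergy_succ, ← Finset.mul_sum]
    rw [Finset.sum_comm, ← add_assoc, ← mul_add, ← Finset.sum_add_distrib]
    gcongr with l
    · exact ih (finiteEnergy_comp_cellMap hr₀ hr₁ hu l)
    · exact bondFormAt_le_bondForm (finiteEnergy_bondFormAt hr₀ hr₁ hu) n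

theorem triangleEnergy_nonneg (hr₀ : 0 < r) (hr₁ : r < 7 / 15) (n : ℕ) (u : hybrid s → ℝ) :
    0 ≤ triangleEnergy s r n u u := by
  have := baseResistance_pos hr₀ hr₁
  exact mul_nonneg (by positivity) ((isGraphForm_levelSum _ _ n).nonneg u)

theorem triangleEnergy_le_energyAt (hr₀ : 0 < r) (hr₁ : r < 7 / 15) (n : ℕ) (u : hybrid s → ℝ) :
    triangleEnergy s r n u u ≤ energyAt s r n u u := by
  have hR := (baseResistance_pos hr₀ hr₁).ne'
  induction n generalizing u with
  | zero => rw [energyAt_zero s hR]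
  | succ n ih =>
    rw [energyAt_succ s hR, triangleEnergy_succ]
    have h1 := ((isFormSeq_bondFormAt s).graph n).nonneg u
    have h2 : r⁻¹ * ∑ l, triangleEnergy s r n (u ∘ cellMap s l) (u ∘ cellMap s l) ≤
        r⁻¹ * ∑ l, energyAt s r n (u ∘ cellMap s l) (u ∘ cellMap s l) := by
      gcongr with l
      exact ih _
    linarith

theorem triangleEnergy_le_succ (hr₀ : 0 < r) (hr₁ : r < 7 / 15) {u : hybrid s → ℝ}
    (hu : FiniteEnergy (energyAt s r) u) (n : ℕ) :
    triangleEnergy s r n u u ≤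
      networkResistance (baseResistance r * r) (1 / 2) / baseResistance r *
        (triangleEnergy s r (n + 1) u u + 2 * bondEnergy s r n u u) := by
  have hR := baseResistance_pos hr₀ hr₁
  have hN := networkResistance_pos (mul_pos hR hr₀) one_half_pos
  induction n generalizing u with
  | zero =>
    refine (triangleEnergy_zero_le s hr₀ hr₁ one_half_pos u).trans ?_
    rw [bondEnergy_zero, show (1 / 2 : ℝ)⁻¹ = 2 by norm_num]
    have hθ := (div_pos hN hR).le
    gcongr
    exact bondFormAt_le_bondForm (finiteEnergy_bondFormAt hr₀ hr₁ hu) 0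
  | succ n ih =>
    rw [triangleEnergy_succ, triangleEnergy_succ s r (n + 1), bondEnergy_succ]
    rw [mul_left_comm 2, ← mul_add, Finset.mul_sum (a := (2 : ℝ)), ← Finset.sum_add_distrib,
      mul_left_comm, Finset.mul_sum (a := _ / baseResistance r)]
    gcongr with l
    exact ih (finiteEnergy_comp_cellMap hr₀ hr₁ hu l)

/-- The inequality bounds `a n` by later terms, so it is iterated forwards; the a priori bound `M`
makes the remainder `θ ^ m * M` negligible. -/
theorem tendsto_zero_of_le_mul_add {a c : ℕ → ℝ} {θ M : ℝ} (hθ0 : 0 ≤ θ) (hθ1 : θ < 1)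
    (ha0 : ∀ n, 0 ≤ a n) (haM : ∀ n, a n ≤ M) (h : ∀ n, a n ≤ θ * (a (n + 1) + c n))
    (hc : Tendsto c atTop (𝓝 0)) : Tendsto a atTop (𝓝 0) := by
  have h1θ : 0 < 1 - θ := by linarith
  rw [Metric.tendsto_atTop]
  intro ε hε
  -- Chosen so that `θ * (ε / 2 + δ) ≤ ε / 2`, since `θ * (2 - θ) ≤ 1`.
  set δ := ε / 2 * (1 - θ) with hδ
  have hδ0 : 0 < δ := by positivity
  obtain ⟨N, hN⟩ := eventually_atTop.1 (hc.eventually_le_const hδ0)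
  have key : ∀ m, ∀ n ≥ N, a n ≤ θ ^ m * M + ε / 2 := by
    intro m
    induction m with
    | zero => intro n _; rw [pow_zero, one_mul]; linarith [haM n]
    | succ m ih =>
      intro n hn
      calc a n ≤ θ * (a (n + 1) + c n) := h n
        _ ≤ θ * (θ ^ m * M + ε / 2 + δ) := by
          gcongr
          · exact ih (n + 1) (by omega)
          · exact hN n hn
        _ ≤ θ ^ (m + 1) * M + ε / 2 := by
          rw [hδ, pow_succ]
          nlinarith [mul_nonneg hε.le (sq_nonneg (1 - θ))]
  refine ⟨N, fun n hn => ?_⟩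
  rw [Real.dist_0_eq_abs, abs_of_nonneg (ha0 n)]
  have ht : Tendsto (fun m => θ ^ m * M + ε / 2) atTop (𝓝 (0 * M + ε / 2)) :=
    ((tendsto_pow_atTop_nhds_zero_of_lt_one hθ0 hθ1).mul_const M).add_const _
  have := ge_of_tendsto' ht fun m => key m n hn
  linarith

theorem summable_bondEnergy_self (hr₀ : 0 < r) (hr₁ : r < 7 / 15) {u : hybrid s → ℝ}
    (hu : FiniteEnergy (energyAt s r) u) : Summable fun k => bondEnergy s r k u u :=
  summable_of_sum_range_le (bondEnergy_nonneg hr₀ hr₁ hu) (sum_bondEnergy_le hr₀ hr₁ hu)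

/-- The triangular cells carry no energy in the limit. -/
theorem tendsto_triangleEnergy (hr₀ : 0 < r) (hr₁ : r < 7 / 15) {u : hybrid s → ℝ}
    (hu : FiniteEnergy (energyAt s r) u) :
    Tendsto (fun n => triangleEnergy s r n u u) atTop (𝓝 0) := by
  have hR := baseResistance_pos hr₀ hr₁
  have hN := networkResistance_pos (mul_pos hR hr₀) one_half_pos
  refine tendsto_zero_of_le_mul_add (div_pos hN hR).le
    ((div_lt_one hR).2 (networkResistance_half_lt hr₀ hr₁))
    (fun n => triangleEnergy_nonneg hr₀ hr₁ n u)
    (fun n => (triangleEnergy_le_energyAt hr₀ hr₁ n u).trans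
      ((isFormSeq_energyAt s hr₀ hr₁).le_limForm hu n))
    (triangleEnergy_le_succ hr₀ hr₁ hu) ?_
  simpa using (summable_bondEnergy_self hr₀ hr₁ hu).tendsto_atTop_zero.const_mul 2

theorem hasSum_bondEnergy_self (hr₀ : 0 < r) (hr₁ : r < 7 / 15) {u : hybrid s → ℝ}
    (hu : FiniteEnergy (energyAt s r) u) :
    HasSum (fun k => bondEnergy s r k u u) (energy s r u u) := by
  have hs := summable_bondEnergy_self hr₀ hr₁ hu
  have h1 : ∑' k, bondEnergy s r k u u ≤ energy s r u u :=
    Real.tsum_le_of_sum_range_le (bondEnergy_nonneg hr₀ hr₁ hu) (sum_bondEnergy_le hr₀ hr₁ hu)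
  have h2 : energy s r u u ≤ 0 + ∑' k, bondEnergy s r k u u := by
    refine le_of_tendsto_of_tendsto' ((isFormSeq_energyAt s hr₀ hr₁).tendsto hu hu)
      ((tendsto_triangleEnergy hr₀ hr₁ hu).add hs.hasSum.tendsto_sum_nat) fun n => ?_
    exact energyAt_le_triangleEnergy_add hr₀ hr₁ hu n
  rw [le_antisymm h2 (by linarith), zero_add]
  exact hs.hasSum

theorem bondForm_polarization {u v : hybrid s → ℝ} (hu : FiniteEnergy (bondFormAt s) u)
    (hv : FiniteEnergy (bondFormAt s) v) :
    bondForm s u v = (bondForm s (u + v) (u + v) - bondForm s (u - v) (u - v)) / 4 := by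
  have h := isFormSeq_bondFormAt s
  have h1 := h.finiteEnergy_add hu hv
  have h2 := h.finiteEnergy_sub hu hv
  rw [← limForm_bondFormAt hu hv, ← limForm_bondFormAt h1 h1, ← limForm_bondFormAt h2 h2]
  exact h.limForm_polarization hu hv

theorem bondEnergy_polarization (hr₀ : 0 < r) (hr₁ : r < 7 / 15) {u v : hybrid s → ℝ}
    (hu : FiniteEnergy (energyAt s r) u) (hv : FiniteEnergy (energyAt s r) v) (k : ℕ) :
    bondEnergy s r k u v =
      (bondEnergy s r k (u + v) (u + v) - bondEnergy s r k (u - v) (u - v)) / 4 := by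
  simp only [bondEnergy_eq, ← Finset.sum_sub_distrib, Finset.sum_div]
  refine Finset.sum_congr rfl fun w _ => ?_
  rw [bondForm_polarization
    (finiteEnergy_bondFormAt hr₀ hr₁ (finiteEnergy_comp_wordMap hr₀ hr₁ hu k w))
    (finiteEnergy_bondFormAt hr₀ hr₁ (finiteEnergy_comp_wordMap hr₀ hr₁ hv k w))]
  simp only [Pi.add_comp, Pi.sub_comp]
  ring

theorem hasSum_bondEnergy (hr₀ : 0 < r) (hr₁ : r < 7 / 15) {u v : hybrid s → ℝ}
    (hu : FiniteEnergy (energyAt s r) u) (hv : FiniteEnergy (energyAt s r) v) :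
    HasSum (fun k => bondEnergy s r k u v) (energy s r u v) := by
  have h := isFormSeq_energyAt s hr₀ hr₁
  simp only [bondEnergy_polarization hr₀ hr₁ hu hv]
  rw [energy_eq, h.limForm_polarization hu hv]
  exact ((hasSum_bondEnergy_self hr₀ hr₁ (h.finiteEnergy_add hu hv)).sub
    (hasSum_bondEnergy_self hr₀ hr₁ (h.finiteEnergy_sub hu hv))).div_const 4

end FiniteEnergy

/-! ### The oscillation estimate -/

/-- Passing from a middle cell to an adjacent corner cell costs at most `3 * B`: one cell, one bond,
one cell. The worst case, the cell opposite to vertex 0, takes three passages. -/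
theorem abs_sub_corner_le (x : Letter → Fin 3 → ℝ) {B : ℝ}
    (h1 : ∀ l a b, |x l a - x l b| ≤ B)
    (h2 : ∀ e : Joint, |x s(e.1.1, e.1.1) e.1.2 - x s(e.1.1, e.1.2) e.1.1| ≤ B)
    (l : Letter) (k : Fin 3) : |x l k - x s(0, 0) 0| ≤ 9 * B := by
  have hB : 0 ≤ B := (abs_nonneg _).trans (h1 s(0, 0) 0 0)
  have hop : ∀ i j : Fin 3, i ≠ j → ∀ a b, |x s(i, j) a - x s(i, i) b| ≤ 3 * B := by
    intro i j hij a b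
    have e1 := h1 s(i, j) a i
    have e2 := h2 ⟨(i, j), hij⟩
    have e3 := h1 s(i, i) j b
    rw [abs_sub_comm] at e2
    have t1 := abs_sub_le (x s(i, j) a) (x s(i, j) i) (x s(i, i) b)
    have t2 := abs_sub_le (x s(i, j) i) (x s(i, i) j) (x s(i, i) b)
    simp only at e2
    linarith
  have two : ∀ j : Fin 3, 0 ≠ j → ∀ a, |x s(j, j) a - x s(0, 0) 0| ≤ 6 * B := by
    intro j hj a
    have e1 := hop j 0 hj.symm 0 a
    have e2 := hop 0 j hj 0 0
    rw [Sym2.eq_swap, abs_sub_comm] at e1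
    have := abs_sub_le (x s(j, j) a) (x s(0, j) 0) (x s(0, 0) 0)
    linarith
  rcases letter_cases l with rfl | rfl | rfl | rfl | rfl | rfl
  · linarith [h1 s(0, 0) k 0]
  · linarith [two 1 (by decide) k]
  · linarith [two 2 (by decide) k]
  · linarith [hop 0 1 (by decide) k 0]
  · linarith [hop 0 2 (by decide) k 0]
  · have e1 := hop 1 2 (by decide) k 0
    have e2 := two 1 (by decide) 0
    have := abs_sub_le (x s(1, 2) k) (x s(1, 1) 0) (x s(0, 0) 0)
    linarith

theorem exists_abs_sub_corner_le (s : Ratio) {r : ℝ} (hr₀ : 0 < r) (hr₁ : r < 7 / 15) :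
    ∃ C, 0 ≤ C ∧ ∀ (M : ℝ) (u : hybrid s → ℝ), 0 ≤ M → Continuous u →
      (∀ n, energyAt s r n u u ≤ M ^ 2) → ∀ x, |u x - u (corner s 0)| ≤ C * M := by
  have hR := baseResistance_pos hr₀ hr₁
  have hE := isFormSeq_energyAt s hr₀ hr₁
  choose Ci hCi0 hCi using fun e => (isSimplexGasket_interval s e).exists_abs_sub_le
  obtain ⟨Cg, hCg0, hCg⟩ := (isSimplexGasket_gasket s).exists_abs_sub_le
  -- Dominates both drops, relative to `M`: `√(baseResistance r * r)` inside a cell and 1 across an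
  -- interval.
  set b := √(baseResistance r * r) + 1 with hb
  have hq1 : √r < 1 := (Real.sqrt_lt' one_pos).2 (by linarith)
  have hsum0 : 0 ≤ ∑ e, Ci e := Finset.sum_nonneg fun e _ => hCi0 e
  set C := ∑ e, Ci e + Cg + 9 * b with hC
  have hC0 : 0 ≤ C := by positivity
  have hvert : ∀ (M : ℝ) (u : hybrid s → ℝ), 0 ≤ M → (∀ n, energyAt s r n u u ≤ M ^ 2) →
      ∀ l k, |u (cellMap s l (corner s k)) - u (corner s 0)| ≤ 9 * b * M := by
    intro M u hM hu l k
    have h0 := bondFormAt_le_energyAt s hr₀ hr₁ 0 u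
    have := abs_sub_corner_le (fun l k => u (cellMap s l (corner s k))) (B := b * M)
      (fun l i j => ?_) (fun e => ?_) l k
    · rw [cellMap_corner] at this
      linarith
    · have h1 := sq_sub_le_simplexEnergy ((u ∘ cellMap s l) ∘ corner s) i j
      have h2 := energyAt_comp_cellMap_le s hr₀ hr₁ 0 u l
      rw [energyAt_zero s hR.ne', triangleEnergy_zero, div_le_iff₀ hR] at h2
      have h3 : (u (cellMap s l (corner s i)) - u (cellMap s l (corner s j))) ^ 2 ≤
          (√(baseResistance r * r) * M) ^ 2 := by
        rw [mul_pow, Real.sq_sqrt (by positivity)]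
        calc _ ≤ _ := h1
          _ ≤ _ := h2
          _ ≤ r * M ^ 2 * baseResistance r := by gcongr; exact hu _
          _ = _ := by ring
      refine (abs_le_of_sq_le_sq h3 (by positivity)).trans ?_
      gcongr
      simp [hb]
    · have h1 := intervalEnergyAt_le s 0 u e
      rw [intervalEnergyAt_eq, renormEnergy_zero, simplexEnergy_two] at h1
      have h3 := abs_le_of_sq_le_sq ((h1.trans h0).trans (hu 1)) hM
      refine le_trans h3 ?_
      have : 1 ≤ b := by simp [hb]
      nlinarith
  refine ⟨C / (1 - √r), by have : 0 < 1 - √r := by linarith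
                           positivity, fun M u hM hu hE' x => ?_⟩
  refine abs_sub_le_of_chain (cellMap s) (corner s 0)
    (fun M u => Continuous u ∧ ∀ n, energyAt s r n u u ≤ M ^ 2)
    (Real.sqrt_nonneg _) hq1 hC0 ?_ ?_ ?_ hM ⟨hu, hE'⟩ x
  · rintro M u l hM ⟨hu, hE'⟩
    refine ⟨hu.comp (continuous_cellMap s l), fun n => ?_⟩
    rw [mul_pow, Real.sq_sqrt hr₀.le]
    exact (energyAt_comp_cellMap_le s hr₀ hr₁ n u l).trans (mul_le_mul_of_nonneg_left (hE' _) hr₀.le)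
  · rintro M u x hM ⟨hu, hE'⟩
    rcases hybrid_cases s x with ⟨l, y, rfl⟩ | ⟨e, y, rfl⟩ | ⟨y, rfl⟩
    · refine Or.inr ⟨l, y, rfl, (hvert M u hM hE' l 0).trans ?_⟩
      gcongr
      rw [hC]; linarith
    · refine Or.inl ?_
      have h1 := hCi e M (onInterval s e u) hM (hu.comp (continuous_inclusion _)) (fun n => by
        rw [← intervalEnergyAt_eq]
        exact ((intervalEnergyAt_le s n u e).trans (bondFormAt_le_energyAt s hr₀ hr₁ n u)).trans
          (hE' _)) y 0
      have h2 := hvert M u hM hE' s(e.1.1, e.1.1) e.1.2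
      have h3 := abs_sub_le (u (Set.inclusion (interval_subset s e) y))
        (u (cellMap s s(e.1.1, e.1.1) (corner s e.1.2))) (u (corner s 0))
      have h4 : Ci e ≤ ∑ e, Ci e := Finset.single_le_sum (fun e _ => hCi0 e) (Finset.mem_univ e)
      have h5 : |u (Set.inclusion (interval_subset s e) y) -
        u (cellMap s s(e.1.1, e.1.1) (corner s e.1.2))| ≤ Ci e * M := h1
      rw [hC]
      nlinarith
    · refine Or.inl ?_
      have h1 := hCg M (onGasket s u) hM (hu.comp (continuous_inclusion _)) (fun n => by
        rw [← gasketEnergyAt_eq]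
        exact ((gasketEnergyAt_le s n u).trans (bondFormAt_le_energyAt s hr₀ hr₁ n u)).trans
          (hE' _)) y 0
      have h2 := hvert M u hM hE' s(0 + 1, 0 + 2) 0
      have h3 := abs_sub_le (u (Set.inclusion (gasket_subset s) y))
        (u (cellMap s s(0 + 1, 0 + 2) (corner s 0))) (u (corner s 0))
      have h5 : |u (Set.inclusion (gasket_subset s) y) -
        u (cellMap s s(0 + 1, 0 + 2) (corner s 0))| ≤ Cg * M := h1
      rw [hC]
      nlinarith
  · rintro M u ⟨hu, -⟩ ε hε
    obtain ⟨N, hN⟩ := exists_osc_wordMap_le (cellMap s) s.2.1.le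
      (s.2.2.trans (by norm_num)) (fun l x y => (dist_cellMap s l x y).le) hu hε
    exact ⟨N, hN N le_rfl⟩

/-! ### Functions constant on cells -/

/-- A function on a segment or a gasket with prescribed boundary values close to those of `φ` is
close to `φ` and of finite energy. -/
theorem IsSimplexGasket.exists_finiteEnergy_near {X : Type*} [MetricSpace X] [CompactSpace X]
    {m : ℕ} {f : Fin m → X → X} {p : Fin m → X} (h : IsSimplexGasket f p) {φ : X → ℝ}
    (hφ : Continuous φ) {a : Fin m → ℝ} {δ ε : ℝ} (ha : ∀ i, |a i - φ (p i)| ≤ δ) (hε : 0 < ε) :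
    ∃ g : X → ℝ, Continuous g ∧ FiniteEnergy (renormEnergy f p) g ∧ (∀ i, g (p i) = a i) ∧
      ∀ x, |g x - φ x| ≤ δ + ε := by
  obtain ⟨H, hH⟩ := h.exists_harmonic
  obtain ⟨hc, hp, -, hr, -⟩ := hH fun i => a i - φ (p i)
  obtain ⟨g, hg, hgE, hgp, hgφ⟩ := h.exists_finiteEnergy_approx (hφ.add hc) hε
  simp only [Pi.add_apply] at hgp hgφ
  refine ⟨g, hg, hgE, fun i => ?_, fun x => ?_⟩
  · rw [hgp, hp]; ring
  · have h1 := hr (-δ) δ (fun i => abs_le.1 (ha i)) x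
    have h2 := abs_le.1 (hgφ x)
    rw [abs_le]
    constructor <;> linarith [h1.1, h1.2, h2.1, h2.2]

/-- Each corner of a cell belongs to at most one bond. The factor 3 comes from the gasket, compared
with the star centred at 0. -/
theorem bondCorner_energy_le (x : Letter → Fin 3 → ℝ) :
    ∑ e : Joint, (x s(e.1.1, e.1.1) e.1.2 - x s(e.1.1, e.1.2) e.1.1) ^ 2 +
      simplexEnergy (fun k => x s(k + 1, k + 2) k) ≤ 3 * ∑ l, ∑ k, x l k ^ 2 := by
  have s10 : (s(1, 0) : Letter) = s(0, 1) := Sym2.eq_swap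
  have s20 : (s(2, 0) : Letter) = s(0, 2) := Sym2.eq_swap
  have s21 : (s(2, 1) : Letter) = s(1, 2) := Sym2.eq_swap
  have z0 : (s(0 + 1, 0 + 2) : Letter) = s(1, 2) := rfl
  have z1 : (s(1 + 1, 1 + 2) : Letter) = s(0, 2) := by decide
  have z2 : (s(2 + 1, 2 + 2) : Letter) = s(0, 1) := rfl
  have hs : ∀ a b : ℝ, (a - b) ^ 2 ≤ 3 * (a ^ 2 + b ^ 2) := fun a b => by
    nlinarith [sq_nonneg (a + b), sq_nonneg a, sq_nonneg b]
  have h3 := simplexEnergy_three_le_star (fun k => x s(k + 1, k + 2) k) 0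
  simp only [sub_zero] at h3
  rw [sum_joints, sum_letters]
  simp only [Fin.sum_univ_three, s10, s20, s21, z0, z1, z2] at h3 ⊢
  linarith [hs (x s(0, 0) 1) (x s(0, 1) 0), hs (x s(1, 1) 0) (x s(0, 1) 1),
    hs (x s(0, 0) 2) (x s(0, 2) 0), hs (x s(2, 2) 0) (x s(0, 2) 2),
    hs (x s(1, 1) 2) (x s(1, 2) 1), hs (x s(2, 2) 1) (x s(1, 2) 2),
    sq_nonneg (x s(0, 0) 0), sq_nonneg (x s(1, 1) 1), sq_nonneg (x s(2, 2) 2)]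

/-- Functions given on the cells of level `1` extend harmonically to the bonds. -/
theorem exists_harmonic_glue (s : Ratio) (f : Letter → hybrid s → ℝ)
    (hf : ∀ l, Continuous (f l)) {δ : ℝ} (hδ : ∀ l x, |f l x| ≤ δ) :
    ∃ W : hybrid s → ℝ, Continuous W ∧ (∀ l, W ∘ cellMap s l = f l) ∧ (∀ x, |W x| ≤ δ) ∧
      ∀ n, bondFormAt s n W W ≤ 3 * ∑ l, ∑ k, f l (corner s k) ^ 2 := by
  choose He hHe using fun e => (isSimplexGasket_interval s e).exists_harmonic
  obtain ⟨Hg, hHg⟩ := (isSimplexGasket_gasket s).exists_harmonic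
  set ae : Joint → Fin 2 → ℝ := fun e =>
    ![f s(e.1.1, e.1.1) (corner s e.1.2), f s(e.1.1, e.1.2) (corner s e.1.1)] with hae
  set ag : Fin 3 → ℝ := fun k => f s(k + 1, k + 2) (corner s k) with hag
  obtain ⟨W, hW, hWc, hWe, hWg⟩ := exists_glue_hybrid s f hf (fun e => He e (ae e))
    (fun e => (hHe e _).1) (Hg ag) (hHg _).1 (fun e => (hHe e _).2.1 0)
    (fun e => (hHe e _).2.1 1) (hHg _).2.1
  refine ⟨W, hW, hWc, fun x => ?_, fun n => ?_⟩
  · rcases hybrid_cases s x with ⟨l, y, rfl⟩ | ⟨e, y, rfl⟩ | ⟨y, rfl⟩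
    · have h1 : W (cellMap s l y) = f l y := congrFun (hWc l) y
      rw [h1]
      exact hδ l y
    · have h1 : W (Set.inclusion (interval_subset s e) y) = He e (ae e) y := congrFun (hWe e) y
      rw [h1, abs_le]
      refine (hHe e (ae e)).2.2.2.1 (-δ) δ (fun i => abs_le.1 ?_) y
      fin_cases i
      · exact hδ _ _
      · exact hδ _ _
    · have h1 : W (Set.inclusion (gasket_subset s) y) = Hg ag y := congrFun hWg y
      rw [h1, abs_le]
      exact (hHg ag).2.2.2.1 (-δ) δ (fun i => abs_le.1 (hδ _ _)) y
  · refine le_trans (le_of_eq ?_) (bondCorner_energy_le fun l k => f l (corner s k))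
    simp only [bondFormAt, hWe, hWg, intervalEnergyAt_eq, gasketEnergyAt_eq, (hHe _ _).2.2.2.2,
      (hHg _).2.2.2.2, simplexEnergy_two]
    rfl

section Density

variable {s : Ratio} {r : ℝ}

/-- A bound for the energy needed to make a function constant on the `n`-cells. -/
def flatteningEnergy (s : Ratio) (r : ℝ) (n : ℕ) (u : hybrid s → ℝ) : ℝ :=
  energy s r u u - ∑ k ∈ Finset.range n, bondEnergy s r k u u +
    3 * baseResistance r * triangleEnergy s r n u u

theorem flatteningEnergy_succ (hr₀ : 0 < r) (hr₁ : r < 7 / 15) {u : hybrid s → ℝ}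
    (hu : FiniteEnergy (energyAt s r) u) (n : ℕ) :
    flatteningEnergy s r (n + 1) u = r⁻¹ * ∑ l, flatteningEnergy s r n (u ∘ cellMap s l) := by
  simp only [flatteningEnergy, Finset.sum_range_succ', bondEnergy_zero, triangleEnergy_succ,
    bondEnergy_succ, Finset.sum_add_distrib, Finset.sum_sub_distrib, ← Finset.mul_sum]
  rw [energy_self_similar hr₀ hr₁ hu hu, Finset.sum_comm]
  ring

theorem tendsto_flatteningEnergy (hr₀ : 0 < r) (hr₁ : r < 7 / 15) {u : hybrid s → ℝ}
    (hu : FiniteEnergy (energyAt s r) u) :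
    Tendsto (fun n => flatteningEnergy s r n u) atTop (𝓝 0) := by
  have h1 := (hasSum_bondEnergy_self hr₀ hr₁ hu).tendsto_sum_nat
  have h2 := (tendsto_triangleEnergy hr₀ hr₁ hu).const_mul (3 * baseResistance r)
  simpa [flatteningEnergy] using (h1.const_sub (energy s r u u)).add h2

/-- A function of finite energy can be made constant on the `n`-cells at the expense of the
flattening energy. -/
theorem exists_flattening (hr₀ : 0 < r) (hr₁ : r < 7 / 15) (n : ℕ) {u : hybrid s → ℝ}
    (huc : Continuous u) (hu : FiniteEnergy (energyAt s r) u) {δ : ℝ}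
    (hδ : ∀ (w : Fin n → Letter) x y,
      |u (wordMap (cellMap s) n w x) - u (wordMap (cellMap s) n w y)| ≤ δ) :
    ∃ W : hybrid s → ℝ, Continuous W ∧ (∀ x, |W x| ≤ δ) ∧
      (∀ (w : Fin n → Letter) x y,
        (u - W) (wordMap (cellMap s) n w x) = (u - W) (wordMap (cellMap s) n w y)) ∧
      ∀ N, energyAt s r N W W + 3 * ∑ k, W (corner s k) ^ 2 ≤ flatteningEnergy s r n u := by
  have hE := isFormSeq_energyAt s hr₀ hr₁
  have hR := baseResistance_pos hr₀ hr₁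
  induction n generalizing u with
  | zero =>
    -- The corner term is `3 * ((u₁ - u₀)² + (u₂ - u₀)²)`, with `uₖ` the value of `u` at corner `k`;
    -- three times the triangle's squared differences dominates it.
    refine ⟨fun x => u x - u (corner s 0), huc.sub continuous_const,
      fun x => hδ Fin.elim0 x (corner s 0), fun w x y => by simp, fun N => ?_⟩
    rw [(hE.graph N).sub_const, flatteningEnergy, triangleEnergy_zero, mul_assoc,
      mul_div_cancel₀ _ hR.ne', simplexEnergy_three, Fin.sum_univ_three]
    have := hE.le_limForm hu N
    rw [← energy_eq] at this
    simp only [Finset.range_zero, Finset.sum_empty, Function.comp]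
    nlinarith [sq_nonneg (u (corner s 1) - u (corner s 2))]
  | succ n ih =>
    have := fun l => ih (huc.comp (continuous_cellMap s l))
      (finiteEnergy_comp_cellMap hr₀ hr₁ hu l) fun w x y => hδ (Fin.cons l w) x y
    choose f hf hfδ hfc hfE using this
    obtain ⟨W, hW, hWc, hWδ, hWE⟩ := exists_harmonic_glue s f hf hfδ
    refine ⟨W, hW, hWδ, fun w x y => ?_, fun N => ?_⟩
    · have h1 := hfc (w 0) (Fin.tail w) x y
      rw [← hWc] at h1
      exact h1
    · rw [flatteningEnergy_succ hr₀ hr₁ hu]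
      have h1 := hE.mono N W
      rw [energyAt_succ s hR.ne'] at h1
      simp only [hWc] at h1
      have h2 := hWE N
      have h3 : ∑ k, W (corner s k) ^ 2 ≤ ∑ l, ∑ k, f l (corner s k) ^ 2 := by
        have e : ∀ k, W (corner s k) = f s(k, k) (corner s k) := fun k => by
          rw [← hWc, Function.comp, cellMap_corner]
        simp only [e, sum_letters, Fin.sum_univ_three]
        have := fun l k => sq_nonneg (f l (corner s k))
        linarith [this s(0, 0) 1, this s(0, 0) 2, this s(1, 1) 0, this s(1, 1) 2, this s(2, 2) 0,
          this s(2, 2) 1, this s(0, 1) 0, this s(0, 1) 1, this s(0, 1) 2, this s(0, 2) 0,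
          this s(0, 2) 1, this s(0, 2) 2, this s(1, 2) 0, this s(1, 2) 1, this s(1, 2) 2]
      have h4 : ∑ l, energyAt s r N (f l) (f l) + 3 * ∑ l, ∑ k, f l (corner s k) ^ 2 ≤
          ∑ l, flatteningEnergy s r n (u ∘ cellMap s l) := by
        rw [Finset.mul_sum, ← Finset.sum_add_distrib]
        exact Finset.sum_le_sum fun l _ => hfE l N
      set D := ∑ l, ∑ k, f l (corner s k) ^ 2
      have hD : 0 ≤ D := Finset.sum_nonneg fun l _ => Finset.sum_nonneg fun k _ => sq_nonneg _
      -- The new bonds cost at most `3 * D`, and the corner term of `W` is again at most `3 * D`.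
      -- The induction hypothesis supplies `r⁻¹ * (3 * D)`, so `r⁻¹ ≥ 2` closes it.
      have hr2 : 2 ≤ r⁻¹ := by
        rw [le_inv_comm₀ two_pos hr₀]
        linarith
      have h5 := mul_le_mul_of_nonneg_left h4 (inv_nonneg.2 hr₀.le)
      rw [mul_add] at h5
      nlinarith

/-! ### Equality of the domains and separation of points -/

theorem mem_domEnergy_iff (hr₀ : 0 < r) (hr₁ : r < 7 / 15) (u : hybrid s → ℝ) :
    u ∈ domEnergy s r ↔ Continuous u ∧ FiniteEnergy (energyAt s r) u :=
  and_congr_right fun _ => ((isFormSeq_energyAt s hr₀ hr₁).finiteEnergy_iff u).symm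

theorem domEnergy_eq (hr₀ : 0 < r) (hr₁ : r < 7 / 15) :
    domEnergy s r = {u | Continuous u ∧ FiniteEnergy (energyAt s r) u} :=
  Set.ext (mem_domEnergy_iff hr₀ hr₁)

theorem exists_osc_cell_le {u : hybrid s → ℝ} (hu : Continuous u) {ε : ℝ} (hε : 0 < ε) :
    ∃ N, ∀ n ≥ N, ∀ (w : Fin n → Letter) x y,
      |u (wordMap (cellMap s) n w x) - u (wordMap (cellMap s) n w y)| ≤ ε :=
  exists_osc_wordMap_le (cellMap s) s.2.1.le (s.2.2.trans (by norm_num))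
    (fun l x y => (dist_cellMap s l x y).le) hu hε

theorem domEnergy_eq_domEnergyTilde (hr₀ : 0 < r) (hr₁ : r < 7 / 15) :
    domEnergy s r = domEnergyTilde s r := by
  have hE := isFormSeq_energyAt s hr₀ hr₁
  refine Subset.antisymm (fun u hu => ⟨hu, ?_⟩) fun u hu => hu.1
  obtain ⟨huc, huE⟩ := (mem_domEnergy_iff hr₀ hr₁ u).1 hu
  have step : ∀ n : ℕ, ∃ W : hybrid s → ℝ, (∃ m, 1 ≤ m ∧ u - W ∈ cellConstant s r m) ∧
      FiniteEnergy (energyAt s r) W ∧ energy s r W W ≤ 1 / ((n : ℝ) + 1) ∧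
      ∀ x, |W x| ≤ 1 / ((n : ℝ) + 1) := by
    intro n
    have hε : 0 < 1 / ((n : ℝ) + 1) := by positivity
    obtain ⟨N, hN⟩ := exists_osc_cell_le huc hε
    -- One level with small oscillation on cells, for pointwise convergence, and small flattening
    -- energy, for convergence in energy.
    obtain ⟨m, hm1, hm2, hm3⟩ := ((eventually_ge_atTop 1).and ((eventually_ge_atTop N).and
      ((tendsto_flatteningEnergy hr₀ hr₁ huE).eventually_le_const hε))).exists
    obtain ⟨W, hW, hWδ, hWc, hWE⟩ := exists_flattening hr₀ hr₁ m huc huE (hN m hm2)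
    have hWle : ∀ N, energyAt s r N W W ≤ 1 / ((n : ℝ) + 1) := fun N => by
      have : 0 ≤ ∑ k, W (corner s k) ^ 2 := Finset.sum_nonneg fun k _ => sq_nonneg _
      linarith [hWE N]
    exact ⟨W, ⟨m, hm1, (mem_domEnergy_iff hr₀ hr₁ _).2
      ⟨huc.sub hW, hE.finiteEnergy_sub huE ⟨_, hWle⟩⟩, hWc⟩, ⟨_, hWle⟩, hE.limForm_le hWle, hWδ⟩
  choose W hW1 hW2 hW3 hW4 using step
  have ht := tendsto_one_div_add_atTop_nhds_zero_nat (𝕜 := ℝ)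
  refine ⟨fun n => u - W n, hW1, ?_, fun x => ?_⟩
  · simp only [sub_sub_cancel]
    exact squeeze_zero (fun n => hE.limForm_nonneg (hW2 n)) hW3 ht
  · have : Tendsto (fun n => W n x) atTop (𝓝 0) := squeeze_zero_norm (fun n => hW4 n x) ht
    simpa using this.const_sub (u x)

/-- Functions of finite energy are uniformly dense. -/
theorem exists_finiteEnergy_near (hr₀ : 0 < r) (hr₁ : r < 7 / 15) (n : ℕ) {φ : hybrid s → ℝ}
    (hφ : Continuous φ) {δ : ℝ} (hδ0 : 0 < δ) (hδ : ∀ (w : Fin n → Letter) x y,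
      |φ (wordMap (cellMap s) n w x) - φ (wordMap (cellMap s) n w y)| ≤ δ) :
    ∃ u : hybrid s → ℝ, Continuous u ∧ FiniteEnergy (energyAt s r) u ∧
      (∀ k, |u (corner s k) - φ (corner s k)| ≤ δ) ∧ ∀ x, |u x - φ x| ≤ δ + δ := by
  have hE := isFormSeq_energyAt s hr₀ hr₁
  induction n generalizing φ with
  | zero =>
    have h := fun x => hδ Fin.elim0 (corner s 0) x
    exact ⟨fun _ => φ (corner s 0), continuous_const, hE.finiteEnergy_const _, fun k => h _,
      fun x => (h x).trans (by linarith)⟩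
  | succ n ih =>
    have := fun l => ih (hφ.comp (continuous_cellMap s l)) fun w x y => hδ (Fin.cons l w) x y
    choose f hf hfE hfc hfφ using this
    -- The error at corners stays at `δ` through all levels, since the corners of the hybrid are
    -- corners of its corner cells. Thus each bond adds `δ` only once and errors do not accumulate.
    have hint : ∀ e, ∃ g : interval s e → ℝ, Continuous g ∧
        FiniteEnergy (intervalEnergyAt s e) g ∧
        (∀ i, g (intervalBdry s e i) = ![f s(e.1.1, e.1.1) (corner s e.1.2),
          f s(e.1.1, e.1.2) (corner s e.1.1)] i) ∧
        ∀ x, |g x - onInterval s e φ x| ≤ δ + δ := fun e => by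
      rw [intervalEnergyAt_eq]
      refine (isSimplexGasket_interval s e).exists_finiteEnergy_near
        (hφ.comp (continuous_inclusion _)) (fun i => ?_) hδ0
      fin_cases i
      · exact hfc s(e.1.1, e.1.1) e.1.2
      · exact hfc s(e.1.1, e.1.2) e.1.1
    choose g hg hgE hgp hgφ using hint
    obtain ⟨h, hh, hhE, hhp, hhφ⟩ := (isSimplexGasket_gasket s).exists_finiteEnergy_near
      (φ := onGasket s φ) (a := fun k => f s(k + 1, k + 2) (corner s k))
      (hφ.comp (continuous_inclusion _)) (fun k => hfc s(k + 1, k + 2) k) hδ0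
    obtain ⟨u, hu, huc, hue, hug⟩ := exists_glue_hybrid s f hf g hg h hh (fun e => hgp e 0)
      (fun e => hgp e 1) hhp
    refine ⟨u, hu, finiteEnergy_energyAt hr₀ hr₁ (fun l => ?_)
      (finiteEnergy_bondFormAt_iff.2 ⟨fun e => ?_, ?_⟩), fun k => ?_, fun x => ?_⟩
    · rw [huc]; exact hfE l
    · rw [hue]; exact hgE e
    · rw [hug, gasketEnergyAt_eq]; exact hhE
    · have h1 := hfc s(k, k) k
      rw [← huc] at h1
      simpa only [Function.comp, cellMap_corner] using h1
    · rcases hybrid_cases s x with ⟨l, y, rfl⟩ | ⟨e, y, rfl⟩ | ⟨y, rfl⟩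
      · have h1 := hfφ l y
        rw [← huc] at h1
        exact h1
      · have h1 := hgφ e y
        rw [← hue] at h1
        exact h1
      · have h1 := hhφ y
        rw [← hug] at h1
        exact h1

theorem isResistanceForm_energy (hr₀ : 0 < r) (hr₁ : r < 7 / 15) :
    IsResistanceForm (energy s r) (domEnergy s r) := by
  have hE := isFormSeq_energyAt s hr₀ hr₁
  have : Nonempty (hybrid s) := ⟨corner s 0⟩
  obtain ⟨C, hC0, hC⟩ := exists_abs_sub_corner_le s hr₀ hr₁
  rw [domEnergy_eq hr₀ hr₁]
  refine hE.isResistanceForm (2 * C) (fun M u hM hu hb x y => ?_) fun x y hxy => ?_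
  · have h1 := hC M u hM hu hb x
    have h2 := hC M u hM hu hb y
    rw [abs_sub_comm] at h2
    have := abs_sub_le (u x) (u (corner s 0)) (u y)
    linarith
  · have hd : 0 < dist y x := dist_pos.2 hxy.symm
    have hφ : Continuous fun z : hybrid s => dist z x := continuous_id.dist continuous_const
    -- With `δ = dist y x / 5` the errors at `x` and `y` total at most `4 * δ < dist y x`, so the
    -- approximation of the distance to `x` still separates them.
    obtain ⟨N, hN⟩ := exists_osc_cell_le hφ (show 0 < dist y x / 5 by positivity)
    obtain ⟨u, hu, huE, -, huφ⟩ := exists_finiteEnergy_near hr₀ hr₁ N hφ (by positivity)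
      (hN N le_rfl)
    refine ⟨u, hu, huE, fun h => ?_⟩
    have h1 := abs_le.1 (huφ x)
    have h2 := abs_le.1 (huφ y)
    simp only [dist_self] at h1
    linarith [h1.2, h2.1]

end Density

end HybridGasket

end

/-- The first group of conjuncts says that the limits and series defining the two forms converge
on their domains; then both are resistance forms, and they coincide. -/
theorem theorem2p5 (s : Ratio) (r : ℝ) (hr₀ : 0 < r) (hr₁ : r < 7 / 15) :
    (∀ u ∈ domEnergy s r, ∀ v ∈ domEnergy s r,
      Tendsto (fun n => energyAt s r n u v) atTop (𝓝 (energy s r u v)) ∧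
      (∀ (k : ℕ) (w : Fin k → Letter),
        (∀ e : Joint, Tendsto (fun n => intervalEnergyAt s e n
            (onInterval s e (u ∘ wordMap (cellMap s) k w))
            (onInterval s e (v ∘ wordMap (cellMap s) k w))) atTop
          (𝓝 (intervalEnergy s e
            (onInterval s e (u ∘ wordMap (cellMap s) k w))
            (onInterval s e (v ∘ wordMap (cellMap s) k w))))) ∧
        Tendsto (fun n => gasketEnergyAt s n
            (onGasket s (u ∘ wordMap (cellMap s) k w))
            (onGasket s (v ∘ wordMap (cellMap s) k w))) atTop
          (𝓝 (gasketEnergy s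
            (onGasket s (u ∘ wordMap (cellMap s) k w))
            (onGasket s (v ∘ wordMap (cellMap s) k w))))) ∧
      Summable (fun k => bondEnergy s r k u v)) ∧
    IsResistanceForm (energy s r) (domEnergy s r) ∧
    IsResistanceForm (energyTilde s r) (domEnergyTilde s r) ∧
    domEnergy s r = domEnergyTilde s r ∧
    (∀ u ∈ domEnergy s r, ∀ v ∈ domEnergy s r, energy s r u v = energyTilde s r u v) := by
  have hE := isFormSeq_energyAt s hr₀ hr₁
  have hdom := domEnergy_eq_domEnergyTilde (s := s) hr₀ hr₁
  have hfin : ∀ u ∈ domEnergy s r, FiniteEnergy (energyAt s r) u := fun u hu =>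
    ((mem_domEnergy_iff hr₀ hr₁ u).1 hu).2
  have heq : ∀ u ∈ domEnergy s r, ∀ v ∈ domEnergy s r, energy s r u v = energyTilde s r u v :=
    fun u hu v hv => (hasSum_bondEnergy hr₀ hr₁ (hfin u hu) (hfin v hv)).tsum_eq.symm
  have hres := isResistanceForm_energy (s := s) hr₀ hr₁
  refine ⟨fun u hu v hv => ⟨hE.tendsto (hfin u hu) (hfin v hv), fun k w => ?_,
    (hasSum_bondEnergy hr₀ hr₁ (hfin u hu) (hfin v hv)).summable⟩, hres,
    hdom ▸ hres.congr heq, hdom, heq⟩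
  have hu' := finiteEnergy_bondFormAt hr₀ hr₁ (finiteEnergy_comp_wordMap hr₀ hr₁ (hfin u hu) k w)
  have hv' := finiteEnergy_bondFormAt hr₀ hr₁ (finiteEnergy_comp_wordMap hr₀ hr₁ (hfin v hv) k w)
  exact ⟨fun e => (isFormSeq_intervalEnergyAt s e).tendsto (finiteEnergy_onInterval hu' e)
    (finiteEnergy_onInterval hv' e), (isFormSeq_gasketEnergyAt s).tendsto
    (finiteEnergy_onGasket hu') (finiteEnergy_onGasket hv')⟩
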